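/- Let $k$ be a field of characteristic $0$ and let $\mathfrak a$ be a Lie algebra over $k$ with a finite basis $(e_1,\dots,e_n)$ and structure constants $C_{i,j}^a$, so that $[e_i,e_j]=\sum_{a}C_{i,j}^a e_a$. Let $T=k\langle e_1,\dots,e_n\rangle[[h]]$ be the $h$-adically complete tensor algebra over $k[[h]]$ of the free module $\bigoplus_i k[[h]]e_i$. For a polynomial $P=\sum_m a_m X_1^{m_1}\cdots X_n^{m_n}$ put $P^{\otimes}=\sum_m a_m e_1^{\otimes m_1}\otimes\cdots\otimes e_n^{\otimes m_n}$, and for $g=\sum_r P_r h^r\in k[X_1,\dots,X_n][[h]]$ put $g^{\otimes}=\sum_r P_r^{\otimes}h^r\in T$. For $1\le i,j\le n$ let $g_{i,j}\in k[X_1,\dots,X_n][[h]]$ have no monomials of degree $0$ in $X$ and satisfy $g_{i,j}^{\otimes}\equiv\sum_a C_{i,j}^a e_a \pmod{hT}$. Let $$U_h(\mathfrak a)=T/I,$$ where $I$ is the closure, in the $h$-adic topology, of the two-sided ideal generated by the elements $e_i\otimes e_j-e_j\otimes e_i-g_{i,j}^{\otimes}$. Assume that $U_h(\mathfrak a)$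 is a deformation of $U(\mathfrak a)$, i.e. it is topologically free (isomorphic as a $k[[h]]$-module to $V[[h]]$ for some $k$-vector space $V$) and $U_h(\mathfrak a)/hU_h(\mathfrak a)\simeq U(\mathfrak a)$ as $k$-algebras. Then there is exactly one $k[[h]]$-algebra morphism $\varepsilon:U_h(\mathfrak a)\to k[[h]]$ with $\varepsilon(e_i)=0$ for all $i$; it makes $k[[h]]$ a $U_h(\mathfrak a)$-module, called trivial. There are $U_h(\mathfrak a)$-linear maps $\partial^h_{q}:U_h(\mathfrak a)\otimes_k\wedge^{q}\mathfrak a\to U_h(\mathfrak a)\otimes_k\wedge^{q-1}\mathfrak a$ ($q\ge1$) such that $$\cdots\to U_h(\mathfrak a)\otimes_k\wedge^2\mathfrak a\xrightarrow{\partial_2^h}U_h(\mathfrak a)\otimes_k\mathfrak a\xrightarrow{\partial_1^h}U_h(\mathfrak a)\xrightarrow{\varepsilon}k[[h]]\to0$$ is exact, and the associated graded complex for the $h$-adic filtrations, $\operatorname{Gr}M=\bigoplus_{t\ge0}h^tM/h^{t+1}M$, is the Koszul (Chevalley–Eilenberg) resolution of the trivial $U(\mathfrak a)[h]$-module $k[h]$.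 The last statement means the following. There is an isomorphism of graded $k$-algebras $\operatorname{Gr}U_h(\mathfrak a)\simeq U(\mathfrak a)[h]$ that sends the class of $e_i$ in degree $0$ to $e_i$ and the class of $h$ in degree $1$ to $h$. There are compatible additive isomorphisms $\operatorname{Gr}(U_h(\mathfrak a)\otimes_k\wedge^q\mathfrak a)\simeq U(\mathfrak a)[h]\otimes_k\wedge^q\mathfrak a$ and $\operatorname{Gr}k[[h]]\simeq k[h]$, semilinear over it, that send the class of $1\otimes\omega$ to $1\otimes\omega$ and the class of $1$ to $1$. Under these, $\operatorname{Gr}\partial^h_q$ corresponds to $$\begin{aligned}\partial_q(u\otimes X_1\wedge\cdots\wedge X_q)={}&\sum_{i}(-1)^{i-1}uX_i\otimes X_1\wedge\cdots\widehat{X_i}\cdots\wedge X_q\\&+\sum_{i<j}(-1)^{i+j}u\otimes[X_i,X_j]\wedge X_1\wedge\cdots\widehat{X_i}\cdots\widehat{X_j}\cdots\wedge X_q,\end{aligned}$$ and $\operatorname{Gr}\varepsilon$ corresponds to the augmentation $U(\mathfrak a)[h]\to k[h]$ killing $\mathfrak a$. The complex $(U(\mathfrak a)[h]\otimes_k\wedge^\bullet\mathfrak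 a,\partial_\bullet)$ with this augmentation is itself a resolution of the trivial module $k[h]$. -/

import Mathlib

open scoped DirectSum TensorProduct PowerSeries Polynomial

noncomputable section

namespace QKoszul

/-! ### The filtration by powers of a central element and its associated graded object -/

section Graded

variable {S : Type*} [CommRing S] (h : S)

/-- `F_t M = h ^ t M`. -/
def hFilt (M : Type*) [AddCommGroup M] [Module S M] (t : ℕ) : Submodule S M :=
  LinearMap.range (LinearMap.lsmul S M (h ^ t))

/-- `G_t M = h ^ t M / h ^ (t + 1) M`. -/
abbrev GrPiece (M : Type*) [AddCommGroup M] [Module S M] (t : ℕ) : Type _ :=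
  hFilt h M t ⧸ (hFilt h M (t + 1)).submoduleOf (hFilt h M t)

/-- The associated graded module `Gr M = ⨁ t, h ^ t M / h ^ (t + 1) M`. -/
abbrev Gr (M : Type*) [AddCommGroup M] [Module S M] : Type _ := ⨁ t : ℕ, GrPiece h M t

section Module

variable {M : Type*} [AddCommGroup M] [Module S M]

/-- The class of an element of `F_t M` in `G_t M`. -/
def grMk (t : ℕ) (m : hFilt h M t) : GrPiece h M t := Submodule.Quotient.mk m

theorem grMk_surjective (t : ℕ) : Function.Surjective (grMk h (M := M) t) :=
  Submodule.Quotient.mk_surjective _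

theorem pow_smul_mem_hFilt (t : ℕ) (m : M) : h ^ t • m ∈ hFilt h M t := ⟨m, rfl⟩

/-- The class of `h ^ t m` in degree `t` of `Gr M`. -/
def grSymb (t : ℕ) (m : M) : Gr h M :=
  DirectSum.of (GrPiece h M) t (grMk h t ⟨h ^ t • m, pow_smul_mem_hFilt h t m⟩)

theorem map_mem_hFilt {N : Type*} [AddCommGroup N] [Module S N] (f : M →ₗ[S] N) (t : ℕ) (m : M)
    (hm : m ∈ hFilt h M t) : f m ∈ hFilt h N t := by
  obtain ⟨x, rfl⟩ := hm
  exact ⟨f x, by simp⟩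

/-- The map `F_t M / F_{t+1} M → F_t N / F_{t+1} N` induced by a linear map. -/
def grPieceMap {N : Type*} [AddCommGroup N] [Module S N] (f : M →ₗ[S] N) (t : ℕ) :
    GrPiece h M t →ₗ[S] GrPiece h N t :=
  Submodule.mapQ _ _ (f.restrict (p := hFilt h M t) (q := hFilt h N t)
    (fun m hm => map_mem_hFilt h f t m hm))
    (fun m hm => map_mem_hFilt h f (t + 1) m hm)

/-- The map `Gr f : Gr M → Gr N` induced by a linear map `f : M → N`. -/
def grMap {N : Type*} [AddCommGroup N] [Module S N] (f : M →ₗ[S] N) : Gr h M →+ Gr h N :=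
  DirectSum.map (fun t => (grPieceMap h f t).toAddMonoidHom)

end Module

variable {A : Type*} [Ring A] [Algebra S A]
variable {M : Type*} [AddCommGroup M] [Module S M] [Module A M] [IsScalarTower S A M]

theorem smul_mem_hFilt {s t : ℕ} {a : A} {m : M} (ha : a ∈ hFilt h A s) (hm : m ∈ hFilt h M t) :
    a • m ∈ hFilt h M (s + t) := by
  obtain ⟨a, rfl⟩ := ha
  obtain ⟨m, rfl⟩ := hm
  refine ⟨a • m, ?_⟩
  have hc : a • (h ^ t • m) = h ^ t • (a • m) := by
    rw [← algebraMap_smul A (h ^ t) m, ← algebraMap_smul A (h ^ t) (a • m), smul_smul, smul_smul,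
      Algebra.commutes]
  simp only [LinearMap.lsmul_apply, smul_assoc, hc, smul_smul, pow_add]

/-- `[a] • [m] = [a • m]`, for `[a] ∈ G_s A` and `[m] ∈ G_t M`. -/
def grSMul {s t : ℕ} : GrPiece h A s → GrPiece h M t → GrPiece h M (s + t) :=
  Quotient.map₂ (fun a m => ⟨a.1 • m.1, smul_mem_hFilt h a.2 m.2⟩) (by
    intro a a' ha m m' hm
    have ha : a - a' ∈ (hFilt h A (s + 1)).submoduleOf (hFilt h A s) :=
      (Submodule.quotientRel_def _).1 ha
    have hm : m - m' ∈ (hFilt h M (t + 1)).submoduleOf (hFilt h M t) :=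
      (Submodule.quotientRel_def _).1 hm
    refine (Submodule.quotientRel_def _).2 ?_
    have ha : a.1 - a'.1 ∈ hFilt h A (s + 1) := ha
    have hm : m.1 - m'.1 ∈ hFilt h M (t + 1) := hm
    show a.1 • m.1 - a'.1 • m'.1 ∈ hFilt h M (s + t + 1)
    have h1 := smul_mem_hFilt h ha m.2
    have h2 := smul_mem_hFilt h a'.2 hm
    rw [show s + 1 + t = s + t + 1 by omega] at h1
    have h3 := add_mem h1 h2
    rwa [sub_smul, smul_sub, sub_add_sub_cancel] at h3)

theorem grSMul_mk {s t : ℕ} (a : hFilt h A s) (m : hFilt h M t) :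
    grSMul h (grMk h s a) (grMk h t m) =
      grMk h (s + t) ⟨a.1 • m.1, smul_mem_hFilt h a.2 m.2⟩ := rfl

theorem grMk_add (t : ℕ) (m m' : hFilt h M t) : grMk h t (m + m') = grMk h t m + grMk h t m' := rfl

theorem gradedMk_congr {s t : ℕ} (hst : s = t) {m : hFilt h M s} {m' : hFilt h M t}
    (hm : m.1 = m'.1) :
    (⟨s, grMk h s m⟩ : GradedMonoid (GrPiece h M)) = ⟨t, grMk h t m'⟩ := by
  subst hst
  rw [Subtype.ext hm]

theorem grSMul_add {s t : ℕ} (a : GrPiece h A s) (m m' : GrPiece h M t) :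
    grSMul h a (m + m') = grSMul h a m + grSMul h a m' := by
  obtain ⟨a, rfl⟩ := grMk_surjective h s a
  obtain ⟨m, rfl⟩ := grMk_surjective h t m
  obtain ⟨m', rfl⟩ := grMk_surjective h t m'
  simp only [← grMk_add, grSMul_mk]
  congr 1
  exact Subtype.ext (smul_add _ _ _)

theorem add_grSMul {s t : ℕ} (a a' : GrPiece h A s) (m : GrPiece h M t) :
    grSMul h (a + a') m = grSMul h a m + grSMul h a' m := by
  obtain ⟨a, rfl⟩ := grMk_surjective h s a
  obtain ⟨a', rfl⟩ := grMk_surjective h s a'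
  obtain ⟨m, rfl⟩ := grMk_surjective h t m
  simp only [← grMk_add, grSMul_mk]
  congr 1
  exact Subtype.ext (add_smul _ _ _)

theorem grSMul_zero {s t : ℕ} (a : GrPiece h A s) : grSMul h a (0 : GrPiece h M t) = 0 := by
  have := grSMul_add h a (0 : GrPiece h M t) 0
  simpa using this

theorem zero_grSMul {s t : ℕ} (m : GrPiece h M t) : grSMul h (0 : GrPiece h A s) m = 0 := by
  have := add_grSMul h (0 : GrPiece h A s) 0 m
  simpa using this

variable (A) in
/-- The class of `1` in `G_0 A`. -/
def grOne : GrPiece h A 0 := grMk h 0 ⟨1, 1, by simp⟩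

instance : GradedMonoid.GMul (GrPiece h A) := ⟨fun a b => grSMul h a b⟩

instance : GradedMonoid.GOne (GrPiece h A) := ⟨grOne h A⟩

/-- `Gr A` is a graded ring with product `[a] [b] = [a b]`. -/
instance grGSemiring : DirectSum.GSemiring (GrPiece h A) where
  mul_zero a := grSMul_zero h a
  zero_mul b := zero_grSMul h b
  mul_add a b c := grSMul_add h a b c
  add_mul a b c := add_grSMul h a b c
  one_mul := by
    rintro ⟨t, a⟩
    obtain ⟨a, rfl⟩ := grMk_surjective h t a
    exact gradedMk_congr h (zero_add t) (one_mul _)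
  mul_one := by
    rintro ⟨t, a⟩
    obtain ⟨a, rfl⟩ := grMk_surjective h t a
    exact gradedMk_congr h (add_zero t) (mul_one _)
  mul_assoc := by
    rintro ⟨r, a⟩ ⟨s, b⟩ ⟨t, c⟩
    obtain ⟨a, rfl⟩ := grMk_surjective h r a
    obtain ⟨b, rfl⟩ := grMk_surjective h s b
    obtain ⟨c, rfl⟩ := grMk_surjective h t c
    exact gradedMk_congr h (add_assoc r s t) (mul_assoc _ _ _)
  natCast n := n • grOne h A
  natCast_zero := zero_smul _ _
  natCast_succ n := succ_nsmul _ _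

/-- `Gr M` is a graded `Gr A`-module with action `[a] • [m] = [a • m]`. -/
instance grGmodule : DirectSum.Gmodule (GrPiece h A) (GrPiece h M) where
  smul a m := grSMul h a m
  smul_add a m m' := grSMul_add h a m m'
  smul_zero a := grSMul_zero h a
  add_smul a a' m := add_grSMul h a a' m
  zero_smul m := zero_grSMul h m
  one_smul := by
    rintro ⟨t, m⟩
    obtain ⟨m, rfl⟩ := grMk_surjective h t m
    exact gradedMk_congr h (zero_add t) (one_smul _ _)
  mul_smul := by
    rintro ⟨r, a⟩ ⟨s, b⟩ ⟨t, c⟩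
    obtain ⟨a, rfl⟩ := grMk_surjective h r a
    obtain ⟨b, rfl⟩ := grMk_surjective h s b
    obtain ⟨c, rfl⟩ := grMk_surjective h t c
    exact gradedMk_congr h (add_assoc r s t) (mul_smul _ _ _)

end Graded

/-! ### Resolutions of augmentation modules -/

/-- For a ring morphism `ε : A → S`, the `A`-module `S` on which `a` acts as multiplication
by `ε a`. -/
def AugModule {A S : Type*} [Ring A] [CommRing S] (_ε : A →+* S) : Type _ := S

namespace AugModule

variable {A S : Type*} [Ring A] [CommRing S] (ε : A →+* S)

instance : AddCommGroup (AugModule ε) := inferInstanceAs (AddCommGroup S)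

instance : Module S (AugModule ε) := inferInstanceAs (Module S S)

instance : Module A (AugModule ε) := Module.compHom S ε

/-- The identity map from `S` to the `A`-module `S`. -/
def of : S ≃+ AugModule ε := AddEquiv.refl S

instance [Algebra S A] (ε : A →ₐ[S] S) : IsScalarTower S A (AugModule (ε : A →+* S)) where
  smul_assoc s a x := by
    show ε (s • a) * (show S from x) = s * (ε a * (show S from x))
    rw [map_smul, smul_eq_mul, mul_assoc]

end AugModule

/-- `⋯ → M 2 → M 1 → M 0 → N → 0` is exact. -/
structure IsResolution {B : Type*} [Ring B] (M : ℕ → Type*) [∀ q, AddCommGroup (M q)]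
    [∀ q, Module B (M q)] {N : Type*} [AddCommGroup N] [Module B N]
    (d : ∀ q, M (q + 1) →ₗ[B] M q) (η : M 0 →ₗ[B] N) : Prop where
  surjective : Function.Surjective η
  exact_zero : Function.Exact (d 0) η
  exact_succ : ∀ q, Function.Exact (d (q + 1)) (d q)

/-! ### The Koszul complex -/

section Koszul

variable (k : Type*) [Field k] {𝔞 : Type*} [LieRing 𝔞] [LieAlgebra k 𝔞]
variable {B : Type*} [Ring B] [Algebra k B]

variable (B 𝔞) in
/-- The `B`-module `B ⊗ ⋀^q 𝔞`, with `B` acting by left multiplication on the first factor. -/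
abbrev KoszulMod (q : ℕ) : Type _ := B ⊗[k] ⋀[k]^q 𝔞

/-- The bracket part of the Koszul differential of `u ⊗ X₀ ∧ ⋯ ∧ X_q`: the sum over `i < j` of
`(-1) ^ (i + j) u ⊗ [X_i, X_j] ∧ X₀ ∧ ⋯ ∧ X̂_i ∧ ⋯ ∧ X̂_j ∧ ⋯ ∧ X_q`. -/
def koszulBracketPart : (q : ℕ) → B → (Fin (q + 1) → 𝔞) → KoszulMod k 𝔞 B q
  | 0, _, _ => 0
  | q + 1, u, X => ∑ j : Fin (q + 2), ∑ i : Fin (q + 1),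
      if i.castSucc < j then
        (-1 : B) ^ ((i : ℕ) + (j : ℕ)) •
          (u ⊗ₜ[k] exteriorPower.ιMulti k (q + 1)
            (Fin.cons ⁅X i.castSucc, X j⁆ (i.removeNth (j.removeNth X)) : Fin (q + 1) → 𝔞))
      else 0

/-- The Koszul (Chevalley-Eilenberg) differential on `u ⊗ X₀ ∧ ⋯ ∧ X_q`, with indices starting
at `0`. -/
def koszulFormula (φ : 𝔞 → B) (q : ℕ) (u : B) (X : Fin (q + 1) → 𝔞) : KoszulMod k 𝔞 B q :=
  ∑ i : Fin (q + 1), (-1 : B) ^ (i : ℕ) •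
      ((u * φ (X i)) ⊗ₜ[k] exteriorPower.ιMulti k q (i.removeNth X)) +
    koszulBracketPart k q u X

/-- The `B`-linear maps `d q : B ⊗ ⋀^(q+1) 𝔞 → B ⊗ ⋀^q 𝔞` are the Koszul differentials. As the
elements `u ⊗ X₀ ∧ ⋯ ∧ X_q` span, this determines `d`. -/
def IsKoszulDifferential (φ : 𝔞 → B)
    (d : ∀ q, KoszulMod k 𝔞 B (q + 1) →ₗ[B] KoszulMod k 𝔞 B q) : Prop :=
  ∀ (q : ℕ) (u : B) (X : Fin (q + 1) → 𝔞),
    d q (u ⊗ₜ[k] exteriorPower.ιMulti k (q + 1) X) = koszulFormula k φ q u X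

/-- `η` is the augmentation `B ⊗ ⋀^0 𝔞 → S`, `u ⊗ 1 ↦ ε u`. -/
def IsKoszulAugmentation {S : Type*} [CommRing S] (ε : B →+* S)
    (η : KoszulMod k 𝔞 B 0 →ₗ[B] AugModule ε) : Prop :=
  ∀ (u : B) (v : Fin 0 → 𝔞), η (u ⊗ₜ[k] exteriorPower.ιMulti k 0 v) = AugModule.of ε (ε u)

variable (𝔞)

/-- The algebra `U(𝔞)[h]`. -/
abbrev UPoly : Type _ := (UniversalEnvelopingAlgebra k 𝔞)[X]

/-- The map `𝔞 → U(𝔞)[h]`. -/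
def UPoly.ι (x : 𝔞) : UPoly k 𝔞 := Polynomial.C (UniversalEnvelopingAlgebra.ι k x)

attribute [local instance 100] LieRing.ofAssociativeRing

/-- The morphism `U(𝔞)[h] → k[h]` that sends `𝔞` to `0` and `h` to `h`; it defines the trivial
`U(𝔞)[h]`-module `k[h]`. -/
def UPoly.counit : UPoly k 𝔞 →+* k[X] :=
  Polynomial.mapRingHom
    (UniversalEnvelopingAlgebra.lift k (0 : 𝔞 →ₗ⁅k⁆ k)).toRingHom

end Koszul

/-! ### Deformations -/

section Deformation

universe u

variable (k : Type*) [Field k]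

/-- `M` is isomorphic, as a `k⟦h⟧`-module, to `V⟦h⟧` for some `k`-vector space `V`. Here `V⟦h⟧` is
the group of sequences `v : ℕ → V`, written `∑ v n h ^ n`, with `k⟦h⟧` acting by the Cauchy
product. -/
def IsTopologicallyFree (M : Type u) [AddCommGroup M] [Module k⟦X⟧ M] : Prop :=
  ∃ (V : Type u) (_ : AddCommGroup V) (_ : Module k V) (Φ : (ℕ → V) ≃+ M),
    ∀ (c : k⟦X⟧) (v : ℕ → V),
      Φ (fun n => ∑ p ∈ Finset.HasAntidiagonal.antidiagonal n, PowerSeries.coeff p.1 c • v p.2) = c • Φ v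

/-- `A` is a deformation of `A₀`: a topologically free `k⟦h⟧`-algebra with `A / h A ≃ A₀` as
`k`-algebras. -/
def IsDeformation (A₀ A : Type*) [Ring A₀] [Algebra k A₀] [Ring A] [Algebra k A]
    [Algebra k⟦X⟧ A] : Prop :=
  IsTopologicallyFree k A ∧
    Nonempty ((TwoSidedIdeal.span {algebraMap k⟦X⟧ A PowerSeries.X}).ringCon.Quotient ≃ₐ[k] A₀)

end Deformation

/-! ### The algebra `U_h(𝔞)` given by generators and relations -/

section Presentation

/-- The closure of a two-sided ideal in the `h`-adic topology: the elements `x` such that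
`J` meets `x + h ^ N A` for all `N`. -/
def hClosure {S : Type*} [CommRing S] (h : S) {A : Type*} [Ring A] [Algebra S A]
    (J : TwoSidedIdeal A) : TwoSidedIdeal A :=
  TwoSidedIdeal.mk' {x | ∀ N : ℕ, ∃ y ∈ J, x - y ∈ hFilt h A N}
    (fun N => ⟨0, J.zero_mem, by simp⟩)
    (by
      intro x x' hx hx' N
      obtain ⟨y, hy, hxy⟩ := hx N
      obtain ⟨y', hy', hxy'⟩ := hx' N
      exact ⟨y + y', J.add_mem hy hy', by rw [add_sub_add_comm]; exact add_mem hxy hxy'⟩)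
    (by
      intro x hx N
      obtain ⟨y, hy, hxy⟩ := hx N
      exact ⟨-y, J.neg_mem hy, by rw [neg_sub_neg, ← neg_sub]; exact neg_mem hxy⟩)
    (by
      intro x y hy N
      obtain ⟨z, hz, w, hw⟩ := hy N
      refine ⟨x * z, J.mul_mem_left _ _ hz, x * w, ?_⟩
      rw [← mul_sub, ← hw]
      simp)
    (by
      intro x y hx N
      obtain ⟨z, hz, w, hw⟩ := hx N
      refine ⟨z * y, J.mul_mem_right _ _ hz, w * y, ?_⟩
      rw [← sub_mul, ← hw]
      simp)

theorem mem_hClosure {S : Type*} [CommRing S] (h : S) {A : Type*} [Ring A] [Algebra S A]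
    (J : TwoSidedIdeal A) (x : A) :
    x ∈ hClosure h J ↔ ∀ N : ℕ, ∃ y ∈ J, x - y ∈ hFilt h A N :=
  TwoSidedIdeal.mem_mk' ..

variable (k : Type*) [Field k] (n : ℕ)

/-- The (`h`-adically complete) tensor algebra of the free `k⟦h⟧`-module with basis
`e_1, …, e_n`: formal power series in `h` with coefficients in `k⟨e_1, …, e_n⟩`. -/
def CTensor : Type _ := (FreeAlgebra k (Fin n))⟦X⟧

instance : Ring (CTensor k n) := inferInstanceAs (Ring (FreeAlgebra k (Fin n))⟦X⟧)

instance : Algebra k (CTensor k n) := inferInstanceAs (Algebra k (FreeAlgebra k (Fin n))⟦X⟧)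

theorem CTensor.map_commutes (c : k⟦X⟧) (x : (FreeAlgebra k (Fin n))⟦X⟧) :
    PowerSeries.map (algebraMap k (FreeAlgebra k (Fin n))) c * x =
      x * PowerSeries.map (algebraMap k (FreeAlgebra k (Fin n))) c := by
  ext m
  rw [PowerSeries.coeff_mul, PowerSeries.coeff_mul, ← Finset.Nat.sum_antidiagonal_swap]
  refine Finset.sum_congr rfl fun p _ => ?_
  simp only [PowerSeries.coeff_map, Prod.fst_swap, Prod.snd_swap]
  exact Algebra.commutes _ _

/-- `k⟦h⟧` acts through `k⟦h⟧ ⊆ k⟨e_1, …, e_n⟩⟦h⟧`. -/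
instance : Algebra k⟦X⟧ (CTensor k n) :=
  RingHom.toAlgebra' (S := CTensor k n)
    (PowerSeries.map (algebraMap k (FreeAlgebra k (Fin n))))
    (CTensor.map_commutes k n)

instance : IsScalarTower k k⟦X⟧ (CTensor k n) :=
  IsScalarTower.of_algebraMap_eq fun c => by
    show (algebraMap k (FreeAlgebra k (Fin n))⟦X⟧ c) =
      PowerSeries.map (algebraMap k (FreeAlgebra k (Fin n))) (algebraMap k k⟦X⟧ c)
    rw [PowerSeries.algebraMap_apply, PowerSeries.algebraMap_apply, PowerSeries.map_C]
    rfl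

variable {n}

/-- The generator `e_i`. -/
def CTensor.gen (i : Fin n) : CTensor k n :=
  (PowerSeries.C (FreeAlgebra.ι k i) : (FreeAlgebra k (Fin n))⟦X⟧)

variable {k}

/-- For a polynomial `P = ∑ a_m X₁ ^ m₁ ⋯ Xₙ ^ mₙ`, the element
`P^⊗ = ∑ a_m e₁ ^ m₁ ⋯ eₙ ^ mₙ` of `k⟨e_1, …, e_n⟩`. -/
def polyTensor : MvPolynomial (Fin n) k →ₗ[k] FreeAlgebra k (Fin n) :=
  (MvPolynomial.basisMonomials (Fin n) k).constr k
    (fun m => (List.ofFn fun i => FreeAlgebra.ι k i ^ m i).prod)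

/-- For `g = ∑ P_r h ^ r`, the element `g^⊗ = ∑ P_r^⊗ h ^ r`. -/
def seriesTensor (g : (MvPolynomial (Fin n) k)⟦X⟧) : CTensor k n :=
  (PowerSeries.mk fun r => polyTensor (PowerSeries.coeff r g) : (FreeAlgebra k (Fin n))⟦X⟧)

/-- The closure of the two-sided ideal generated by the `e_i e_j - e_j e_i - g_{i,j}^⊗`. -/
def relIdeal (g : Fin n → Fin n → (MvPolynomial (Fin n) k)⟦X⟧) : TwoSidedIdeal (CTensor k n) :=
  hClosure (PowerSeries.X : k⟦X⟧) (TwoSidedIdeal.span (Set.range fun p : Fin n × Fin n =>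
    CTensor.gen k p.1 * CTensor.gen k p.2 - CTensor.gen k p.2 * CTensor.gen k p.1 -
      seriesTensor (g p.1 p.2)))

/-- `U_h(𝔞)`, the quotient of the complete tensor algebra by `relIdeal g`. -/
abbrev Uh (g : Fin n → Fin n → (MvPolynomial (Fin n) k)⟦X⟧) : Type _ :=
  (relIdeal g).ringCon.Quotient

/-- The class of `e_i` in `U_h(𝔞)`. -/
def Uh.gen (g : Fin n → Fin n → (MvPolynomial (Fin n) k)⟦X⟧) (i : Fin n) : Uh g :=
  (relIdeal g).ringCon.mk' (CTensor.gen k i)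

instance (g : Fin n → Fin n → (MvPolynomial (Fin n) k)⟦X⟧) : IsScalarTower k k⟦X⟧ (Uh g) :=
  IsScalarTower.of_algebraMap_eq fun c => by
    show (relIdeal g).ringCon.mk' (algebraMap k (CTensor k n) c) =
      (relIdeal g).ringCon.mk' (algebraMap k⟦X⟧ (CTensor k n) (algebraMap k k⟦X⟧ c))
    rw [← IsScalarTower.algebraMap_apply]

end Presentation

end QKoszul

end

open QKoszul

/-! / The algebra `A = U_h(𝔞)` is `h`-torsion free, separated and complete, being topologically free
(`IsTopologicallyFree.isHFree`). Setting `h = 0` in the presentation identifies `A / hA` with `U(𝔞)`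
(`Uh.isReduction_toEnv`). The resolution is a lift along this reduction of the Koszul resolution of
`U(𝔞)`.

Exactness over `U(𝔞)` (`envD_exact`). By Poincaré-Birkhoff-Witt, ordered monomials identify `U(𝔞)`
with polynomials, and products agree with those of polynomials up to lower degree. Transported
partial derivatives give `s (u ⊗ w) = ∑ ∂_i u ⊗ e_i ∧ w`. Cartan's formula and Euler's identity show
that `∂ s + s ∂` is multiplication by the total degree (polynomial plus exterior) up to lower
filtration. In characteristic `0` this degree is invertible, so induction on the filtration makes
every cycle of positive exterior degree a boundary. Over `U(𝔞)[h]` everything happens coefficient by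
coefficient (`isResolution_upoly`).

Lifting (`exists_lift_koszulResolution`). Given a lifted differential `d`, the element `∂ (1 ⊗ w)`
is a cycle modulo `h`, so any lift `x` of it has `d x = h m`. The range of `d` is all of its target
(for `ε`) or the kernel of a map to a torsion free module, so `m = d z`, and `x - h z` is a true
cycle lifting `∂ (1 ⊗ w)`. These cycles define the next differential on `A ⊗ ⋀ 𝔞`. The result is
exact: a cycle is a boundary modulo `h`, the error is `h` times a cycle, and the corrections sum to
a convergent series.

Graded object (`exists_grKoszulEquiv`). For torsion free `M`, multiplication by `h ^ t` identifies
`M / hM` with `h ^ t M / h ^ (t + 1) M`, so `Gr M` is `(M / hM)[h]` and the graded map of `d` is its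
reduction applied to each coefficient.

The augmentation exists because the `g i j` have no constant term, and is unique because every
element is a noncommutative polynomial in the `e_i` plus a multiple of `h`, and `k⟦h⟧` is separated.
-/

noncomputable section

namespace QKoszul

/-! ### Operators on exterior powers -/

section ExteriorOperators

variable {k : Type*} [CommRing k] {V : Type*} [AddCommGroup V] [Module k V]
variable {N N' : Type*} [AddCommGroup N] [Module k N] [AddCommGroup N'] [Module k N']

/-- Left multiplication by a vector, `⋀^q V → ⋀^(q+1) V`. -/
def wedge (q : ℕ) : V →ₗ[k] ⋀[k]^q V →ₗ[k] ⋀[k]^(q + 1) V :=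
  (exteriorPower.alternatingMapLinearEquiv (R := k)).toLinearMap ∘ₗ
    (exteriorPower.ιMulti k (q + 1) (M := V)).curryLeft

@[simp] theorem wedge_ιMulti (q : ℕ) (x : V) (X : Fin q → V) :
    wedge (k := k) q x (exteriorPower.ιMulti k q X) =
      exteriorPower.ιMulti k (q + 1) (Fin.cons x X : Fin (q + 1) → V) := by
  simp [wedge, Matrix.vecCons]

theorem exteriorPower_ext {q : ℕ} {f f' : ⋀[k]^q V →ₗ[k] N}
    (h : ∀ X, f (exteriorPower.ιMulti k q X) = f' (exteriorPower.ιMulti k q X)) : f = f' :=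
  exteriorPower.linearMap_ext (AlternatingMap.ext h)

/-- The products `x ∧ w` span, so operator identities follow by induction on the degree from
commutation with `wedge`. -/
theorem exteriorPower_ext_wedge {q : ℕ} {f f' : ⋀[k]^(q + 1) V →ₗ[k] N}
    (h : ∀ x w, f (wedge q x w) = f' (wedge q x w)) : f = f' :=
  exteriorPower_ext fun X => by
    have := h (X 0) (exteriorPower.ιMulti k q (Fin.tail X))
    rwa [wedge_ιMulti, Fin.cons_self_tail] at this

theorem coe_wedge (q : ℕ) (x : V) (w : ⋀[k]^q V) :
    (wedge q x w : ExteriorAlgebra k V) = ExteriorAlgebra.ι k x * w := by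
  have : (⋀[k]^(q + 1) V).subtype ∘ₗ wedge q x =
      LinearMap.mulLeft k (ExteriorAlgebra.ι k x) ∘ₗ (⋀[k]^q V).subtype :=
    exteriorPower_ext fun X => by
      simp [wedge_ιMulti, ExteriorAlgebra.ιMulti_succ_apply, Matrix.vecTail, Function.comp_def]
  exact LinearMap.congr_fun this w

theorem wedge_wedge (q : ℕ) (x y : V) (w : ⋀[k]^q V) :
    wedge (q + 1) x (wedge q y w) = -wedge (q + 1) y (wedge q x w) := by
  refine Subtype.ext ?_
  rw [Submodule.coe_neg]
  simp only [coe_wedge, ← mul_assoc]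
  rw [← neg_mul, eq_neg_of_add_eq_zero_left (ExteriorAlgebra.ι_add_mul_swap x y)]

/-- The alternating extension of `f : V → Hom(⋀^q V, N)` to `⋀^(q+1) V`. -/
def altLift {q : ℕ} (f : V →ₗ[k] ⋀[k]^q V →ₗ[k] N) : ⋀[k]^(q + 1) V →ₗ[k] N :=
  exteriorPower.alternatingMapLinearEquiv (AlternatingMap.alternatizeUncurryFin
    ((exteriorPower.alternatingMapLinearEquiv (R := k)).symm.toLinearMap ∘ₗ f))

theorem altLift_ιMulti {q : ℕ} (f : V →ₗ[k] ⋀[k]^q V →ₗ[k] N) (X : Fin (q + 1) → V) :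
    altLift f (exteriorPower.ιMulti k (q + 1) X) =
      ∑ i : Fin (q + 1), (-1 : ℤ) ^ (i : ℕ) • f (X i) (exteriorPower.ιMulti k q (i.removeNth X)) := by
  simp [altLift, AlternatingMap.alternatizeUncurryFin_apply]

theorem comp_altLift {q : ℕ} (g : N →ₗ[k] N') (f : V →ₗ[k] ⋀[k]^q V →ₗ[k] N)
    (w : ⋀[k]^(q + 1) V) : g (altLift f w) = altLift (f.compr₂ g) w := by
  have : g ∘ₗ altLift f = altLift (f.compr₂ g) := exteriorPower_ext fun X => by
    simp [altLift_ιMulti, map_sum]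
  exact LinearMap.congr_fun this w

theorem altLift_add {q : ℕ} (f f' : V →ₗ[k] ⋀[k]^q V →ₗ[k] N) :
    altLift (f + f') = altLift f + altLift f' := by
  simp [altLift, LinearMap.comp_add]

theorem altLift_eq_sub {q : ℕ} {f f₁ f₂ : V →ₗ[k] ⋀[k]^q V →ₗ[k] N}
    (h : ∀ x w, f x w = f₁ x w - f₂ x w) (w : ⋀[k]^(q + 1) V) :
    altLift f w = altLift f₁ w - altLift f₂ w := by
  have : altLift f = altLift f₁ - altLift f₂ := exteriorPower_ext fun X => by
    simp [altLift_ιMulti, h, smul_sub]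
  exact LinearMap.congr_fun this w

theorem altLift_eq_neg {q : ℕ} {f f' : V →ₗ[k] ⋀[k]^q V →ₗ[k] N}
    (h : ∀ x w, f x w = -f' x w) (w : ⋀[k]^(q + 1) V) : altLift f w = -altLift f' w := by
  have : altLift f = -altLift f' := exteriorPower_ext fun X => by simp [altLift_ιMulti, h]
  exact LinearMap.congr_fun this w

theorem altLift_wedge_zero (f : V →ₗ[k] ⋀[k]^0 V →ₗ[k] N) (x : V) (w : ⋀[k]^0 V) :
    altLift f (wedge 0 x w) = f x w := by
  have : altLift f ∘ₗ wedge 0 x = f x := exteriorPower_ext fun X => by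
    simp only [LinearMap.comp_apply, wedge_ιMulti, altLift_ιMulti]
    simp
  exact LinearMap.congr_fun this w

theorem removeNth_succ_cons {α : Type*} {q : ℕ} (i : Fin (q + 1)) (x : α) (X : Fin (q + 1) → α) :
    i.succ.removeNth (Fin.cons x X : Fin (q + 2) → α) =
      (Fin.cons x (i.removeNth X) : Fin (q + 1) → α) := by
  funext j
  refine Fin.cases ?_ (fun j => ?_) j <;> simp [Fin.removeNth]

theorem removeNth_zero_cons {α : Type*} {q : ℕ} (x : α) (X : Fin q → α) :
    (0 : Fin (q + 1)).removeNth (Fin.cons x X : Fin (q + 1) → α) = X := by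
  simp 

/-- Expansion along the first vector: the term `i = 0` gives `f x w`; in the others `x` stays in
front and the sign shifts by one. -/
theorem altLift_wedge_succ {q : ℕ} (f : V →ₗ[k] ⋀[k]^(q + 1) V →ₗ[k] N) (x : V)
    (w : ⋀[k]^(q + 1) V) :
    altLift f (wedge (q + 1) x w) = f x w - altLift (f.compl₂ (wedge q x)) w := by
  have : altLift f ∘ₗ wedge (q + 1) x = f x - altLift (f.compl₂ (wedge q x)) :=
    exteriorPower_ext fun X => by
      simp only [LinearMap.comp_apply, wedge_ιMulti, altLift_ιMulti, LinearMap.sub_apply]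
      rw [Fin.sum_univ_succ]
      simp [removeNth_succ_cons, pow_succ, sub_eq_add_neg]
  exact LinearMap.congr_fun this w

end ExteriorOperators

/-! ### The adjoint action on exterior powers -/

section LieOperators

variable {k : Type*} [CommRing k] {𝔞 : Type*} [LieRing 𝔞] [LieAlgebra k 𝔞]

/-- The action of `𝔞` on `⋀^q 𝔞` induced by the adjoint action. -/
def extAd : (q : ℕ) → 𝔞 →ₗ[k] ⋀[k]^q 𝔞 →ₗ[k] ⋀[k]^q 𝔞
  | 0 => 0
  | q + 1 =>
    { toFun x := altLift ((wedge q).comp (LieAlgebra.ad k 𝔞 x : 𝔞 →ₗ[k] 𝔞))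
      map_add' x y := by rw [← altLift_add]; congr 1; ext; simp
      map_smul' c x := exteriorPower_ext fun X => by
        simp [altLift_ιMulti, Finset.smul_sum, smul_comm c] }

theorem extAd_succ (q : ℕ) (x : 𝔞) (w : ⋀[k]^(q + 1) 𝔞) :
    extAd (q + 1) x w = altLift ((wedge q).comp (LieAlgebra.ad k 𝔞 x : 𝔞 →ₗ[k] 𝔞)) w := rfl

/-- Leibniz rule. Moving `[x, X_i]` to the front costs `(-1)^i`, which is why `extAd` is an
`altLift`; the minus sign of `altLift_wedge_succ` is undone when `[x, z]` is moved past `y`. -/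
theorem extAd_wedge (q : ℕ) (x y : 𝔞) (w : ⋀[k]^q 𝔞) :
    extAd (q + 1) x (wedge q y w) = wedge q ⁅x, y⁆ w + wedge q y (extAd q x w) := by
  cases q with
  | zero => rw [extAd_succ, altLift_wedge_zero]; simp [extAd]
  | succ q =>
    rw [extAd_succ, altLift_wedge_succ, extAd_succ, comp_altLift, sub_eq_add_neg,
      altLift_eq_neg (f' := ((wedge q).comp (LieAlgebra.ad k 𝔞 x : 𝔞 →ₗ[k] 𝔞)).compr₂
        (wedge (q + 1) y)) (fun z w => by simp [wedge_wedge _ ⁅x, z⁆ y]), neg_neg]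
    simp

/-- The Jacobi identity on vectors, propagated to all degrees by the Leibniz rule. -/
theorem extAd_lie (q : ℕ) (x y : 𝔞) (w : ⋀[k]^q 𝔞) :
    extAd q ⁅x, y⁆ w = extAd q x (extAd q y w) - extAd q y (extAd q x w) := by
  induction q with
  | zero => simp [extAd]
  | succ q ih =>
    have : extAd (k := k) (q + 1) ⁅x, y⁆ =
        extAd (q + 1) x ∘ₗ extAd (q + 1) y - extAd (q + 1) y ∘ₗ extAd (q + 1) x :=
      exteriorPower_ext_wedge fun z w => by
        simp only [LinearMap.sub_apply, LinearMap.comp_apply, extAd_wedge, map_add, ih, map_sub,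
          lie_lie, LinearMap.sub_apply]
        abel
    exact LinearMap.congr_fun this w

end LieOperators

section Bracket

variable {k : Type*} [Field k] [CharZero k] {𝔞 : Type*} [LieRing 𝔞] [LieAlgebra k 𝔞]

/-- The differential `⋀^(q+1) 𝔞 → ⋀^q 𝔞` of the Chevalley-Eilenberg complex with trivial
coefficients. -/
def extBracket (q : ℕ) : ⋀[k]^(q + 1) 𝔞 →ₗ[k] ⋀[k]^q 𝔞 :=
  -- The alternating sum of the `ad X_i` meets every pair `{i, j}` twice, each time with the sign
  -- opposite to the one in the differential; hence the factor `-1/2`.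
  -(2⁻¹ : k) • altLift (extAd q)

omit [CharZero k] in
theorem extBracket_zero (w : ⋀[k]^1 𝔞) : extBracket 0 w = 0 := by
  have : extBracket (k := k) (𝔞 := 𝔞) 0 = 0 := exteriorPower_ext fun X => by
    simp [extBracket, altLift_ιMulti, extAd]
  simp [this]

/-- One copy of `ad x` comes from expanding along `x`, another from the Leibniz rule for `ad y (x ∧
·)` summed over `y`; together they absorb the factor `1/2`. -/
theorem extBracket_wedge (q : ℕ) (x : 𝔞) (w : ⋀[k]^(q + 1) 𝔞) :
    extBracket (q + 1) (wedge (q + 1) x w) = -extAd (q + 1) x w - wedge q x (extBracket q w) := by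
  have h : altLift ((extAd (k := k) (q + 1)).compl₂ (wedge q x)) w =
      wedge q x (altLift (extAd q) w) - extAd (q + 1) x w := by
    rw [comp_altLift, extAd_succ]
    refine altLift_eq_sub (fun y w => ?_) w
    simp only [LinearMap.compl₂_apply, extAd_wedge, LinearMap.compr₂_apply, LinearMap.comp_apply,
      LieAlgebra.ad_apply]
    rw [← lie_skew x y, map_neg, LinearMap.neg_apply]
    abel
  simp only [extBracket, LinearMap.smul_apply, altLift_wedge_succ, h, map_smul]
  module

end Bracket

/-! ### The Koszul differential and its Cartan calculus -/

section KoszulDifferential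

variable {k : Type*} [Field k] [CharZero k] {𝔞 : Type*} [LieRing 𝔞] [LieAlgebra k 𝔞]
variable {B : Type*} [Ring B] [Algebra k B]

omit [CharZero k] in
theorem neg_one_pow_smul_tmul (m : ℕ) {W : Type*} [AddCommGroup W] [Module k W] (u : B) (w : W) :
    (-1 : B) ^ m • (u ⊗ₜ[k] w) = u ⊗ₜ[k] ((-1 : ℤ) ^ m • w) := by
  rcases Nat.even_or_odd m with h | h <;> simp [h.neg_one_pow, TensorProduct.smul_tmul', TensorProduct.tmul_neg,
    TensorProduct.neg_tmul]

-- Pairs containing the index `0` give the adjoint term. In the other pairs both indices shift,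
-- which preserves the sign, and moving `x` in front of the bracket costs `-1`. This is the
-- recursion of `extBracket_wedge`.
omit [CharZero k] in
theorem koszulBracketPart_cons (q : ℕ) (u : B) (x : 𝔞) (X : Fin (q + 2) → 𝔞) :
    koszulBracketPart k (q + 2) u (Fin.cons x X : Fin (q + 3) → 𝔞) =
      -(u ⊗ₜ extAd (q + 2) x (exteriorPower.ιMulti k (q + 2) X)) -
        (wedge (q + 1) x).lTensor B (koszulBracketPart k (q + 1) u X) := by
  simp only [koszulBracketPart, map_sum]
  conv_lhs =>
    rw [Fin.sum_univ_succ]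
    enter [2, 2, j]
    rw [Fin.sum_univ_succ]
  simp only [Fin.not_lt_zero, if_false, Finset.sum_const_zero, zero_add]
  rw [Finset.sum_add_distrib, sub_eq_add_neg]
  congr 1
  · rw [extAd_succ, altLift_ιMulti, TensorProduct.tmul_sum, ← Finset.sum_neg_distrib]
    refine Finset.sum_congr rfl fun j _ => ?_
    rw [removeNth_succ_cons, if_pos (by exact Fin.succ_pos j)]
    simp only [removeNth_zero_cons, Fin.castSucc_zero, Fin.cons_zero, Fin.cons_succ,
      LinearMap.comp_apply, LieAlgebra.ad_apply, wedge_ιMulti, Fin.val_zero, Fin.val_succ, zero_add]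
    rw [neg_one_pow_smul_tmul, pow_succ, mul_neg_one, neg_smul, TensorProduct.tmul_neg]
  · rw [← Finset.sum_neg_distrib]
    refine Finset.sum_congr rfl fun j _ => ?_
    rw [← Finset.sum_neg_distrib]
    refine Finset.sum_congr rfl fun i _ => ?_
    simp only [← Fin.succ_castSucc, Fin.succ_lt_succ_iff]
    split_ifs
    · simp only [Fin.cons_succ, removeNth_succ_cons, Fin.val_succ]
      rw [show (i : ℕ) + 1 + (j + 1) = (i + j) + 2 by ring, pow_add, neg_one_sq, mul_one,
        neg_one_pow_smul_tmul, neg_one_pow_smul_tmul, LinearMap.lTensor_tmul, TensorProduct.tmul_smul, map_zsmul,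
        wedge_ιMulti, ← wedge_ιMulti _ _ (Fin.cons _ _), ← wedge_ιMulti, ← wedge_ιMulti, wedge_wedge,
        ← wedge_ιMulti, TensorProduct.tmul_smul, TensorProduct.tmul_neg, smul_neg]
    · simp

/-- Both sides satisfy the same recursion in the first vector. Degrees `0` and `1` are treated
separately because the recursion for the double sum only starts above them. -/
theorem koszulBracketPart_eq (q : ℕ) (u : B) (X : Fin (q + 1) → 𝔞) :
    koszulBracketPart k q u X = u ⊗ₜ extBracket q (exteriorPower.ιMulti k (q + 1) X) := by
  induction q with
  | zero => rw [extBracket_zero, TensorProduct.tmul_zero]; rfl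
  | succ q ih =>
    rw [← Fin.cons_self_tail X]
    generalize X 0 = x
    generalize Fin.tail X = X
    cases q with
    | zero =>
      rw [← wedge_ιMulti, extBracket_wedge, extBracket_zero, extAd_succ, altLift_ιMulti]
      simp [koszulBracketPart, Fin.sum_univ_succ, TensorProduct.tmul_neg]
      rw [Subsingleton.elim (Fin.tail (Fin.removeNth 1 _)) (Fin.tail X), TensorProduct.smul_tmul',
        neg_one_smul, TensorProduct.neg_tmul]
    | succ q =>
      rw [koszulBracketPart_cons, ih, ← wedge_ιMulti, extBracket_wedge, TensorProduct.tmul_sub,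
        TensorProduct.tmul_neg, LinearMap.lTensor_tmul]

/-- Extension of a `k`-linear map `W → N` to a `B`-linear map `B ⊗ W → N`. -/
def extendScalars {W N : Type*} [AddCommGroup W] [Module k W] [AddCommGroup N] [Module k N]
    [Module B N] [IsScalarTower k B N] (f : W →ₗ[k] N) : B ⊗[k] W →ₗ[B] N :=
  TensorProduct.AlgebraTensorModule.lift
    { toFun b := b • f
      map_add' _ _ := add_smul _ _ _
      map_smul' _ _ := mul_smul _ _ _ }

omit [CharZero k] in
@[simp] theorem extendScalars_tmul {W N : Type*} [AddCommGroup W] [Module k W] [AddCommGroup N]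
    [Module k N] [Module B N] [IsScalarTower k B N] (f : W →ₗ[k] N) (b : B) (w : W) :
    extendScalars f (b ⊗ₜ w) = b • f w := rfl

omit [CharZero k] in
theorem linearMap_ext_one_tmul {W N : Type*} [AddCommGroup W] [Module k W] [AddCommGroup N]
    [Module B N] {f f' : B ⊗[k] W →ₗ[B] N} (h : ∀ w, f (1 ⊗ₜ w) = f' (1 ⊗ₜ w)) : f = f' := by
  refine LinearMap.ext fun z => ?_
  induction z with
  | zero => simp
  | add z z' hz hz' => rw [map_add, map_add, hz, hz']
  | tmul b w =>
    rw [← mul_one b, ← smul_eq_mul, ← TensorProduct.smul_tmul', map_smul, map_smul, h]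

/-- The `B`-linear map `id ⊗ f`. -/
abbrev tensorMap (B : Type*) [Ring B] [Algebra k B] {W W' : Type*} [AddCommGroup W] [Module k W]
    [AddCommGroup W'] [Module k W'] (f : W →ₗ[k] W') : B ⊗[k] W →ₗ[B] B ⊗[k] W' :=
  TensorProduct.AlgebraTensorModule.lTensor B B f

variable (φ : 𝔞 →ₗ[k] B)

/-- The restriction of the Koszul differential to `1 ⊗ ⋀^(q+1) 𝔞`. -/
def koszulD₁ (q : ℕ) : ⋀[k]^(q + 1) 𝔞 →ₗ[k] KoszulMod k 𝔞 B q :=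
  altLift ((TensorProduct.mk k B (⋀[k]^q 𝔞)).comp φ) +
    (TensorProduct.mk k B (⋀[k]^q 𝔞) 1).comp (extBracket q)

/-- The Koszul differential. -/
def koszulD (q : ℕ) : KoszulMod k 𝔞 B (q + 1) →ₗ[B] KoszulMod k 𝔞 B q :=
  extendScalars (koszulD₁ φ q)

theorem isKoszulDifferential_koszulD : IsKoszulDifferential k φ (koszulD φ) := by
  intro q u X
  rw [koszulD, extendScalars_tmul, koszulD₁, LinearMap.add_apply, smul_add, koszulFormula,
    koszulBracketPart_eq, altLift_ιMulti, Finset.smul_sum]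
  congr 1
  · refine Finset.sum_congr rfl fun i _ => ?_
    rw [neg_one_pow_smul_tmul, TensorProduct.tmul_smul, smul_comm u]
    simp [TensorProduct.smul_tmul']
  · simp [TensorProduct.smul_tmul']

/-- `u ⊗ w ↦ u ⊗ x ∧ w`. -/
abbrev kWedge (B : Type*) [Ring B] [Algebra k B] (q : ℕ) (x : 𝔞) :
    KoszulMod k 𝔞 B q →ₗ[B] KoszulMod k 𝔞 B (q + 1) :=
  tensorMap B (wedge q x)

omit [CharZero k] in
theorem koszulMod_ext_kWedge {N : Type*} [AddCommGroup N] [Module k N] [Module B N]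
    [IsScalarTower k B N] {q : ℕ} {f f' : KoszulMod k 𝔞 B (q + 1) →ₗ[B] N}
    (h : ∀ x z, f (kWedge B q x z) = f' (kWedge B q x z)) : f = f' := by
  refine linearMap_ext_one_tmul fun w => ?_
  have : f.restrictScalars k ∘ₗ TensorProduct.mk k B _ 1 =
      f'.restrictScalars k ∘ₗ TensorProduct.mk k B _ 1 :=
    exteriorPower_ext_wedge fun x w => by simpa using h x (1 ⊗ₜ w)
  exact LinearMap.congr_fun this w

/-- The Lie derivative `u ⊗ w ↦ u φ(x) ⊗ w - u ⊗ ad x w`. -/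
def kLie (q : ℕ) (x : 𝔞) : KoszulMod k 𝔞 B q →ₗ[B] KoszulMod k 𝔞 B q :=
  extendScalars (TensorProduct.mk k B (⋀[k]^q 𝔞) (φ x) -
    (TensorProduct.mk k B (⋀[k]^q 𝔞) 1).comp (extAd q x))

omit [CharZero k] in
theorem kLie_tmul (q : ℕ) (x : 𝔞) (u : B) (w : ⋀[k]^q 𝔞) :
    kLie φ q x (u ⊗ₜ w) = (u * φ x) ⊗ₜ w - u ⊗ₜ extAd q x w := by
  simp [kLie, smul_sub, TensorProduct.smul_tmul']

omit [CharZero k] in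
theorem koszulD_kWedge_zero (x : 𝔞) (z : KoszulMod k 𝔞 B 0) :
    koszulD φ 0 (kWedge B 0 x z) = kLie φ 0 x z := by
  have : koszulD φ 0 ∘ₗ kWedge B 0 x = kLie φ 0 x := linearMap_ext_one_tmul fun w => by
    simp [kLie_tmul, koszulD, koszulD₁, altLift_wedge_zero, extBracket_zero, extAd]
  exact LinearMap.congr_fun this z

/-- Cartan's formula. -/
theorem koszulD_kWedge (q : ℕ) (x : 𝔞) (z : KoszulMod k 𝔞 B (q + 1)) :
    koszulD φ (q + 1) (kWedge B (q + 1) x z) =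
      kLie φ (q + 1) x z - kWedge B q x (koszulD φ q z) := by
  have : koszulD φ (q + 1) ∘ₗ kWedge B (q + 1) x =
      kLie φ (q + 1) x - kWedge B q x ∘ₗ koszulD φ q := linearMap_ext_one_tmul fun w => by
    simp only [LinearMap.comp_apply, LinearMap.sub_apply, kLie_tmul, koszulD, koszulD₁, one_smul,
      TensorProduct.AlgebraTensorModule.lTensor_tmul, extendScalars_tmul, one_mul,
      LinearMap.add_apply, altLift_wedge_succ, extBracket_wedge, map_add, TensorProduct.mk_apply,
      TensorProduct.tmul_sub, TensorProduct.tmul_neg]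
    have h := comp_altLift ((kWedge B q x).restrictScalars k)
      ((TensorProduct.mk k B (⋀[k]^q 𝔞)).comp φ) w
    rw [LinearMap.restrictScalars_apply] at h
    rw [h]
    have h' : ((TensorProduct.mk k B (⋀[k]^(q + 1) 𝔞)).comp φ).compl₂ (wedge q x) =
        ((TensorProduct.mk k B (⋀[k]^q 𝔞)).comp φ).compr₂
          ((kWedge B q x).restrictScalars k) := by
      refine LinearMap.ext fun y => LinearMap.ext fun v => ?_
      simp
    rw [h']
    abel
  exact LinearMap.congr_fun this z

omit [CharZero k] in
theorem kLie_kWedge (q : ℕ) (x y : 𝔞) (z : KoszulMod k 𝔞 B q) :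
    kLie φ (q + 1) x (kWedge B q y z) = kWedge B q y (kLie φ q x z) - kWedge B q ⁅x, y⁆ z := by
  have : kLie φ (q + 1) x ∘ₗ kWedge B q y =
      kWedge B q y ∘ₗ kLie φ q x - kWedge B q ⁅x, y⁆ := linearMap_ext_one_tmul fun w => by
    simp only [LinearMap.comp_apply, LinearMap.sub_apply, kLie_tmul, map_sub,
      TensorProduct.AlgebraTensorModule.lTensor_tmul, extAd_wedge, TensorProduct.tmul_add]
    abel
  exact LinearMap.congr_fun this z

variable {φ} (hφ : ∀ x y, φ ⁅x, y⁆ = φ x * φ y - φ y * φ x)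
include hφ

-- The order is reversed because right multiplication on `B` and `-ad` on the exterior factor are
-- both anti-representations.
omit [CharZero k] in
theorem kLie_kLie (q : ℕ) (x y : 𝔞) (z : KoszulMod k 𝔞 B q) :
    kLie φ q x (kLie φ q y z) = kLie φ q y (kLie φ q x z) - kLie φ q ⁅x, y⁆ z := by
  have : kLie φ q x ∘ₗ kLie φ q y =
      kLie φ q y ∘ₗ kLie φ q x - kLie φ q ⁅x, y⁆ := linearMap_ext_one_tmul fun w => by
    simp only [LinearMap.comp_apply, LinearMap.sub_apply, kLie_tmul, map_sub, one_mul, hφ,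
      extAd_lie, TensorProduct.sub_tmul, TensorProduct.tmul_sub]
    abel
  exact LinearMap.congr_fun this z

/-- On `y ∧ z`, Cartan's formula reduces the commutator of `d` and `L_x` to the one in lower degree;
the remaining Lie derivatives cancel by `kLie_kLie`. -/
theorem kLie_koszulD (q : ℕ) (x : 𝔞) (z : KoszulMod k 𝔞 B (q + 1)) :
    koszulD φ q (kLie φ (q + 1) x z) = kLie φ q x (koszulD φ q z) := by
  suffices h : koszulD φ q ∘ₗ kLie φ (q + 1) x = kLie φ q x ∘ₗ koszulD φ q from
    LinearMap.congr_fun h z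
  induction q with
  | zero =>
    refine koszulMod_ext_kWedge fun y z => ?_
    simp only [LinearMap.comp_apply, kLie_kWedge, map_sub, koszulD_kWedge_zero,
      kLie_kLie hφ 0 x y]
  | succ q ih =>
    have ih z := LinearMap.congr_fun (ih z) z
    refine koszulMod_ext_kWedge fun y z => ?_
    simp only [LinearMap.comp_apply] at ih
    simp only [LinearMap.comp_apply, kLie_kWedge, map_sub, koszulD_kWedge, kLie_kLie hφ _ x y, ih]
    abel

/-- By Cartan's formula `d d (x ∧ z) = (d L_x - L_x d) z + x ∧ d d z`, without the last term in the
lowest degree; the first term vanishes by `kLie_koszulD`, the second by induction. -/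
theorem koszulD_koszulD (q : ℕ) (z : KoszulMod k 𝔞 B (q + 2)) :
    koszulD φ q (koszulD φ (q + 1) z) = 0 := by
  suffices h : koszulD φ q ∘ₗ koszulD φ (q + 1) = 0 from LinearMap.congr_fun h z
  induction q with
  | zero =>
    refine koszulMod_ext_kWedge fun y z => ?_
    rw [LinearMap.comp_apply, koszulD_kWedge, map_sub, koszulD_kWedge_zero, kLie_koszulD hφ,
      sub_self, LinearMap.zero_apply]
  | succ q ih =>
    have ih z := LinearMap.congr_fun (ih z) z
    refine koszulMod_ext_kWedge fun y z => ?_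
    simp only [LinearMap.comp_apply, LinearMap.zero_apply] at ih
    rw [LinearMap.comp_apply, koszulD_kWedge, map_sub, koszulD_kWedge, kLie_koszulD hφ, ih, map_zero,
      sub_zero, sub_self, LinearMap.zero_apply]

end KoszulDifferential
/-! ### The Poincaré-Birkhoff-Witt theorem -/

section DegLT

variable (k : Type*) [CommRing k] {n : ℕ}

/-- Polynomials of degree `< p`. -/
def degLT (n p : ℕ) : Submodule k (MvPolynomial (Fin n) k) :=
  Submodule.span k ((fun m => MvPolynomial.monomial m 1) '' {m : Fin n →₀ ℕ | m.degree < p})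

variable {k}

theorem monomial_mem_degLT {p : ℕ} {m : Fin n →₀ ℕ} (hm : m.degree < p) :
    MvPolynomial.monomial m (1 : k) ∈ degLT k n p :=
  Submodule.subset_span ⟨m, hm, rfl⟩

theorem map_mem_of_mem_degLT {W : Type*} [AddCommGroup W] [Module k W] {p : ℕ}
    {T : MvPolynomial (Fin n) k →ₗ[k] W} {W' : Submodule k W}
    (hT : ∀ m : Fin n →₀ ℕ, m.degree < p → T (MvPolynomial.monomial m 1) ∈ W')
    {P : MvPolynomial (Fin n) k} (hP : P ∈ degLT k n p) : T P ∈ W' := by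
  have : degLT k n p ≤ W'.comap T := Submodule.span_le.2 (by rintro _ ⟨m, hm, rfl⟩; exact hT m hm)
  exact this hP

theorem degLT_mono {p p' : ℕ} (h : p ≤ p') : degLT k n p ≤ degLT k n p' :=
  Submodule.span_mono (Set.image_mono fun _ hm => lt_of_lt_of_le hm h)

/-- With a strict bound the filtration starts at `0`, the base case of the inductions on `p` below.
-/
theorem degLT_zero : degLT k n 0 = ⊥ := by simp [degLT]

theorem exists_mem_degLT (P : MvPolynomial (Fin n) k) : ∃ p, P ∈ degLT k n p := by
  induction P using MvPolynomial.induction_on' with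
  | monomial m a =>
    refine ⟨m.degree + 1, ?_⟩
    rw [← mul_one a, ← smul_eq_mul, ← MvPolynomial.smul_monomial]
    exact Submodule.smul_mem _ _ (monomial_mem_degLT (Nat.lt_succ_self _))
  | add P Q hP hQ =>
    obtain ⟨p, hp⟩ := hP
    obtain ⟨q, hq⟩ := hQ
    exact ⟨max p q, add_mem (degLT_mono (le_max_left _ _) hp) (degLT_mono (le_max_right _ _) hq)⟩

theorem linearMap_ext_monomial {W : Type*} [AddCommGroup W] [Module k W]
    {T T' : MvPolynomial (Fin n) k →ₗ[k] W}
    (h : ∀ m, T (MvPolynomial.monomial m 1) = T' (MvPolynomial.monomial m 1)) : T = T' :=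
  (MvPolynomial.basisMonomials (Fin n) k).ext fun m => by simpa using h m

theorem constr_monomial {W : Type*} [AddCommGroup W] [Module k W] (f : (Fin n →₀ ℕ) → W)
    (m : Fin n →₀ ℕ) :
    (MvPolynomial.basisMonomials (Fin n) k).constr k f (MvPolynomial.monomial m 1) = f m := by
  simpa using (MvPolynomial.basisMonomials (Fin n) k).constr_basis k f m

theorem X_mul_monomial_one (i : Fin n) (m : Fin n →₀ ℕ) :
    (MvPolynomial.X i * MvPolynomial.monomial m 1 : MvPolynomial (Fin n) k) =
      MvPolynomial.monomial (m + Finsupp.single i 1) 1 := by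
  rw [MvPolynomial.X, MvPolynomial.monomial_mul, one_mul, add_comm]

theorem X_mul_mem_degLT (i : Fin n) {p : ℕ} {P : MvPolynomial (Fin n) k} (hP : P ∈ degLT k n p) :
    MvPolynomial.X i * P ∈ degLT k n (p + 1) := by
  refine map_mem_of_mem_degLT (T := LinearMap.mulLeft k (MvPolynomial.X i)) (fun m hm => ?_) hP
  rw [LinearMap.mulLeft_apply, X_mul_monomial_one]
  exact monomial_mem_degLT (by simpa using hm)

/-- Splitting off the least variable peels the first factor from an ordered monomial; all the
inductions on monomials below proceed this way. -/
theorem exists_min_of_ne_zero {m : Fin n →₀ ℕ} (hm : m ≠ 0) :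
    ∃ j N, (∀ l ∈ N.support, j ≤ l) ∧ m = N + Finsupp.single j 1 := by
  have h : m.support.Nonempty := Finsupp.support_nonempty_iff.2 hm
  refine ⟨m.support.min' h, m - Finsupp.single (m.support.min' h) 1, fun l hl => ?_, ?_⟩
  · exact Finset.min'_le _ _ (Finsupp.support_mono tsub_le_self hl)
  · rw [tsub_add_cancel_of_le]
    rw [Finsupp.single_le_iff, Nat.one_le_iff_ne_zero, ← Finsupp.mem_support_iff]
    exact Finset.min'_mem _ _

end DegLT

section PBW

variable {k : Type*} [Field k] {𝔞 : Type*} [LieRing 𝔞] [LieAlgebra k 𝔞]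
variable {n : ℕ} (e : Module.Basis (Fin n) k 𝔞)

open Classical in
/-- The action of `e i` on polynomials of degree at most `r`, defined by recursion on `r`. -/
def pbwAct : ℕ → Fin n → MvPolynomial (Fin n) k →ₗ[k] MvPolynomial (Fin n) k
  | 0, i => LinearMap.mulLeft k (MvPolynomial.X i)
  | r + 1, i => (MvPolynomial.basisMonomials (Fin n) k).constr k fun m =>
      -- Only degree `r + 1` is new at this stage; values beyond it carry no meaning.
      if m.degree ≤ r then pbwAct r i (MvPolynomial.monomial m 1)
      else MvPolynomial.X i * MvPolynomial.monomial m 1 +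
        -- If the least variable `j` of `m = N + j` lies below `i`, the relation `e_i e_j = e_j e_i
        -- + [e_i, e_j]` is imposed on `X^N`. The leading part `e_j (X_i X^N) = X_i X^m` is split
        -- off beforehand, so that the recursive calls only see degree at most `r`.
        if h : ∃ j, j < i ∧ ∃ N : Fin n →₀ ℕ, (∀ l ∈ N.support, j ≤ l) ∧ m = N + Finsupp.single j 1 then
          pbwAct r h.choose (pbwAct r i (MvPolynomial.monomial h.choose_spec.2.choose 1) -
            MvPolynomial.X i * MvPolynomial.monomial h.choose_spec.2.choose 1) +
          ∑ a, e.repr ⁅e i, e h.choose⁆ a • pbwAct r a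
            (MvPolynomial.monomial h.choose_spec.2.choose 1)
        else 0

/-- The corrections to multiplication by `X i` do not exceed the degree of the argument. This makes
the recursive calls of `pbwAct` legitimate. -/
theorem pbwAct_sub_mem (r : ℕ) : ∀ (i : Fin n) {p : ℕ} (_ : p ≤ r + 1) {P : MvPolynomial (Fin n) k}
    (_ : P ∈ degLT k n p), pbwAct e r i P - MvPolynomial.X i * P ∈ degLT k n p := by
  induction r with
  | zero => intro i p _ P _; simp [pbwAct]
  | succ r ih =>
    have ih' : ∀ (i : Fin n) {p : ℕ} (_ : p ≤ r + 1) {P : MvPolynomial (Fin n) k}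
        (_ : P ∈ degLT k n p), pbwAct e r i P ∈ degLT k n (p + 1) := fun i p hp P hP => by
      simpa using add_mem (degLT_mono (Nat.le_succ _) (ih i hp hP)) (X_mul_mem_degLT i hP)
    intro i p hp P hP
    refine map_mem_of_mem_degLT (T := pbwAct e (r + 1) i - LinearMap.mulLeft k (MvPolynomial.X i))
      (fun m hm => ?_) hP
    rw [LinearMap.sub_apply, LinearMap.mulLeft_apply, pbwAct, constr_monomial]
    split_ifs with h1 h2
    · exact degLT_mono hm (ih i (by omega) (monomial_mem_degLT (Nat.lt_succ_self _)))
    · obtain ⟨hN1, hN2⟩ := h2.choose_spec.2.choose_spec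
      generalize h2.choose_spec.2.choose = N at *
      generalize h2.choose = j at *
      have hd : m.degree = N.degree + 1 := by rw [hN2]; simp
      rw [add_sub_cancel_left]
      have hN : MvPolynomial.monomial N (1 : k) ∈ degLT k n (r + 1) :=
        monomial_mem_degLT (by omega)
      have hpp : r + 1 + 1 ≤ p := by omega
      refine degLT_mono hpp (add_mem ?_ (sum_mem fun a _ => Submodule.smul_mem _ _ ?_))
      · exact ih' j le_rfl (ih i le_rfl hN)
      · exact ih' a le_rfl hN
    · simp

/-- The action of `e i` on polynomials. -/
def pbwRho (i : Fin n) : MvPolynomial (Fin n) k →ₗ[k] MvPolynomial (Fin n) k :=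
  (MvPolynomial.basisMonomials (Fin n) k).constr k fun m =>
    pbwAct e m.degree i (MvPolynomial.monomial m 1)

theorem pbwAct_monomial {r : ℕ} (i : Fin n) {m : Fin n →₀ ℕ} (hm : m.degree ≤ r) :
    pbwAct e r i (MvPolynomial.monomial m 1) = pbwRho e i (MvPolynomial.monomial m 1) := by
  rw [pbwRho, constr_monomial]
  induction r, hm using Nat.le_induction with
  | base => rfl
  | succ r hr ih => rw [pbwAct, constr_monomial, if_pos hr, ih]

theorem pbwAct_eq {r p : ℕ} (hp : p ≤ r + 1) (i : Fin n) {P : MvPolynomial (Fin n) k}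
    (hP : P ∈ degLT k n p) : pbwAct e r i P = pbwRho e i P := by
  have := map_mem_of_mem_degLT (T := pbwAct e r i - pbwRho e i) (W' := ⊥) (fun m hm => by
    simpa [sub_eq_zero] using pbwAct_monomial e i (show m.degree ≤ r by omega)) hP
  simpa [sub_eq_zero] using this

theorem pbwRho_sub_mem (i : Fin n) {p : ℕ} {P : MvPolynomial (Fin n) k} (hP : P ∈ degLT k n p) :
    pbwRho e i P - MvPolynomial.X i * P ∈ degLT k n p := by
  rw [← pbwAct_eq e (Nat.le_succ p) i hP]
  exact pbwAct_sub_mem e p i (Nat.le_succ p) hP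

theorem pbwRho_of_le {i : Fin n} {m : Fin n →₀ ℕ} (hm : ∀ l ∈ m.support, i ≤ l) :
    pbwRho e i (MvPolynomial.monomial m 1) = MvPolynomial.X i * MvPolynomial.monomial m 1 := by
  rw [pbwRho, constr_monomial]
  cases hr : m.degree with
  | zero => rfl
  | succ r =>
    rw [pbwAct, constr_monomial, if_neg (by omega), dif_neg, add_zero]
    rintro ⟨j, hj, N, -, rfl⟩
    exact hj.not_ge (hm j (by simp))

theorem pbwRho_of_lt {i j : Fin n} (hij : j < i) {N : Fin n →₀ ℕ} (hN : ∀ l ∈ N.support, j ≤ l) :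
    pbwRho e i (MvPolynomial.monomial (N + Finsupp.single j 1) 1) =
      MvPolynomial.X i * MvPolynomial.monomial (N + Finsupp.single j 1) 1 +
      (pbwRho e j (pbwRho e i (MvPolynomial.monomial N 1) -
        MvPolynomial.X i * MvPolynomial.monomial N 1) +
      ∑ a, e.repr ⁅e i, e j⁆ a • pbwRho e a (MvPolynomial.monomial N 1)) := by
  have hd : (N + Finsupp.single j 1).degree = N.degree + 1 := by simp
  have h : ∃ j', j' < i ∧ ∃ N' : Fin n →₀ ℕ, (∀ l ∈ N'.support, j' ≤ l) ∧
      N + Finsupp.single j 1 = N' + Finsupp.single j' 1 := ⟨j, hij, N, hN, rfl⟩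
  rw [← pbwAct_monomial e i (m := N + Finsupp.single j 1) le_rfl, hd, pbwAct, constr_monomial,
    if_neg (by omega), dif_pos h]
  obtain ⟨h1, h2⟩ := h.choose_spec.2.choose_spec
  generalize h.choose_spec.2.choose = N' at *
  generalize h.choose = j' at *
  -- The split-off variable is the least one of the monomial, so the decomposition is unique and the
  -- chosen pair is `(j, N)`.
  have hle : ∀ {i j : Fin n} {N N' : Fin n →₀ ℕ}, (∀ l ∈ N.support, j ≤ l) →
      N + Finsupp.single j 1 = N' + Finsupp.single i 1 → j ≤ i := by
    intro i j N N' hN h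
    have hi : i ∈ (N + Finsupp.single j 1).support := by simp [h]
    rcases Finset.mem_union.1 (Finsupp.support_add hi) with hi | hi
    · exact hN _ hi
    · exact (Finset.mem_singleton.1 (Finsupp.support_single_subset hi)).ge
  obtain rfl : j = j' := le_antisymm (hle hN h2) (hle h1 h2.symm)
  obtain rfl : N = N' := add_right_cancel h2
  have hmN : MvPolynomial.monomial N (1 : k) ∈ degLT k n (N.degree + 1) :=
    monomial_mem_degLT (Nat.lt_succ_self _)
  simp only [pbwAct_monomial e _ le_rfl]
  rw [pbwAct_eq e le_rfl j (pbwRho_sub_mem e i hmN)]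

/-- The action of `𝔞` on polynomials. -/
def pbwRep : 𝔞 →ₗ[k] Module.End k (MvPolynomial (Fin n) k) := e.constr k (pbwRho e)

theorem pbwRep_basis (i : Fin n) : pbwRep e (e i) = pbwRho e i := e.constr_basis k _ i

theorem pbwRep_apply (x : 𝔞) (P : MvPolynomial (Fin n) k) :
    pbwRep e x P = ∑ a, e.repr x a • pbwRho e a P := by
  simp [pbwRep, Module.Basis.constr_apply_fintype]

/-- Since `j` is minimal, `e_j X^N = X_j X^N`, and the relation is the defining clause
`pbwRho_of_lt`. -/
theorem pbwRho_comm_of_lt {i j : Fin n} (hij : j < i) {N : Fin n →₀ ℕ}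
    (hN : ∀ l ∈ N.support, j ≤ l) :
    pbwRho e i (pbwRho e j (MvPolynomial.monomial N 1)) =
      pbwRho e j (pbwRho e i (MvPolynomial.monomial N 1)) +
        pbwRep e ⁅e i, e j⁆ (MvPolynomial.monomial N 1) := by
  rw [pbwRho_of_le e hN, X_mul_monomial_one, pbwRho_of_lt e hij hN, ← pbwRep_apply, map_sub,
    X_mul_monomial_one, X_mul_monomial_one, pbwRho_of_le e (i := j), X_mul_monomial_one,
    add_right_comm N]
  · abel
  · intro l hl
    rcases Finset.mem_union.1 (Finsupp.support_add hl) with hl | hl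
    · exact hN _ hl
    · exact (Finset.mem_singleton.1 (Finsupp.support_single_subset hl)) ▸ hij.le

theorem pbwRho_comm_of_le (i : Fin n) {j : Fin n} {N : Fin n →₀ ℕ}
    (hN : ∀ l ∈ N.support, j ≤ l) :
    pbwRho e i (pbwRho e j (MvPolynomial.monomial N 1)) =
      pbwRho e j (pbwRho e i (MvPolynomial.monomial N 1)) +
        pbwRep e ⁅e i, e j⁆ (MvPolynomial.monomial N 1) := by
  rcases lt_trichotomy j i with h | rfl | h
  · exact pbwRho_comm_of_lt e h hN
  · simp
  · rw [pbwRho_comm_of_lt e h (fun l hl => h.le.trans (hN l hl)), ← lie_skew (e i) (e j), map_neg,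
      LinearMap.neg_apply]
    abel

/-- Induction on the degree, on basis vectors and monomials. If `i` or `j` is at most every variable
of the monomial, the relation holds by construction. Otherwise the least variable `l` is below both;
the monomial is `e_l X^N`, and moving `e_l` to the left reduces the claim to the relation on `X^N`
and the Jacobi identity. -/
theorem pbwRep_comm (p : ℕ) : ∀ (x y : 𝔞) {P : MvPolynomial (Fin n) k} (_ : P ∈ degLT k n p),
    pbwRep e x (pbwRep e y P) = pbwRep e y (pbwRep e x P) + pbwRep e ⁅x, y⁆ P := by
  induction p with
  | zero => intro x y P hP; rw [degLT_zero, Submodule.mem_bot] at hP; simp [hP]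
  | succ p ih =>
    suffices h : ∀ (i j : Fin n) (m : Fin n →₀ ℕ), m.degree < p + 1 →
        pbwRho e i (pbwRho e j (MvPolynomial.monomial m 1)) =
          pbwRho e j (pbwRho e i (MvPolynomial.monomial m 1)) +
            pbwRep e ⁅e i, e j⁆ (MvPolynomial.monomial m 1) by
      intro x y P hP
      have h1 : ∀ i j, pbwRho e i (pbwRho e j P) =
          pbwRho e j (pbwRho e i P) + pbwRep e ⁅e i, e j⁆ P := fun i j => by
        have := map_mem_of_mem_degLT (W' := ⊥) (T := pbwRho e i ∘ₗ pbwRho e j -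
          (pbwRho e j ∘ₗ pbwRho e i + pbwRep e ⁅e i, e j⁆)) (fun m hm => by
            simpa [sub_eq_zero] using h i j m hm) hP
        simpa [sub_eq_zero] using this
      let β : 𝔞 →ₗ[k] 𝔞 →ₗ[k] MvPolynomial (Fin n) k :=
        LinearMap.mk₂ k (fun x y => pbwRep e x (pbwRep e y P) - pbwRep e y (pbwRep e x P) -
          pbwRep e ⁅x, y⁆ P)
          (fun x x' y => by simp only [map_add, LinearMap.add_apply, add_lie]; abel)
          (fun c x y => by simp only [map_smul, LinearMap.smul_apply, smul_lie, smul_sub])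
          (fun x y y' => by simp only [map_add, LinearMap.add_apply, lie_add]; abel)
          (fun c x y => by simp only [map_smul, LinearMap.smul_apply, lie_smul, smul_sub])
      have hβ : β = 0 := e.ext fun i => e.ext fun j => by
        simp [β, pbwRep_basis, h1 i j]
      have := LinearMap.congr_fun₂ hβ x y
      simp only [β, LinearMap.mk₂_apply, LinearMap.zero_apply] at this
      rw [← sub_eq_zero, ← this]
      abel
    intro i j m hm
    by_cases hm0 : m = 0
    · exact pbwRho_comm_of_le e i (by simp [hm0])
    obtain ⟨l, N, hN, rfl⟩ := exists_min_of_ne_zero hm0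
    have hsupp : ∀ {i : Fin n}, i ≤ l → ∀ l' ∈ (N + Finsupp.single l 1).support, i ≤ l' := by
      intro i hi l' hl'
      rcases Finset.mem_union.1 (Finsupp.support_add hl') with hl' | hl'
      · exact hi.trans (hN _ hl')
      · exact (Finset.mem_singleton.1 (Finsupp.support_single_subset hl')) ▸ hi
    by_cases hjl : j ≤ l
    · exact pbwRho_comm_of_le e i (hsupp hjl)
    by_cases hil : i ≤ l
    · rw [pbwRho_comm_of_le e j (hsupp hil), ← lie_skew (e i) (e j), map_neg, LinearMap.neg_apply]
      abel
    have hd : N.degree + 1 ≤ p := by simpa using hm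
    have hz : MvPolynomial.monomial N (1 : k) ∈ degLT k n p := monomial_mem_degLT hd
    -- `e_j X^N` may have degree `p`, out of reach of the inductive hypothesis. It is `X_j X^N`, on
    -- which `l` is minimal and the relation holds by construction, plus a remainder of lower
    -- degree.
    have hcomm : ∀ {i j : Fin n}, l < i → l < j →
        pbwRho e i (pbwRho e l (pbwRho e j (MvPolynomial.monomial N 1))) =
          pbwRho e l (pbwRho e i (pbwRho e j (MvPolynomial.monomial N 1))) +
            pbwRep e ⁅e i, e l⁆ (pbwRho e j (MvPolynomial.monomial N 1)) := by
      intro i j hi hj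
      have hw := degLT_mono hd (pbwRho_sub_mem e j (monomial_mem_degLT (k := k)
        (Nat.lt_succ_self N.degree)))
      have h1 := ih (e i) (e l) hw
      have h2 : _ = _ := pbwRho_comm_of_lt e hi (N := N + Finsupp.single j 1) (by
        intro l' hl'
        rcases Finset.mem_union.1 (Finsupp.support_add hl') with hl' | hl'
        · exact hN _ hl'
        · exact (Finset.mem_singleton.1 (Finsupp.support_single_subset hl')) ▸ hj.le)
      rw [← X_mul_monomial_one] at h2
      simp only [pbwRep_basis, map_sub] at h1
      linear_combination (exp := 1) h1 + h2
    have hm' : MvPolynomial.monomial (N + Finsupp.single l 1) (1 : k) =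
        pbwRho e l (MvPolynomial.monomial N 1) := by
      rw [pbwRho_of_le e hN, X_mul_monomial_one]
    have a1 := hcomm (not_le.1 hil) (not_le.1 hjl)
    have a2 := hcomm (not_le.1 hjl) (not_le.1 hil)
    have b1 := congrArg (pbwRho e i) (ih (e j) (e l) hz)
    have b2 := congrArg (pbwRho e j) (ih (e i) (e l) hz)
    have c1 := ih (e i) ⁅e j, e l⁆ hz
    have c2 := ih (e j) ⁅e i, e l⁆ hz
    have d1 := ih ⁅e i, e j⁆ (e l) hz
    have d2 := congrArg (pbwRho e l) (ih (e i) (e j) hz)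
    have d3 : pbwRep e ⁅⁅e i, e j⁆, e l⁆ (MvPolynomial.monomial N 1) =
        pbwRep e ⁅e i, ⁅e j, e l⁆⁆ (MvPolynomial.monomial N 1) -
          pbwRep e ⁅e j, ⁅e i, e l⁆⁆ (MvPolynomial.monomial N 1) := by
      rw [lie_lie, map_sub, LinearMap.sub_apply]
    simp only [pbwRep_basis, map_add] at b1 b2 c1 c2 d1 d2
    rw [hm']
    linear_combination (exp := 1) b1 - b2 + a1 - a2 + c1 - c2 + d2 - d1 - d3

end PBW
-- The symbol isomorphism and the degree filtration of `U(𝔞)`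
section Enveloping

variable {k : Type*} [Field k] {𝔞 : Type*} [LieRing 𝔞] [LieAlgebra k 𝔞]

attribute [local instance 100] LieRing.ofAssociativeRing

local notation "𝔘" => UniversalEnvelopingAlgebra k 𝔞

theorem mkAlgHom_surjective :
    Function.Surjective (UniversalEnvelopingAlgebra.mkAlgHom k 𝔞) :=
  RingCon.mkₐ_surjective _ 

/-- A subspace of `U(𝔞)` that contains `1` and is stable under left multiplication by `𝔞` is
everything. -/
theorem enveloping_mem (W : Submodule k (UniversalEnvelopingAlgebra k 𝔞)) (h1 : 1 ∈ W)
    (hmul : ∀ x, ∀ u ∈ W, UniversalEnvelopingAlgebra.ι k x * u ∈ W)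
    (u : UniversalEnvelopingAlgebra k 𝔞) : u ∈ W := by
  obtain ⟨t, rfl⟩ := mkAlgHom_surjective (k := k) (𝔞 := 𝔞) u
  suffices h : ∀ w ∈ W, UniversalEnvelopingAlgebra.mkAlgHom k 𝔞 t * w ∈ W by
    simpa using h 1 h1
  induction t using TensorAlgebra.induction with
  | algebraMap c =>
    intro w hw
    rw [AlgHom.commutes, ← Algebra.smul_def]
    exact W.smul_mem c hw
  | ι x => exact hmul x
  | mul a b ha hb =>
    intro w hw
    rw [map_mul, mul_assoc]
    exact ha _ (hb _ hw)
  | add a b ha hb =>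
    intro w hw
    rw [map_add, add_mul]
    exact add_mem (ha _ hw) (hb _ hw)

theorem ι_lie (x y : 𝔞) : UniversalEnvelopingAlgebra.ι k ⁅x, y⁆ =
    UniversalEnvelopingAlgebra.ι k x * UniversalEnvelopingAlgebra.ι k y -
      UniversalEnvelopingAlgebra.ι k y * UniversalEnvelopingAlgebra.ι k x := by
  rw [LieHom.map_lie, LieRing.of_associative_ring_bracket]

variable {n : ℕ} (e : Module.Basis (Fin n) k 𝔞)

/-- The action of `𝔞` on polynomials, as a morphism of Lie algebras. -/
def pbwLieHom : 𝔞 →ₗ⁅k⁆ Module.End k (MvPolynomial (Fin n) k) :=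
  { pbwRep e with
    map_lie' := by
      intro x y
      refine LinearMap.ext fun P => ?_
      obtain ⟨p, hP⟩ := exists_mem_degLT P
      have := pbwRep_comm e p x y hP
      simp only [LieRing.of_associative_ring_bracket, LinearMap.sub_apply, Module.End.mul_apply,
        AddHom.toFun_eq_coe, LinearMap.coe_toAddHom]
      rw [this]
      abel }

/-- The action of `U(𝔞)` on polynomials. -/
def pbwAlgHom : 𝔘 →ₐ[k] Module.End k (MvPolynomial (Fin n) k) :=
  UniversalEnvelopingAlgebra.lift k (pbwLieHom e)

theorem pbwAlgHom_ι_mul (i : Fin n) (u : 𝔘) (P : MvPolynomial (Fin n) k) :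
    pbwAlgHom e (UniversalEnvelopingAlgebra.ι k (e i) * u) P = pbwRho e i (pbwAlgHom e u P) := by
  rw [map_mul, Module.End.mul_apply, ← pbwRep_basis]
  congr 1
  exact UniversalEnvelopingAlgebra.lift_ι_apply k (pbwLieHom e) (e i)

/-- The ordered monomials in `U(𝔞)`. -/
def pbwMonomial (m : Fin n →₀ ℕ) : 𝔘 :=
  (((Finsupp.toMultiset m).sort (· ≤ ·)).map fun i => UniversalEnvelopingAlgebra.ι k (e i)).prod

theorem pbwMonomial_zero : pbwMonomial e 0 = 1 := by simp [pbwMonomial]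

theorem pbwMonomial_add_single {m : Fin n →₀ ℕ} {j : Fin n} (hj : ∀ l ∈ m.support, j ≤ l) :
    pbwMonomial e (m + Finsupp.single j 1) =
      UniversalEnvelopingAlgebra.ι k (e j) * pbwMonomial e m := by
  rw [pbwMonomial, map_add, Finsupp.toMultiset_single, one_smul, add_comm, Multiset.singleton_add,
    Multiset.sort_cons, List.map_cons, List.prod_cons, pbwMonomial]
  intro l hl
  exact hj l ((Finsupp.mem_toMultiset _ _).1 hl)

/-- The linear map from polynomials to `U(𝔞)` given by ordered monomials. -/
def pbwMap : MvPolynomial (Fin n) k →ₗ[k] 𝔘 :=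
  (MvPolynomial.basisMonomials (Fin n) k).constr k (pbwMonomial e)

theorem pbwMap_monomial (m : Fin n →₀ ℕ) :
    pbwMap e (MvPolynomial.monomial m 1) = pbwMonomial e m := constr_monomial _ _

theorem pbwMap_rho_of_le {i : Fin n} {m : Fin n →₀ ℕ} (hm : ∀ l ∈ m.support, i ≤ l) :
    pbwMap e (pbwRho e i (MvPolynomial.monomial m 1)) =
      UniversalEnvelopingAlgebra.ι k (e i) * pbwMap e (MvPolynomial.monomial m 1) := by
  rw [pbwRho_of_le e hm, X_mul_monomial_one, pbwMap_monomial, pbwMap_monomial,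
    pbwMonomial_add_single e hm]

/-- If the least variable `j` lies below `i`, both sides are rewritten with `e_i e_j = e_j e_i +
[e_i, e_j]`, valid on polynomials by `pbwRho_comm_of_lt` and in `U(𝔞)` by definition. -/
theorem pbwMap_rho (p : ℕ) : ∀ (i : Fin n) {P : MvPolynomial (Fin n) k} (_ : P ∈ degLT k n p),
    pbwMap e (pbwRho e i P) = UniversalEnvelopingAlgebra.ι k (e i) * pbwMap e P := by
  induction p with
  | zero => intro i P hP; rw [degLT_zero, Submodule.mem_bot] at hP; simp [hP]
  | succ p ih =>
    suffices h : ∀ (i : Fin n) (m : Fin n →₀ ℕ), m.degree < p + 1 →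
        pbwMap e (pbwRho e i (MvPolynomial.monomial m 1)) =
          UniversalEnvelopingAlgebra.ι k (e i) * pbwMap e (MvPolynomial.monomial m 1) by
      intro i P hP
      have := map_mem_of_mem_degLT (W' := ⊥) (T := pbwMap e ∘ₗ pbwRho e i -
        LinearMap.mulLeft k (UniversalEnvelopingAlgebra.ι k (e i)) ∘ₗ pbwMap e) (fun m hm => by
          simpa [sub_eq_zero] using h i m hm) hP
      simpa [sub_eq_zero] using this
    intro i m hm
    by_cases hm0 : m = 0
    · exact pbwMap_rho_of_le e (by simp [hm0])
    obtain ⟨j, N, hN, rfl⟩ := exists_min_of_ne_zero hm0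
    have hsupp : ∀ {i : Fin n}, i ≤ j → ∀ l ∈ (N + Finsupp.single j 1).support, i ≤ l := by
      intro i hi l hl
      rcases Finset.mem_union.1 (Finsupp.support_add hl) with hl | hl
      · exact hi.trans (hN _ hl)
      · exact (Finset.mem_singleton.1 (Finsupp.support_single_subset hl)) ▸ hi
    by_cases hij : i ≤ j
    · exact pbwMap_rho_of_le e (hsupp hij)
    have hd : N.degree + 1 ≤ p := by simpa using hm
    have hz : MvPolynomial.monomial N (1 : k) ∈ degLT k n p := monomial_mem_degLT hd
    -- `e_i X^N` is `X_i X^N`, on which `j` is still minimal, plus a remainder of degree covered by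
    -- induction.
    have hw := degLT_mono hd (pbwRho_sub_mem e i (monomial_mem_degLT (k := k)
      (Nat.lt_succ_self N.degree)))
    have h1 := ih j hw
    have h2 : _ = _ := pbwMap_rho_of_le e (i := j) (m := N + Finsupp.single i 1) (by
      intro l hl
      rcases Finset.mem_union.1 (Finsupp.support_add hl) with hl | hl
      · exact hN _ hl
      · exact (Finset.mem_singleton.1 (Finsupp.support_single_subset hl)) ▸ (not_le.1 hij).le)
    rw [← X_mul_monomial_one] at h2
    simp only [map_sub, mul_sub] at h1
    rw [sub_eq_sub_iff_add_eq_add, h2, add_left_inj, ih i hz, ← mul_assoc] at h1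
    have h3 : pbwMap e (pbwRep e ⁅e i, e j⁆ (MvPolynomial.monomial N 1)) =
        UniversalEnvelopingAlgebra.ι k ⁅e i, e j⁆ * pbwMap e (MvPolynomial.monomial N 1) := by
      conv_rhs => rw [← e.sum_repr ⁅e i, e j⁆]
      simp only [pbwRep_apply, map_sum, map_smul, ih _ hz, Finset.sum_mul, smul_mul_assoc]
    have h4 : MvPolynomial.monomial (N + Finsupp.single j 1) (1 : k) =
        pbwRho e j (MvPolynomial.monomial N 1) := by
      rw [pbwRho_of_le e hN, X_mul_monomial_one]
    rw [h4, pbwRho_comm_of_lt e (not_le.1 hij) hN, map_add, h1, h3, pbwMap_rho_of_le e hN, ι_lie]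
    noncomm_ring

/-- The symbol map, inverse to `pbwMap`. -/
def pbwSymbol : 𝔘 →ₗ[k] MvPolynomial (Fin n) k :=
  LinearMap.applyₗ 1 ∘ₗ (pbwAlgHom e).toLinearMap

theorem pbwSymbol_one : pbwSymbol e 1 = 1 := by simp [pbwSymbol]

theorem pbwSymbol_ι_mul (i : Fin n) (u : 𝔘) :
    pbwSymbol e (UniversalEnvelopingAlgebra.ι k (e i) * u) = pbwRho e i (pbwSymbol e u) :=
  pbwAlgHom_ι_mul e i u 1

theorem pbwMap_one : pbwMap e 1 = 1 := by
  simpa [pbwMonomial_zero] using pbwMap_monomial e 0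

/-- Ordered monomials span: the elements fixed by the composite contain `1` and are stable under
left multiplication by `𝔞`. -/
theorem pbwMap_pbwSymbol (u : 𝔘) : pbwMap e (pbwSymbol e u) = u := by
  refine enveloping_mem (LinearMap.eqLocus (pbwMap e ∘ₗ pbwSymbol e) LinearMap.id) ?_ ?_ u
  · simp [pbwSymbol_one, pbwMap_one]
  · intro x u hu
    simp only [LinearMap.mem_eqLocus, LinearMap.comp_apply, LinearMap.id_apply] at hu ⊢
    rw [← e.sum_repr x]
    simp only [map_sum, map_smul, Finset.sum_mul, smul_mul_assoc]
    refine Finset.sum_congr rfl fun i _ => ?_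
    obtain ⟨p, hp⟩ := exists_mem_degLT (pbwSymbol e u)
    rw [pbwSymbol_ι_mul, pbwMap_rho e p i hp, hu]

theorem monomial_min_induction {motive : (Fin n →₀ ℕ) → Prop} (zero : motive 0)
    (step : ∀ j N, (∀ l ∈ N.support, j ≤ l) → motive N → motive (N + Finsupp.single j 1))
    (m : Fin n →₀ ℕ) : motive m := by
  induction hd : m.degree generalizing m with
  | zero => rwa [(Finsupp.degree_eq_zero_iff m).1 hd]
  | succ d ih =>
    obtain ⟨j, N, hN, rfl⟩ := exists_min_of_ne_zero (m := m) (by rintro rfl; simp at hd)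
    exact step j N hN (ih N (by simpa using hd))

/-- Ordered monomials are independent: applied to `1`, their factors act from the largest variable
down, so each acts as plain multiplication. -/
theorem pbwSymbol_pbwMap (P : MvPolynomial (Fin n) k) : pbwSymbol e (pbwMap e P) = P := by
  suffices h : pbwSymbol e ∘ₗ pbwMap e = LinearMap.id from LinearMap.congr_fun h P
  refine linearMap_ext_monomial fun m => ?_
  simp only [LinearMap.comp_apply, LinearMap.id_apply, pbwMap_monomial]
  induction m using monomial_min_induction with
  | zero => rw [pbwMonomial_zero, pbwSymbol_one]; rfl
  | step j N hN ih =>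
    rw [pbwMonomial_add_single e hN, pbwSymbol_ι_mul, ih, pbwRho_of_le e hN, X_mul_monomial_one]

/-- The elements of `U(𝔞)` of filtration degree `< p`. -/
def uFilt (p : ℕ) : Submodule k 𝔘 := (degLT k n p).comap (pbwSymbol e)

theorem mem_uFilt {p : ℕ} {u : 𝔘} : u ∈ uFilt e p ↔ pbwSymbol e u ∈ degLT k n p := Iff.rfl

theorem uFilt_mono {p p' : ℕ} (h : p ≤ p') : uFilt e p ≤ uFilt e p' :=
  Submodule.comap_mono (degLT_mono h)

theorem uFilt_zero : uFilt e 0 = ⊥ := by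
  refine (Submodule.eq_bot_iff _).2 fun u hu => ?_
  rw [mem_uFilt, degLT_zero, Submodule.mem_bot] at hu
  rw [← pbwMap_pbwSymbol e u, hu, map_zero]

theorem exists_mem_uFilt (u : 𝔘) : ∃ p, u ∈ uFilt e p := exists_mem_degLT (pbwSymbol e u)

theorem ι_mul_mem_uFilt (x : 𝔞) {p : ℕ} {u : 𝔘} (hu : u ∈ uFilt e p) :
    UniversalEnvelopingAlgebra.ι k x * u ∈ uFilt e (p + 1) := by
  rw [← e.sum_repr x]
  simp only [map_sum, map_smul, Finset.sum_mul, smul_mul_assoc]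
  refine sum_mem fun i _ => Submodule.smul_mem _ _ ?_
  rw [mem_uFilt, pbwSymbol_ι_mul]
  simpa using add_mem (degLT_mono (Nat.le_succ _) (pbwRho_sub_mem e i hu)) (X_mul_mem_degLT i hu)

/-- `[e_j u, x] = e_j [u, x] + [e_j, x] u`, so by induction on ordered monomials commutators do not
raise the degree. -/
theorem mul_ι_sub_mem_uFilt (x : 𝔞) {p : ℕ} {u : 𝔘} (hu : u ∈ uFilt e p) :
    u * UniversalEnvelopingAlgebra.ι k x - UniversalEnvelopingAlgebra.ι k x * u ∈ uFilt e p := by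
  suffices h : ∀ (m : Fin n →₀ ℕ) (x : 𝔞), pbwMonomial e m * UniversalEnvelopingAlgebra.ι k x -
      UniversalEnvelopingAlgebra.ι k x * pbwMonomial e m ∈ uFilt e (m.degree + 1) by
    rw [← pbwMap_pbwSymbol e u]
    refine map_mem_of_mem_degLT (T := (LinearMap.mulRight k (UniversalEnvelopingAlgebra.ι k x) -
      LinearMap.mulLeft k (UniversalEnvelopingAlgebra.ι k x)) ∘ₗ pbwMap e) (fun m hm => ?_) hu
    simpa [pbwMap_monomial] using uFilt_mono e hm (h m x)
  intro m
  induction m using monomial_min_induction with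
  | zero => intro x; simp [pbwMonomial_zero]
  | step j N hN ih =>
    intro x
    have hN' : pbwMonomial e N ∈ uFilt e (N.degree + 1) := by
      rw [mem_uFilt, ← pbwMap_monomial, pbwSymbol_pbwMap]
      exact monomial_mem_degLT (Nat.lt_succ_self _)
    have h1 := ι_mul_mem_uFilt e (e j) (ih x)
    have h2 := ι_mul_mem_uFilt e ⁅e j, x⁆ hN'
    have h3 := add_mem h1 h2
    rw [pbwMonomial_add_single e hN]
    convert h3 using 1
    · simp
    · rw [ι_lie]; noncomm_ring

/-- The symbol of `u x` is the product of the symbols of `u` and `x`. -/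
theorem pbwSymbol_mul_ι_sub_mem (x : 𝔞) {p : ℕ} {u : 𝔘} (hu : u ∈ uFilt e p) :
    pbwSymbol e (u * UniversalEnvelopingAlgebra.ι k x) -
      ∑ i, e.repr x i • (MvPolynomial.X i * pbwSymbol e u) ∈ degLT k n p := by
  have h1 : pbwSymbol e _ ∈ degLT k n p := mul_ι_sub_mem_uFilt e x hu
  have h2 : pbwSymbol e (UniversalEnvelopingAlgebra.ι k x * u) -
      ∑ i, e.repr x i • (MvPolynomial.X i * pbwSymbol e u) ∈ degLT k n p := by
    conv in UniversalEnvelopingAlgebra.ι k x => rw [← e.sum_repr x]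
    simp only [map_sum, map_smul, Finset.sum_mul, smul_mul_assoc, pbwSymbol_ι_mul]
    rw [← Finset.sum_sub_distrib]
    refine sum_mem fun i _ => ?_
    rw [← smul_sub]
    exact Submodule.smul_mem _ _ (pbwRho_sub_mem e i hu)
  simpa using add_mem h1 h2

end Enveloping

/-! ### Exactness of the Koszul complex of `U(𝔞)` -/

section KoszulGeneral

variable {k : Type*} [Field k] {𝔞 : Type*} [LieRing 𝔞] [LieAlgebra k 𝔞]
variable {B : Type*} [Ring B] [Algebra k B]

theorem koszulD_tmul_ιMulti [CharZero k] (φ : 𝔞 →ₗ[k] B) (q : ℕ) (u : B) (X : Fin (q + 1) → 𝔞) :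
    koszulD φ q (u ⊗ₜ exteriorPower.ιMulti k (q + 1) X) =
      ∑ j : Fin (q + 1), (-1 : ℤ) ^ (j : ℕ) •
        ((u * φ (X j)) ⊗ₜ exteriorPower.ιMulti k q (j.removeNth X)) +
      u ⊗ₜ extBracket q (exteriorPower.ιMulti k (q + 1) X) := by
  rw [isKoszulDifferential_koszulD φ, koszulFormula, koszulBracketPart_eq]
  simp [neg_one_pow_smul_tmul]

theorem koszulMod_hom_ext {N : Type*} [AddCommGroup N] [Module k N] {q : ℕ}
    {f f' : KoszulMod k 𝔞 B q →ₗ[k] N}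
    (h : ∀ u X, f (u ⊗ₜ exteriorPower.ιMulti k q X) = f' (u ⊗ₜ exteriorPower.ιMulti k q X)) :
    f = f' := by
  refine TensorProduct.ext (LinearMap.ext fun u => exteriorPower_ext fun X => ?_)
  simpa using h u X

/-- Only compatibility with right multiplication is required, because the maps `P ↦ P.coeff t` and
`a ↦ a h ^ t` need not be ring morphisms. -/
theorem rTensor_koszulD [CharZero k] {B' : Type*} [Ring B'] [Algebra k B'] {φ : 𝔞 →ₗ[k] B}
    {φ' : 𝔞 →ₗ[k] B'} (f : B →ₗ[k] B') (hf : ∀ b x, f (b * φ x) = f b * φ' x) (q : ℕ)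
    (z : KoszulMod k 𝔞 B (q + 1)) :
    f.rTensor (⋀[k]^q 𝔞) (koszulD φ q z) = koszulD φ' q (f.rTensor (⋀[k]^(q + 1) 𝔞) z) := by
  have : f.rTensor (⋀[k]^q 𝔞) ∘ₗ (koszulD φ q).restrictScalars k =
      (koszulD φ' q).restrictScalars k ∘ₗ f.rTensor (⋀[k]^(q + 1) 𝔞) := by
    refine koszulMod_hom_ext fun u X => ?_
    simp [koszulD_tmul_ιMulti, hf]
  exact LinearMap.congr_fun this z

variable (k 𝔞 B) in
/-- The isomorphism `B ⊗ ⋀^0 𝔞 ≃ B`. -/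
def koszulZeroEquiv : KoszulMod k 𝔞 B 0 ≃ₗ[B] B :=
  (TensorProduct.AlgebraTensorModule.congr (LinearEquiv.refl B B)
    (exteriorPower.zeroEquiv k 𝔞)).trans (TensorProduct.AlgebraTensorModule.rid k B B)

theorem koszulZeroEquiv_tmul (u : B) (v : Fin 0 → 𝔞) :
    koszulZeroEquiv k 𝔞 B (u ⊗ₜ exteriorPower.ιMulti k 0 v) = u := by
  simp [koszulZeroEquiv]

theorem koszulZeroEquiv_koszulD [CharZero k] (φ : 𝔞 →ₗ[k] B) (u : B) (X : Fin 1 → 𝔞) :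
    koszulZeroEquiv k 𝔞 B (koszulD φ 0 (u ⊗ₜ exteriorPower.ιMulti k 1 X)) = u * φ (X 0) := by
  simp [koszulD_tmul_ιMulti, koszulZeroEquiv_tmul, extBracket_zero]

variable (k 𝔞) in
/-- The augmentation `B ⊗ ⋀^0 𝔞 → S`. -/
def koszulAug {S : Type*} [CommRing S] (ε : B →+* S) :
    KoszulMod k 𝔞 B 0 →ₗ[B] AugModule ε :=
  LinearMap.toSpanSingleton B (AugModule ε) (AugModule.of ε 1) ∘ₗ
    (koszulZeroEquiv k 𝔞 B).toLinearMap

theorem koszulAug_apply {S : Type*} [CommRing S] (ε : B →+* S) (z : KoszulMod k 𝔞 B 0) :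
    koszulAug k 𝔞 ε z = AugModule.of ε (ε (koszulZeroEquiv k 𝔞 B z)) :=
  mul_one (ε (koszulZeroEquiv k 𝔞 B z))

theorem isKoszulAugmentation_koszulAug {S : Type*} [CommRing S] (ε : B →+* S) :
    IsKoszulAugmentation k ε (koszulAug k 𝔞 ε) := fun u v => by
  rw [koszulAug_apply, koszulZeroEquiv_tmul]

end KoszulGeneral

/-! ### The contracting homotopy given by partial derivatives -/

section Exactness

variable {k : Type*} [Field k] {𝔞 : Type*} [LieRing 𝔞] [LieAlgebra k 𝔞]

attribute [local instance 100] LieRing.ofAssociativeRing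

local notation "𝔘" => UniversalEnvelopingAlgebra k 𝔞

variable (k 𝔞) in
/-- The inclusion of `𝔞` in `U(𝔞)`, as a linear map. -/
def envι : 𝔞 →ₗ[k] UniversalEnvelopingAlgebra k 𝔞 where
  toFun x := UniversalEnvelopingAlgebra.ι k x
  map_add' := map_add _
  map_smul' := map_smul _

theorem envι_apply (x : 𝔞) : envι k 𝔞 x = UniversalEnvelopingAlgebra.ι k x := rfl

variable (k 𝔞) in
/-- The Koszul differential of `U(𝔞)`. -/
abbrev envD [CharZero k] (q : ℕ) :
    KoszulMod k 𝔞 (UniversalEnvelopingAlgebra k 𝔞) (q + 1) →ₗ[UniversalEnvelopingAlgebra k 𝔞]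
      KoszulMod k 𝔞 (UniversalEnvelopingAlgebra k 𝔞) q :=
  koszulD (envι k 𝔞) q

variable {n : ℕ} (e : Module.Basis (Fin n) k 𝔞)

theorem pderiv_mem_degLT (i : Fin n) {p : ℕ} {P : MvPolynomial (Fin n) k}
    (hP : P ∈ degLT k n (p + 1)) : MvPolynomial.pderiv i P ∈ degLT k n p := by
  refine map_mem_of_mem_degLT (T := (MvPolynomial.pderiv i).toLinearMap) (fun m hm => ?_) hP
  rw [Derivation.coeFn_coe, MvPolynomial.pderiv_monomial, ← mul_comm, ← smul_eq_mul,
    ← MvPolynomial.smul_monomial]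
  by_cases h : m i = 0
  · simp [h]
  · refine Submodule.smul_mem _ _ (monomial_mem_degLT ?_)
    have h1 : m = (m - Finsupp.single i 1) + Finsupp.single i 1 := by
      rw [tsub_add_cancel_of_le]
      rwa [Finsupp.single_le_iff, Nat.one_le_iff_ne_zero]
    rw [h1] at hm
    simpa using hm

theorem euler_sub_mem_degLT {p : ℕ} {P : MvPolynomial (Fin n) k} (hP : P ∈ degLT k n (p + 1)) :
    ∑ i, MvPolynomial.X i * MvPolynomial.pderiv i P - (p : k) • P ∈ degLT k n p := by
  have key := map_mem_of_mem_degLT (W' := degLT k n p) (T := ∑ i, LinearMap.mulLeft k (MvPolynomial.X i) ∘ₗ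
    (MvPolynomial.pderiv i).toLinearMap - (p : k) • LinearMap.id) (fun m hm => ?_) hP
  · simpa using key
  have h : ∑ i, (MvPolynomial.X i : MvPolynomial (Fin n) k) *
      MvPolynomial.pderiv i (MvPolynomial.monomial m 1) =
        (m.degree : k) • MvPolynomial.monomial m 1 := by
    simp only [MvPolynomial.X_mul_pderiv_monomial]
    rw [← Finset.sum_smul, ← Finsupp.degree_eq_sum, Nat.cast_smul_eq_nsmul]
  simp only [LinearMap.sub_apply, LinearMap.sum_apply, LinearMap.comp_apply,
    LinearMap.mulLeft_apply, Derivation.coeFn_coe, LinearMap.smul_apply, LinearMap.id_apply, h]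
  rcases (Nat.lt_succ_iff.1 hm).eq_or_lt with h | h
  · simp [h]
  · exact sub_mem (Submodule.smul_mem _ _ (monomial_mem_degLT h))
      (Submodule.smul_mem _ _ (monomial_mem_degLT h))

/-- The partial derivatives, transported to `U(𝔞)`. -/
def envDeriv (i : Fin n) : 𝔘 →ₗ[k] 𝔘 :=
  pbwMap e ∘ₗ (MvPolynomial.pderiv i).toLinearMap ∘ₗ pbwSymbol e

theorem pbwSymbol_envDeriv (i : Fin n) (u : 𝔘) :
    pbwSymbol e (envDeriv e i u) = MvPolynomial.pderiv i (pbwSymbol e u) :=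
  pbwSymbol_pbwMap e _

theorem envDeriv_mem (i : Fin n) {p : ℕ} {u : 𝔘} (hu : u ∈ uFilt e (p + 1)) :
    envDeriv e i u ∈ uFilt e p := by
  rw [mem_uFilt, pbwSymbol_envDeriv]
  exact pderiv_mem_degLT i hu

/-- Up to lower degree the symbol of `u x` is the product of symbols, so this is the Leibniz rule,
with the `i`-th coordinate of `x` as the derivative of `x`. -/
theorem envDeriv_mul_ι_sub_mem (i : Fin n) (x : 𝔞) {p : ℕ} {u : 𝔘} (hu : u ∈ uFilt e (p + 1)) :
    envDeriv e i (u * UniversalEnvelopingAlgebra.ι k x) -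
      envDeriv e i u * UniversalEnvelopingAlgebra.ι k x - e.repr x i • u ∈ uFilt e p := by
  have h1 := pderiv_mem_degLT i (pbwSymbol_mul_ι_sub_mem e x hu)
  have h2 := pbwSymbol_mul_ι_sub_mem e x (envDeriv_mem e i hu)
  rw [mem_uFilt, map_sub, map_sub, map_smul, pbwSymbol_envDeriv]
  rw [pbwSymbol_envDeriv] at h2
  have h3 : ∑ a, e.repr x a • MvPolynomial.pderiv i (MvPolynomial.X a * pbwSymbol e u) =
      ∑ a, e.repr x a • (MvPolynomial.X a * MvPolynomial.pderiv i (pbwSymbol e u)) +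
        e.repr x i • pbwSymbol e u := by
    classical
    simp only [MvPolynomial.pderiv_mul, MvPolynomial.pderiv_X, smul_add, Finset.sum_add_distrib]
    rw [add_comm]
    congr 1
    rw [Finset.sum_eq_single i]
    · simp
    · intro b _ hb; simp [hb]
    · simp
  simp only [map_sub, map_sum, Derivation.map_smul] at h1
  rw [h3] at h1
  have h4 := sub_mem h1 h2
  convert h4 using 1
  abel

theorem sum_envDeriv_mul_ι_sub_mem {p : ℕ} {u : 𝔘} (hu : u ∈ uFilt e (p + 1)) :
    ∑ i, envDeriv e i u * UniversalEnvelopingAlgebra.ι k (e i) - (p : k) • u ∈ uFilt e p := by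
  have h1 : ∀ i, pbwSymbol e (envDeriv e i u * UniversalEnvelopingAlgebra.ι k (e i)) -
      MvPolynomial.X i * MvPolynomial.pderiv i (pbwSymbol e u) ∈ degLT k n p := fun i => by
    have := pbwSymbol_mul_ι_sub_mem e (e i) (envDeriv_mem e i hu)
    rw [pbwSymbol_envDeriv, Finset.sum_eq_single i] at this
    · simpa using this
    · intro b _ hb; simp [hb.symm]
    · simp
  have h2 := add_mem (sum_mem fun i (_ : i ∈ Finset.univ) => h1 i) (euler_sub_mem_degLT hu)
  rw [mem_uFilt, map_sub, map_sum, map_smul]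
  rwa [Finset.sum_sub_distrib, sub_add_sub_cancel] at h2

/-- The filtration of `U(𝔞) ⊗ ⋀^q 𝔞` induced by the one of `U(𝔞)`. -/
def kFilt (p q : ℕ) : Submodule k (KoszulMod k 𝔞 𝔘 q) :=
  Submodule.map₂ (TensorProduct.mk k 𝔘 (⋀[k]^q 𝔞)) (uFilt e p) ⊤

theorem tmul_mem_kFilt {p q : ℕ} {u : 𝔘} (hu : u ∈ uFilt e p) (w : ⋀[k]^q 𝔞) :
    u ⊗ₜ w ∈ kFilt e p q := Submodule.apply_mem_map₂ _ hu Submodule.mem_top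

theorem kFilt_mono {p p' : ℕ} (h : p ≤ p') (q : ℕ) : kFilt e p q ≤ kFilt e p' q :=
  Submodule.map₂_le_map₂_left (uFilt_mono e h)

theorem kFilt_zero (q : ℕ) : kFilt e 0 q = ⊥ := by
  rw [kFilt, uFilt_zero, Submodule.map₂_bot_left]

theorem exists_mem_kFilt {q : ℕ} (z : KoszulMod k 𝔞 𝔘 q) : ∃ p, z ∈ kFilt e p q := by
  induction z using TensorProduct.induction_on with
  | zero => exact ⟨0, zero_mem _⟩
  | tmul u w =>
    obtain ⟨p, hp⟩ := exists_mem_uFilt e u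
    exact ⟨p, tmul_mem_kFilt e hp w⟩
  | add z z' hz hz' =>
    obtain ⟨p, hp⟩ := hz
    obtain ⟨p', hp'⟩ := hz'
    exact ⟨max p p', add_mem (kFilt_mono e (le_max_left _ _) q hp)
      (kFilt_mono e (le_max_right _ _) q hp')⟩

theorem map_mem_of_mem_kFilt {p q : ℕ} {W : Type*} [AddCommGroup W] [Module k W]
    {T : KoszulMod k 𝔞 𝔘 q →ₗ[k] W} {W' : Submodule k W}
    (hT : ∀ u ∈ uFilt e p, ∀ X, T (u ⊗ₜ exteriorPower.ιMulti k q X) ∈ W')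
    {z : KoszulMod k 𝔞 𝔘 q} (hz : z ∈ kFilt e p q) : T z ∈ W' := by
  have : kFilt e p q ≤ W'.comap T := by
    refine Submodule.map₂_le.2 fun u hu w _ => ?_
    have : (⊤ : Submodule k (⋀[k]^q 𝔞)) ≤
        W'.comap (T ∘ₗ TensorProduct.mk k 𝔘 (⋀[k]^q 𝔞) u) := by
      rw [← exteriorPower.ιMulti_span, Submodule.span_le]
      rintro _ ⟨X, rfl⟩
      exact hT u hu X
    exact this (Submodule.mem_top (x := w))
  exact this hz

/-- The contracting homotopy. -/
def envHomotopy (q : ℕ) : KoszulMod k 𝔞 𝔘 q →ₗ[k] KoszulMod k 𝔞 𝔘 (q + 1) :=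
  ∑ i, TensorProduct.map (envDeriv e i) (wedge q (e i))

/-- Putting `X_j` back in its place absorbs the sign, so all `q + 1` terms are equal. -/
theorem sum_wedge_removeNth {q : ℕ} (X : Fin (q + 1) → 𝔞) :
    ∑ j : Fin (q + 1), (-1 : ℤ) ^ (j : ℕ) •
      wedge q (X j) (exteriorPower.ιMulti k q (j.removeNth X)) =
        ((q : k) + 1) • exteriorPower.ιMulti k (q + 1) X := by
  have := DFunLike.congr_fun (AlternatingMap.alternatizeUncurryFin_curryLeft
    (exteriorPower.ιMulti k (q + 1) (M := 𝔞))) X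
  rw [AlternatingMap.alternatizeUncurryFin_apply] at this
  simpa [wedge, add_smul, Nat.cast_smul_eq_nsmul] using this

/-- By Cartan's formula the Lie derivatives contribute the polynomial degree `p` through Euler's
identity, and the commutators of the derivations with the differential contribute the exterior
degree `q + 1`. -/
theorem envHomotopy_koszulD [CharZero k] {p q : ℕ} {u : 𝔘} (hu : u ∈ uFilt e (p + 1))
    (X : Fin (q + 1) → 𝔞) :
    envD k 𝔞 (q + 1) (envHomotopy e (q + 1) (u ⊗ₜ exteriorPower.ιMulti k (q + 1) X)) +
        envHomotopy e q (envD k 𝔞 q (u ⊗ₜ exteriorPower.ιMulti k (q + 1) X)) -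
      ((p + q + 1 : ℕ) : k) • (u ⊗ₜ exteriorPower.ιMulti k (q + 1) X) ∈ kFilt e p (q + 1) := by
  set w := exteriorPower.ιMulti k (q + 1) X with hw
  -- Lie derivatives
  have h1 : ∑ i, kLie (envι k 𝔞) (q + 1) (e i)
      (envDeriv e i u ⊗ₜ w) - (p : k) • (u ⊗ₜ w) ∈ kFilt e p (q + 1) := by
    have h := sub_mem (tmul_mem_kFilt e (sum_envDeriv_mul_ι_sub_mem e hu) w)
      (sum_mem fun i (_ : i ∈ Finset.univ) =>
        tmul_mem_kFilt e (envDeriv_mem e i hu) (extAd (q + 1) (e i) w))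
    simp only [kLie_tmul, Finset.sum_sub_distrib]
    rw [TensorProduct.sub_tmul, TensorProduct.sum_tmul, ← TensorProduct.smul_tmul'] at h
    convert h using 1
    simp only [envι_apply]
    abel
  -- the commutator of the derivations with the differential
  have h2 : envHomotopy e q (envD k 𝔞 q (u ⊗ₜ w)) -
      ∑ i, kWedge 𝔘 q (e i) (envD k 𝔞 q (envDeriv e i u ⊗ₜ w)) - ((q : k) + 1) • (u ⊗ₜ w) ∈
        kFilt e p (q + 1) := by
    have h : ∀ i (j : Fin (q + 1)), _ := fun i j =>
      tmul_mem_kFilt e (envDeriv_mul_ι_sub_mem e i (X j) hu)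
        (wedge q (e i) ((-1 : ℤ) ^ (j : ℕ) • exteriorPower.ιMulti k q (j.removeNth X)))
    have h' := sum_mem fun i (_ : i ∈ Finset.univ) => sum_mem fun j (_ : j ∈ Finset.univ) => h i j
    convert h' using 1
    simp only [TensorProduct.sub_tmul, Finset.sum_sub_distrib]
    have h3 : ((q : k) + 1) • (u ⊗ₜ[k] w) =
        ∑ i, ∑ j : Fin (q + 1), (e.repr (X j) i • u) ⊗ₜ[k]
          wedge q (e i) ((-1 : ℤ) ^ (j : ℕ) • exteriorPower.ιMulti k q (j.removeNth X)) := by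
      rw [← TensorProduct.tmul_smul, hw, ← sum_wedge_removeNth, TensorProduct.tmul_sum,
        Finset.sum_comm]
      refine Finset.sum_congr rfl fun j _ => ?_
      simp only [TensorProduct.smul_tmul, ← TensorProduct.tmul_sum]
      congr 1
      conv_lhs => rw [← e.sum_repr (X j)]
      simp only [map_sum, map_smul, map_zsmul, LinearMap.sum_apply, LinearMap.smul_apply,
        Finset.smul_sum, smul_comm ((-1 : ℤ) ^ (j : ℕ))]
    rw [h3, hw]
    simp only [koszulD_tmul_ιMulti, map_add, map_sum, envHomotopy, LinearMap.sum_apply,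
      map_zsmul, TensorProduct.map_tmul, envι_apply, Finset.sum_add_distrib,
      TensorProduct.AlgebraTensorModule.lTensor_tmul, TensorProduct.tmul_smul]
    rw [Finset.sum_comm]
    -- The bracket parts of the two differentials coincide and cancel exactly.
    rw [add_sub_add_right_eq_sub]
    congr 2
    simp only [Finset.smul_sum]
    exact Finset.sum_comm
  have h3 : envD k 𝔞 (q + 1) (envHomotopy e (q + 1) (u ⊗ₜ w)) =
      ∑ i, kLie (envι k 𝔞) (q + 1) (e i) (envDeriv e i u ⊗ₜ w) -
        ∑ i, kWedge 𝔘 q (e i) (envD k 𝔞 q (envDeriv e i u ⊗ₜ w)) := by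
    rw [envHomotopy, LinearMap.sum_apply, map_sum, ← Finset.sum_sub_distrib]
    refine Finset.sum_congr rfl fun i _ => ?_
    rw [← koszulD_kWedge]
    rfl
  convert add_mem h1 h2 using 1
  rw [h3]
  push_cast
  module

theorem envD_envD [CharZero k] (q : ℕ) (z : KoszulMod k 𝔞 𝔘 (q + 2)) :
    envD k 𝔞 q (envD k 𝔞 (q + 1) z) = 0 :=
  koszulD_koszulD (fun x y => ι_lie x y) q z

-- For a cycle `z` of polynomial degree at most `p`, the homotopy writes `(p + q + 1) z` as a
-- boundary plus a cycle of lower degree, a boundary by induction; characteristic `0` allows the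
-- division.
include e in
theorem envD_exact [CharZero k] (q : ℕ) :
    Function.Exact (envD k 𝔞 (q + 1)) (envD k 𝔞 q) := by
  intro z
  refine ⟨fun hz => ?_, ?_⟩
  · obtain ⟨p, hp⟩ := exists_mem_kFilt e z
    show z ∈ LinearMap.range ((envD k 𝔞 (q + 1)).restrictScalars k)
    induction p generalizing z with
    | zero =>
      rw [kFilt_zero, Submodule.mem_bot] at hp
      rw [hp]
      exact zero_mem _
    | succ p ih =>
      have h := map_mem_of_mem_kFilt e (W' := kFilt e p (q + 1))
        (T := (envD k 𝔞 (q + 1)).restrictScalars k ∘ₗ envHomotopy e (q + 1) +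
          envHomotopy e q ∘ₗ (envD k 𝔞 q).restrictScalars k -
            ((p + q + 1 : ℕ) : k) • LinearMap.id)
        (fun u hu X => by
          simp only [LinearMap.sub_apply, LinearMap.add_apply, LinearMap.comp_apply,
            LinearMap.restrictScalars_apply, LinearMap.smul_apply, LinearMap.id_apply]
          exact envHomotopy_koszulD e hu X) hp
      simp only [LinearMap.sub_apply, LinearMap.add_apply, LinearMap.comp_apply,
        LinearMap.restrictScalars_apply, hz, map_zero, add_zero, LinearMap.smul_apply,
        LinearMap.id_apply] at h
      have h' := ih _ (by
        have : envD k 𝔞 q (((p + q + 1 : ℕ) : k) • z) = 0 := by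
          rw [LinearMap.map_smul_of_tower, hz, smul_zero]
        rw [map_sub, envD_envD, this, sub_zero]) h
      have h'' := sub_mem (LinearMap.mem_range_self
        ((envD k 𝔞 (q + 1)).restrictScalars k) (envHomotopy e (q + 1) z)) h'
      rw [LinearMap.restrictScalars_apply, sub_sub_cancel] at h''
      exact (Submodule.smul_mem_iff _ (Nat.cast_ne_zero.2 (Nat.succ_ne_zero (p + q)))).1 h''
  · rintro ⟨y, rfl⟩
    exact envD_envD q y

end Exactness

/-! ### Polynomials with coefficients in `A ⊗ W` -/

section PolyTensor

variable {k : Type*} [Field k] {A : Type*} [Ring A] [Algebra k A] (W : Type*) [AddCommGroup W]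
  [Module k W]

/-- The coefficient of `X ^ t` of an element of `A[X] ⊗ W`. -/
def tensorCoeff (t : ℕ) : A[X] ⊗[k] W →ₗ[k] A ⊗[k] W :=
  ((Polynomial.lcoeff A t).restrictScalars k).rTensor W

/-- The map `a ⊗ w ↦ a X ^ t ⊗ w`. -/
def tensorMonomial (t : ℕ) : A ⊗[k] W →ₗ[k] A[X] ⊗[k] W :=
  ((Polynomial.monomial (R := A) t).restrictScalars k).rTensor W

variable {W}

@[simp] theorem tensorCoeff_tmul (t : ℕ) (P : A[X]) (w : W) :
    tensorCoeff (k := k) W t (P ⊗ₜ w) = P.coeff t ⊗ₜ w := rfl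

@[simp] theorem tensorMonomial_tmul (t : ℕ) (a : A) (w : W) :
    tensorMonomial (k := k) W t (a ⊗ₜ w) = Polynomial.monomial t a ⊗ₜ w := rfl

theorem tensorCoeff_tensorMonomial (s t : ℕ) (z : A ⊗[k] W) :
    tensorCoeff W s (tensorMonomial W t z) = if t = s then z else 0 := by
  induction z using TensorProduct.induction_on with
  | zero => simp
  | tmul a w =>
    simp only [tensorMonomial_tmul, tensorCoeff_tmul, Polynomial.coeff_monomial]
    split_ifs <;> simp
  | add z z' hz hz' => rw [map_add, map_add, hz, hz']; split_ifs <;> simp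

theorem eq_sum_tensorMonomial (z : A[X] ⊗[k] W) : ∃ N, ∀ N' ≥ N,
    z = ∑ t ∈ Finset.range N', tensorMonomial W t (tensorCoeff W t z) := by
  induction z using TensorProduct.induction_on with
  | zero => exact ⟨0, by simp⟩
  | tmul P w =>
    refine ⟨P.natDegree + 1, fun N hN => ?_⟩
    conv_lhs => rw [P.as_sum_range' N hN]
    rw [TensorProduct.sum_tmul]
    rfl
  | add z z' hz hz' =>
    obtain ⟨N, hN⟩ := hz
    obtain ⟨N', hN'⟩ := hz'
    refine ⟨max N N', fun M hM => ?_⟩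
    conv_lhs => rw [hN M (le_trans (le_max_left _ _) hM), hN' M (le_trans (le_max_right _ _) hM)]
    simp [Finset.sum_add_distrib]

theorem mem_of_tensorMonomial_mem (S : Submodule k (A[X] ⊗[k] W)) {z : A[X] ⊗[k] W}
    (h : ∀ t, tensorMonomial W t (tensorCoeff W t z) ∈ S) : z ∈ S := by
  obtain ⟨N, hN⟩ := eq_sum_tensorMonomial z
  rw [hN N le_rfl]
  exact sum_mem fun t _ => h t

end PolyTensor

/-! ### The Koszul resolution of `k[h]` over `U(𝔞)[h]` -/

section Resolution

variable {k : Type*} [Field k] [CharZero k] {𝔞 : Type*} [LieRing 𝔞] [LieAlgebra k 𝔞]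

attribute [local instance 100] LieRing.ofAssociativeRing

local notation "𝔘" => UniversalEnvelopingAlgebra k 𝔞

variable (k 𝔞) in
/-- The augmentation of `U(𝔞)`. -/
def envCounit : UniversalEnvelopingAlgebra k 𝔞 →ₐ[k] k :=
  UniversalEnvelopingAlgebra.lift k (0 : 𝔞 →ₗ⁅k⁆ k)

omit [CharZero k] in
theorem envCounit_ι (x : 𝔞) : envCounit k 𝔞 (UniversalEnvelopingAlgebra.ι k x) = 0 := by
  rw [envCounit, UniversalEnvelopingAlgebra.lift_ι_apply]
  rfl

theorem envCounit_envD (z : KoszulMod k 𝔞 𝔘 1) :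
    envCounit k 𝔞 (koszulZeroEquiv k 𝔞 𝔘 (envD k 𝔞 0 z)) = 0 := by
  suffices h : (envCounit k 𝔞).toLinearMap ∘ₗ
      (koszulZeroEquiv k 𝔞 𝔘).toLinearMap.restrictScalars k ∘ₗ
        (envD k 𝔞 0).restrictScalars k = 0 from LinearMap.congr_fun h z
  refine koszulMod_hom_ext fun u X => ?_
  show envCounit k 𝔞 (koszulZeroEquiv k 𝔞 𝔘
    (koszulD (envι k 𝔞) 0 (u ⊗ₜ exteriorPower.ιMulti k 1 X))) = 0
  rw [koszulZeroEquiv_koszulD, map_mul, envι_apply, envCounit_ι, mul_zero]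

/-- The image is the left ideal generated by `𝔞`. It contains every `u - ε u`, by induction through
`x u = x (u - ε u) + ε(u) x`. -/
theorem exists_envD_of_envCounit_eq_zero {u : 𝔘} (hu : envCounit k 𝔞 u = 0) :
    ∃ z, koszulZeroEquiv k 𝔞 𝔘 (envD k 𝔞 0 z) = u := by
  let R : Submodule 𝔘 𝔘 :=
    LinearMap.range ((koszulZeroEquiv k 𝔞 𝔘).toLinearMap ∘ₗ envD k 𝔞 0)
  have hι : ∀ x : 𝔞, UniversalEnvelopingAlgebra.ι k x ∈ R := fun x =>
    ⟨1 ⊗ₜ exteriorPower.ιMulti k 1 (fun _ => x), by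
      rw [LinearMap.comp_apply, LinearEquiv.coe_coe, koszulZeroEquiv_koszulD, one_mul, envι_apply]⟩
  have h := enveloping_mem ((R.restrictScalars k).comap
    (LinearMap.id - Algebra.linearMap k 𝔘 ∘ₗ (envCounit k 𝔞).toLinearMap)) (by simp) (by
      intro x u hu
      simp only [Submodule.mem_comap, LinearMap.sub_apply, LinearMap.id_apply,
        LinearMap.comp_apply, AlgHom.toLinearMap_apply, Algebra.linearMap_apply,
        Submodule.restrictScalars_mem, map_mul, envCounit_ι, zero_mul, map_zero, sub_zero] at hu ⊢
      have h1 := R.smul_mem (UniversalEnvelopingAlgebra.ι k x) hu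
      have h2 := R.smul_mem (algebraMap k 𝔘 (envCounit k 𝔞 u)) (hι x)
      have h3 := add_mem h1 h2
      rwa [smul_eq_mul, smul_eq_mul, mul_sub, Algebra.commutes, sub_add_cancel] at h3) u
  simpa [hu, R] using h

variable (k 𝔞) in
/-- The inclusion of `𝔞` in `U(𝔞)[h]`, as a linear map. -/
def upolyι : 𝔞 →ₗ[k] UPoly k 𝔞 where
  toFun := UPoly.ι k 𝔞
  map_add' x y := by simp only [UPoly.ι, map_add]
  map_smul' c x := by
    simp only [UPoly.ι, map_smul, RingHom.id_apply]
    rw [Polynomial.smul_C]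

omit [CharZero k] in
theorem upolyι_apply (x : 𝔞) :
    upolyι k 𝔞 x = Polynomial.C (UniversalEnvelopingAlgebra.ι k x) := rfl

theorem tensorCoeff_koszulD (t q : ℕ) (z : KoszulMod k 𝔞 (UPoly k 𝔞) (q + 1)) :
    tensorCoeff _ t (koszulD (upolyι k 𝔞) q z) = envD k 𝔞 q (tensorCoeff _ t z) :=
  rTensor_koszulD _ (fun b x => by simp [upolyι_apply, envι_apply]) q z

theorem tensorMonomial_koszulD (t q : ℕ) (z : KoszulMod k 𝔞 𝔘 (q + 1)) :
    tensorMonomial _ t (envD k 𝔞 q z) = koszulD (upolyι k 𝔞) q (tensorMonomial _ t z) :=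
  rTensor_koszulD _ (fun b x => by
    simp [upolyι_apply, envι_apply, Polynomial.monomial_mul_C]) q z

omit [CharZero k] in
theorem coeff_koszulZeroEquiv (t : ℕ) (z : KoszulMod k 𝔞 (UPoly k 𝔞) 0) :
    (koszulZeroEquiv k 𝔞 (UPoly k 𝔞) z).coeff t = koszulZeroEquiv k 𝔞 𝔘 (tensorCoeff _ t z) := by
  suffices h : (Polynomial.lcoeff 𝔘 t).restrictScalars k ∘ₗ
      (koszulZeroEquiv k 𝔞 (UPoly k 𝔞)).toLinearMap.restrictScalars k =
      (koszulZeroEquiv k 𝔞 𝔘).toLinearMap.restrictScalars k ∘ₗ tensorCoeff _ t from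
    LinearMap.congr_fun h z
  refine koszulMod_hom_ext fun u X => ?_
  simp only [LinearMap.comp_apply, LinearMap.restrictScalars_apply, LinearEquiv.coe_coe,
    koszulZeroEquiv_tmul, tensorCoeff_tmul, Polynomial.lcoeff_apply]

omit [CharZero k] in
theorem coeff_counit (P : UPoly k 𝔞) (t : ℕ) :
    (UPoly.counit k 𝔞 P).coeff t = envCounit k 𝔞 (P.coeff t) := Polynomial.coeff_map _ _

theorem isResolution_upoly {n : ℕ} (e : Module.Basis (Fin n) k 𝔞) :
    IsResolution (KoszulMod k 𝔞 (UPoly k 𝔞)) (koszulD (upolyι k 𝔞))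
      (koszulAug k 𝔞 (UPoly.counit k 𝔞)) where
  surjective := by
    intro c
    refine ⟨(koszulZeroEquiv k 𝔞 (UPoly k 𝔞)).symm
      (Polynomial.map (algebraMap k 𝔘) ((AugModule.of _).symm c)), ?_⟩
    rw [koszulAug_apply, LinearEquiv.apply_symm_apply]
    refine (AddEquiv.eq_symm_apply _).1 (Polynomial.ext fun t => ?_)
    rw [coeff_counit, Polynomial.coeff_map, AlgHom.commutes]
    rfl
  exact_zero := by
    intro z
    have hz : koszulAug k 𝔞 (UPoly.counit k 𝔞) z = 0 ↔
        ∀ t, envCounit k 𝔞 (koszulZeroEquiv k 𝔞 𝔘 (tensorCoeff _ t z)) = 0 := by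
      rw [koszulAug_apply, EmbeddingLike.map_eq_zero_iff, Polynomial.ext_iff]
      simp only [coeff_counit, coeff_koszulZeroEquiv, Polynomial.coeff_zero]
    rw [hz]
    constructor
    · intro h
      refine mem_of_tensorMonomial_mem
        (LinearMap.range ((koszulD (upolyι k 𝔞) 0).restrictScalars k)) fun t => ?_
      obtain ⟨y, hy⟩ := exists_envD_of_envCounit_eq_zero (h t)
      refine ⟨tensorMonomial _ t y, ?_⟩
      rw [LinearMap.restrictScalars_apply, ← tensorMonomial_koszulD,
        (koszulZeroEquiv k 𝔞 𝔘).injective hy]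
    · rintro ⟨y, rfl⟩ t
      rw [tensorCoeff_koszulD, envCounit_envD]
  exact_succ := by
    intro q z
    constructor
    · intro h
      refine mem_of_tensorMonomial_mem
        (LinearMap.range ((koszulD (upolyι k 𝔞) (q + 1)).restrictScalars k)) fun t => ?_
      obtain ⟨y, hy⟩ := (envD_exact e q (tensorCoeff _ t z)).1 (by
        rw [← tensorCoeff_koszulD, h, map_zero])
      refine ⟨tensorMonomial _ t y, ?_⟩
      rw [LinearMap.restrictScalars_apply, ← tensorMonomial_koszulD, hy]
    · rintro ⟨y, rfl⟩
      refine koszulD_koszulD (fun x y => ?_) q y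
      simp only [upolyι_apply, ι_lie, map_sub, map_mul]

end Resolution

/-! ### Modules that are complete and separated for the filtration by powers of `h` -/

section HFree

variable {S : Type*} [CommRing S] (h : S)

/-- `M` is `h`-torsion free, separated and complete. -/
structure IsHFree (M : Type*) [AddCommGroup M] [Module S M] : Prop where
  torsion_free : ∀ m : M, h • m = 0 → m = 0
  separated : ∀ m : M, (∀ N, m ∈ hFilt h M N) → m = 0
  complete : ∀ z : ℕ → M, ∃ Z : M, ∀ N, Z - ∑ i ∈ Finset.range N, h ^ i • z i ∈ hFilt h M N

variable {h} {M M' : Type*} [AddCommGroup M] [Module S M] [AddCommGroup M'] [Module S M']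

theorem mem_hFilt {t : ℕ} {m : M} : m ∈ hFilt h M t ↔ ∃ m', m = h ^ t • m' :=
  ⟨fun ⟨x, hx⟩ => ⟨x, hx.symm⟩, fun ⟨x, hx⟩ => ⟨x, hx.symm⟩⟩

theorem IsHFree.of_linearEquiv (hM : IsHFree h M) (f : M' ≃ₗ[S] M) : IsHFree h M' where
  torsion_free m hm := f.injective (by
    rw [map_zero]
    exact hM.torsion_free _ (by rw [← map_smul, hm, map_zero]))
  separated m hm := f.injective (by
    rw [map_zero]
    exact hM.separated _ fun N => map_mem_hFilt h f.toLinearMap N m (hm N))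
  complete z := by
    obtain ⟨Z, hZ⟩ := hM.complete fun i => f (z i)
    refine ⟨f.symm Z, fun N => ?_⟩
    have := map_mem_hFilt h f.symm.toLinearMap N _ (hZ N)
    simpa using this

theorem IsHFree.pi (hM : IsHFree h M) (ι : Type*) : IsHFree h (ι → M) where
  torsion_free m hm := funext fun i => hM.torsion_free _ (congrFun hm i)
  separated m hm := funext fun i => hM.separated _ fun N =>
    map_mem_hFilt h (LinearMap.proj i : (ι → M) →ₗ[S] M) N m (hm N)
  complete z := by
    choose Z hZ using fun i => hM.complete fun j => z j i
    refine ⟨Z, fun N => ?_⟩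
    choose Y hY using fun i => mem_hFilt.1 (hZ i N)
    refine mem_hFilt.2 ⟨Y, funext fun i => ?_⟩
    simpa using hY i

theorem IsHFree.tensor {k : Type*} [Field k] [Algebra k S] {A : Type*} [AddCommGroup A]
    [Module k A] [Module S A] [IsScalarTower k S A] (hA : IsHFree h A) (W : Type*)
    [AddCommGroup W] [Module k W] [Module.Finite k W] : IsHFree h (A ⊗[k] W) := by
  classical
  let b := Module.finBasis k W
  exact (hA.pi (Fin (Module.finrank k W))).of_linearEquiv
    ((TensorProduct.AlgebraTensorModule.congr (LinearEquiv.refl S A) b.equivFun).trans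
      (TensorProduct.piScalarRight k S A (Fin (Module.finrank k W))))

theorem coeff_X_pow_smul_sum {k V : Type*} [Field k] [AddCommGroup V] [Module k V] (N n : ℕ)
    (v : ℕ → V) : ∑ p ∈ Finset.HasAntidiagonal.antidiagonal n,
      PowerSeries.coeff p.1 ((PowerSeries.X : k⟦X⟧) ^ N) • v p.2 =
        if N ≤ n then v (n - N) else 0 := by
  simp only [PowerSeries.coeff_X_pow, ite_smul, one_smul, zero_smul]
  split_ifs with hN
  · rw [Finset.sum_eq_single (N, n - N)]
    · simp
    · rintro ⟨a, b⟩ hab hne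
      rw [Finset.HasAntidiagonal.mem_antidiagonal] at hab
      rw [if_neg]
      rintro rfl
      exact hne (by simp only [Prod.mk.injEq, true_and]; simp only at hab; omega)
    · intro hne
      exact absurd (Finset.HasAntidiagonal.mem_antidiagonal.2 (by show N + (n - N) = n; omega)) hne
  · refine Finset.sum_eq_zero ?_
    rintro ⟨a, b⟩ hab
    rw [Finset.HasAntidiagonal.mem_antidiagonal] at hab
    rw [if_neg]
    rintro rfl
    simp only at hab
    omega

theorem IsTopologicallyFree.isHFree {k : Type*} [Field k] {M : Type*} [AddCommGroup M]
    [Module k⟦X⟧ M] (hM : IsTopologicallyFree k M) : IsHFree (PowerSeries.X : k⟦X⟧) M := by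
  obtain ⟨V, _, _, Φ, hΦ⟩ := hM
  have hpow : ∀ (N : ℕ) (v : ℕ → V),
      (PowerSeries.X : k⟦X⟧) ^ N • Φ v = Φ (fun n => if N ≤ n then v (n - N) else 0) :=
    fun N v => by rw [← hΦ]; congr 1; funext n; exact coeff_X_pow_smul_sum N n v
  refine ⟨fun m hm => ?_, fun m hm => ?_, fun z => ?_⟩
  · obtain ⟨v, rfl⟩ := Φ.surjective m
    have h1 := hpow 1 v
    rw [pow_one, hm, eq_comm, EmbeddingLike.map_eq_zero_iff] at h1
    rw [EmbeddingLike.map_eq_zero_iff]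
    funext n
    simpa using congrFun h1 (n + 1)
  · obtain ⟨v, rfl⟩ := Φ.surjective m
    rw [EmbeddingLike.map_eq_zero_iff]
    funext n
    obtain ⟨m', hm'⟩ := mem_hFilt.1 (hm (n + 1))
    obtain ⟨v', rfl⟩ := Φ.surjective m'
    rw [hpow] at hm'
    rw [Φ.injective hm', Pi.zero_apply]
    exact if_neg (by omega)
  · choose v hv using fun i => Φ.surjective (z i)
    -- The coefficient of `h ^ n` in `∑ h ^ i v_i` is a finite sum over `i ≤ n`.
    refine ⟨Φ fun n => ∑ i ∈ Finset.range (n + 1), v i (n - i), fun N => ?_⟩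
    -- The witness is the remainder after `N` terms divided by `h ^ N`, hence the shift of `n` by
    -- `N`.
    refine mem_hFilt.2 ⟨Φ fun n => (∑ i ∈ Finset.range (n + N + 1), v i (n + N - i)) -
      ∑ i ∈ Finset.range N, v i (n + N - i), ?_⟩
    simp only [← hv, hpow]
    rw [← map_sum, ← map_sub]
    congr 1
    funext n
    simp only [Pi.sub_apply, Finset.sum_apply]
    split_ifs with hN
    · rw [Nat.sub_add_cancel hN]
      congr 1
      refine Finset.sum_congr rfl fun i hi => if_pos ?_
      rw [Finset.mem_range] at hi
      omega
    · rw [sub_eq_zero]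
      have : Finset.range (n + 1) ⊆ Finset.range N := Finset.range_subset_range.2 (by omega)
      rw [← Finset.sum_subset this]
      · refine Finset.sum_congr rfl fun i hi => (if_pos ?_).symm
        rw [Finset.mem_range] at hi
        omega
      · intro i _ hi
        rw [Finset.mem_range] at hi
        exact if_neg (by omega)

end HFree

/-! ### Lifting resolutions -/

section Lifting

variable {S : Type*} [CommRing S] {h : S}
variable {M₀ M₁ M₂ : Type*} [AddCommGroup M₀] [Module S M₀] [AddCommGroup M₁] [Module S M₁]
  [AddCommGroup M₂] [Module S M₂]
variable {N₀ N₁ N₂ : Type*} [AddCommGroup N₀] [AddCommGroup N₁] [AddCommGroup N₂]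

/-- The range of `d` is saturated with respect to `h`. -/
def HasSaturatedRange (h : S) (d : M₁ →ₗ[S] M₀) : Prop :=
  ∀ y, h • y ∈ LinearMap.range d → y ∈ LinearMap.range d

/-- The range is the kernel of a map to a torsion free module. -/
theorem hasSaturatedRange_of_exact (hM : ∀ m : M₀, h • m = 0 → m = 0) {d : M₁ →ₗ[S] M₀}
    {d' : M₂ →ₗ[S] M₁} (hd : Function.Exact d' d) : HasSaturatedRange h d' := by
  intro y hy
  refine (hd y).1 (hM _ ?_)
  rw [← map_smul]
  exact (hd _).2 hy

/-- A complex lifting an exact sequence modulo `h` is exact. -/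
theorem exact_of_exact_mod (hM₀ : ∀ m : M₀, h • m = 0 → m = 0)
    (hM₁ : ∀ m : M₁, (∀ N, m ∈ hFilt h M₁ N) → m = 0) (hM₂ : IsHFree h M₂)
    (d : M₁ →ₗ[S] M₀) (d' : M₂ →ₗ[S] M₁) (hdd : ∀ m, d (d' m) = 0)
    (π₀ : M₀ →+ N₀) (π₁ : M₁ →+ N₁) (π₂ : M₂ →+ N₂) (hπ₂ : Function.Surjective π₂)
    (hker : ∀ m, π₁ m = 0 → ∃ m', m = h • m')
    (D : N₁ →+ N₀) (D' : N₂ →+ N₁) (hD : Function.Exact D' D)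
    (hdD : ∀ m, π₀ (d m) = D (π₁ m)) (hdD' : ∀ m, π₁ (d' m) = D' (π₂ m)) :
    Function.Exact d' d := by
  intro y
  refine ⟨fun hy => ?_, ?_⟩
  · have step : ∀ y : LinearMap.ker d, ∃ (z : M₂) (y' : LinearMap.ker d),
        (y : M₁) = d' z + h • (y' : M₁) := by
      rintro ⟨y, hy⟩
      obtain ⟨x, hx⟩ := (hD (π₁ y)).1 (by rw [← hdD, LinearMap.mem_ker.1 hy, map_zero])
      obtain ⟨z, rfl⟩ := hπ₂ x
      obtain ⟨y', hy'⟩ := hker (y - d' z) (by rw [map_sub, hdD', hx, sub_self])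
      refine ⟨z, ⟨y', hM₀ _ ?_⟩, by rw [← hy', add_sub_cancel]⟩
      rw [← map_smul, ← hy', map_sub, LinearMap.mem_ker.1 hy, hdd, sub_self]
    choose z f hf using step
    obtain ⟨Z, hZ⟩ := hM₂.complete fun i => z (f^[i] ⟨y, hy⟩)
    have hsum : ∀ N, y = d' (∑ i ∈ Finset.range N, h ^ i • z (f^[i] ⟨y, hy⟩)) +
        h ^ N • (f^[N] ⟨y, hy⟩ : M₁) := by
      intro N
      induction N with
      | zero => simp
      | succ N ih =>
        conv_lhs => rw [ih, hf (f^[N] ⟨y, hy⟩)]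
        rw [Finset.sum_range_succ, map_add, map_smul, smul_add, smul_smul, ← pow_succ,
          ← Function.iterate_succ_apply' f, add_assoc]
    refine ⟨Z, ?_⟩
    rw [eq_comm, ← sub_eq_zero]
    refine hM₁ _ fun N => ?_
    obtain ⟨m, hm⟩ := mem_hFilt.1 (hZ N)
    refine mem_hFilt.2 ⟨(f^[N] ⟨y, hy⟩ : M₁) - d' m, ?_⟩
    conv_lhs => rw [hsum N, sub_eq_iff_eq_add.1 hm]
    rw [map_add, map_smul, smul_sub]
    abel
  · rintro ⟨x, rfl⟩
    exact hdd x

variable {k : Type*} [Field k] {A : Type*} [Ring A] [Algebra S A] [Algebra k A] [Module A M₀]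
  [IsScalarTower S A M₀] [Module A M₁] [IsScalarTower S A M₁] [Module k M₁] [IsScalarTower k A M₁]
  [Module k N₁] {W : Type*} [AddCommGroup W] [Module k W]

/-- A lift `x` of a cycle has `d x = h m`; saturation gives `m = d z`, and `x - h z` is a cycle with
the same reduction. -/
theorem exists_lift_to_ker (d : M₁ →ₗ[A] M₀) (hd : HasSaturatedRange h (d.restrictScalars S))
    (π₀ : M₀ →+ N₀) (π₁ : M₁ →ₗ[k] N₁) (hπ₁ : Function.Surjective π₁)
    (hker : ∀ m, π₀ m = 0 → ∃ m', m = h • m') (hπ₁h : ∀ m, π₁ (h • m) = 0)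
    (D : N₁ →+ N₀) (hdD : ∀ m, π₀ (d m) = D (π₁ m))
    (f : W →ₗ[k] N₁) (hf : ∀ w, D (f w) = 0) :
    ∃ f' : W →ₗ[k] M₁, (∀ w, d (f' w) = 0) ∧ ∀ w, π₁ (f' w) = f w := by
  let K : Submodule k M₁ := (LinearMap.ker d).restrictScalars k
  have hlift : ∀ y : N₁, D y = 0 → ∃ x ∈ K, π₁ x = y := by
    intro y hy
    obtain ⟨x, rfl⟩ := hπ₁ y
    obtain ⟨m, hm⟩ := hker (d x) (by rw [hdD, hy])
    obtain ⟨z, hz⟩ := hd m ⟨x, hm⟩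
    refine ⟨x - h • z, ?_, by rw [map_sub, hπ₁h, sub_zero]⟩
    show d (x - h • z) = 0
    have : d (h • z) = h • d z := (d.restrictScalars S).map_smul h z
    rw [map_sub, this, hm, ← hz, LinearMap.restrictScalars_apply, sub_self]
  let π' : K →ₗ[k] LinearMap.range (π₁ ∘ₗ K.subtype) := (π₁ ∘ₗ K.subtype).rangeRestrict
  have hfr : ∀ w, f w ∈ LinearMap.range (π₁ ∘ₗ K.subtype) := fun w => by
    obtain ⟨x, hx, hxw⟩ := hlift (f w) (hf w)
    exact ⟨⟨x, hx⟩, hxw⟩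
  -- Vector spaces are projective, so the lifts can be chosen linearly in `w`.
  obtain ⟨g, hg⟩ := Module.projective_lifting_property π' (f.codRestrict _ hfr)
    (LinearMap.surjective_rangeRestrict _)
  refine ⟨K.subtype ∘ₗ g, fun w => (g w).2, fun w => ?_⟩
  exact congrArg Subtype.val (LinearMap.congr_fun hg w)

end Lifting

/-! ### Associated graded objects of torsion free modules -/

section GrSymb

variable {S : Type*} [CommRing S] (h : S)
variable {M M' : Type*} [AddCommGroup M] [Module S M] [AddCommGroup M'] [Module S M']

/-- The class of `h ^ t m` in degree `t`, as an additive map of `m`. -/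
def grPieceSymb (t : ℕ) : M →+ GrPiece h M t where
  toFun m := grMk h t ⟨h ^ t • m, pow_smul_mem_hFilt h t m⟩
  map_zero' := by
    refine (Submodule.Quotient.mk_eq_zero _).2 ?_
    show h ^ t • (0 : M) ∈ hFilt h M (t + 1)
    rw [smul_zero]
    exact zero_mem _
  map_add' m m' := by
    rw [← grMk_add]
    congr 1
    exact Subtype.ext (smul_add _ _ _)

theorem grPieceSymb_surjective (t : ℕ) : Function.Surjective (grPieceSymb h (M := M) t) := by
  intro x
  obtain ⟨⟨_, m, rfl⟩, rfl⟩ := grMk_surjective h t x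
  exact ⟨m, rfl⟩

theorem grPieceSymb_eq_zero {t : ℕ} {m : M} :
    grPieceSymb h t m = 0 ↔ ∃ m', h ^ t • m = h ^ t • h • m' := by
  refine (Submodule.Quotient.mk_eq_zero _).trans ?_
  show h ^ t • m ∈ hFilt h M (t + 1) ↔ _
  simp only [mem_hFilt, pow_succ, mul_smul]

@[elab_as_elim]
theorem gr_induction {motive : Gr h M → Prop} (x : Gr h M) (zero : motive 0)
    (symb : ∀ t m, motive (grSymb h t m)) (add : ∀ x y, motive x → motive y → motive (x + y)) :
    motive x := by
  induction x using DirectSum.induction_on with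
  | zero => exact zero
  | of t x =>
    obtain ⟨m, rfl⟩ := grPieceSymb_surjective h t x
    exact symb t m
  | add x y hx hy => exact add x y hx hy

theorem grMap_grSymb (f : M →ₗ[S] M') (t : ℕ) (m : M) :
    grMap h f (grSymb h t m) = grSymb h t (f m) := by
  rw [grMap, grSymb, DirectSum.map_of]
  show DirectSum.of _ t (grMk h t ⟨f (h ^ t • m), _⟩) = _
  simp only [map_smul]
  rfl

variable {A : Type*} [Ring A] [Algebra S A] [Module A M] [IsScalarTower S A M]

theorem pow_smul_smul_pow_smul (s t : ℕ) (a : A) (m : M) :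
    (h ^ s • a) • (h ^ t • m) = h ^ (s + t) • (a • m) := by
  rw [← algebraMap_smul A (h ^ t) m, ← algebraMap_smul A (h ^ (s + t)) (a • m), smul_smul,
    smul_smul, Algebra.smul_def, mul_assoc, ← Algebra.commutes, ← mul_assoc, ← map_mul, pow_add]

theorem grSymb_smul_grSymb (s t : ℕ) (a : A) (m : M) :
    grSymb h s a • grSymb h t m = grSymb h (s + t) (a • m) := by
  refine (DirectSum.Gmodule.of_smul_of (GrPiece h A) (GrPiece h M) _ _).trans ?_
  rw [grSymb]
  congr 1
  show grSMul h (grMk h s _) (grMk h t _) = _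
  rw [grSMul_mk]
  congr 1
  exact Subtype.ext (pow_smul_smul_pow_smul h s t a m)

theorem grSymb_mul_grSymb (s t : ℕ) (a b : A) :
    grSymb h s a * grSymb h t b = grSymb h (s + t) (a * b) := by
  refine (DirectSum.of_mul_of (A := GrPiece h A) _ _).trans ?_
  rw [grSymb]
  congr 1
  show grSMul h (grMk h s _) (grMk h t _) = _
  rw [grSMul_mk]
  congr 1
  exact Subtype.ext (pow_smul_smul_pow_smul h s t a b)

end GrSymb

/-! ### `Gr M` as polynomials over `M / h M` -/

section GrEquiv

variable {S : Type*} [CommRing S] (h : S) {M : Type*} [AddCommGroup M] [Module S M]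
variable {N P : Type*} [AddCommGroup N] [AddCommGroup P]

/-- `π` identifies `N` with `M / h M`. -/
structure IsReduction (π : M →+ N) : Prop where
  surjective : Function.Surjective π
  exists_of_eq_zero : ∀ m, π m = 0 → ∃ m', m = h • m'
  map_smul : ∀ m, π (h • m) = 0

/-- The maps `mono` and `coeff` identify `P` with the polynomials with coefficients in `N`. -/
structure IsPolynomialGroup (mono : ℕ → N →+ P) (coeff : ℕ → P →+ N) : Prop where
  coeff_mono : ∀ s t y, coeff s (mono t y) = if t = s then y else 0
  eq_sum : ∀ p, ∃ n, p = ∑ t ∈ Finset.range n, mono t (coeff t p)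

variable {h}

/-- Multiplication by `h ^ t` is injective, so the class of `h ^ t m` vanishes exactly when `m ∈ h
M`. -/
theorem exists_grPieceEquiv (hM : ∀ m : M, h • m = 0 → m = 0) {π : M →+ N}
    (hπ : IsReduction h π) (t : ℕ) :
    ∃ E : GrPiece h M t ≃+ N, ∀ m, E (grPieceSymb h t m) = π m := by
  have hpow : ∀ (t : ℕ) (m m' : M), h ^ t • m = h ^ t • m' → m = m' := by
    intro t
    induction t with
    | zero => simp
    | succ t ih =>
      intro m m' hm
      rw [pow_succ, mul_smul, mul_smul] at hm
      have := ih _ _ hm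
      rw [← sub_eq_zero, ← smul_sub] at this
      exact sub_eq_zero.1 (hM _ this)
  have hker : (grPieceSymb h (M := M) t).ker = π.ker := by
    ext m
    rw [AddMonoidHom.mem_ker, AddMonoidHom.mem_ker, grPieceSymb_eq_zero]
    constructor
    · rintro ⟨m', hm'⟩
      rw [hpow t _ _ hm', hπ.map_smul]
    · intro hm
      obtain ⟨m', rfl⟩ := hπ.exists_of_eq_zero m hm
      exact ⟨m', rfl⟩
  refine ⟨(QuotientAddGroup.quotientKerEquivOfSurjective _ (grPieceSymb_surjective h t)).symm.trans
    ((QuotientAddGroup.quotientAddEquivOfEq hker).trans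
      (QuotientAddGroup.quotientKerEquivOfSurjective π hπ.surjective)), fun m => ?_⟩
  have : (QuotientAddGroup.quotientKerEquivOfSurjective _ (grPieceSymb_surjective h t)).symm
      (grPieceSymb h t m) = QuotientAddGroup.mk m := by
    rw [AddEquiv.symm_apply_eq]
    rfl
  rw [AddEquiv.trans_apply, this]
  rfl

theorem exists_grEquiv (hM : ∀ m : M, h • m = 0 → m = 0) {π : M →+ N} (hπ : IsReduction h π)
    {mono : ℕ → N →+ P} {coeff : ℕ → P →+ N} (hP : IsPolynomialGroup mono coeff) :
    ∃ Φ : Gr h M ≃+ P, ∀ t m, Φ (grSymb h t m) = mono t (π m) := by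
  choose E hE using exists_grPieceEquiv hM hπ
  let Φ : Gr h M →+ P := DirectSum.toAddMonoid fun t => (mono t).comp (E t).toAddMonoidHom
  have hΦ : ∀ t x, Φ (DirectSum.of _ t x) = mono t (E t x) := fun t x =>
    DirectSum.toAddMonoid_of _ t x
  have hcoeff : ∀ s x, coeff s (Φ x) = E s (x s) := by
    intro s x
    induction x using DirectSum.induction_on with
    | zero => simp
    | of t x =>
      rw [hΦ, hP.coeff_mono]
      split_ifs with hts
      · subst hts
        rw [DirectSum.of_eq_same]
      · rw [DirectSum.of_eq_of_ne _ _ _ (Ne.symm hts), map_zero]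
    | add x y hx hy => rw [map_add, map_add, hx, hy, DirectSum.add_apply, map_add]
  have hinj : Function.Injective Φ := (injective_iff_map_eq_zero Φ).2 fun x hx =>
    DFinsupp.ext fun s => (E s).injective (by
      rw [← hcoeff, hx, map_zero]
      exact (map_zero (E s)).symm)
  have hsurj : Function.Surjective Φ := by
    intro p
    obtain ⟨n, hn⟩ := hP.eq_sum p
    refine ⟨∑ t ∈ Finset.range n, DirectSum.of _ t ((E t).symm (coeff t p)), ?_⟩
    rw [map_sum]
    conv_rhs => rw [hn]
    refine Finset.sum_congr rfl fun t _ => ?_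
    rw [hΦ, AddEquiv.apply_symm_apply]
  refine ⟨AddEquiv.ofBijective Φ ⟨hinj, hsurj⟩, fun t m => ?_⟩
  rw [← hE t m]
  exact hΦ t _

theorem isPolynomialGroup_polynomial (A : Type*) [Ring A] :
    IsPolynomialGroup (P := A[X]) (fun t => (Polynomial.monomial t).toAddMonoidHom)
      (fun t => (Polynomial.lcoeff A t).toAddMonoidHom) where
  coeff_mono s t y := by simp [Polynomial.coeff_monomial]
  eq_sum p := ⟨p.natDegree + 1, p.as_sum_range⟩

theorem isPolynomialGroup_tensor {k : Type*} [Field k] (A : Type*) [Ring A] [Algebra k A]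
    (W : Type*) [AddCommGroup W] [Module k W] :
    IsPolynomialGroup (fun t => (tensorMonomial (k := k) (A := A) W t).toAddMonoidHom)
      (fun t => (tensorCoeff (k := k) (A := A) W t).toAddMonoidHom) where
  coeff_mono s t y := tensorCoeff_tensorMonomial s t y
  eq_sum p := by
    obtain ⟨n, hn⟩ := eq_sum_tensorMonomial p
    exact ⟨n, hn n le_rfl⟩

/-- Right exactness of `· ⊗ W`, applied to multiplication by `h` followed by `π`. -/
theorem IsReduction.rTensor {k : Type*} [Field k] [Algebra k S] {A B : Type*} [AddCommGroup A]
    [Module k A] [Module S A] [IsScalarTower k S A] [AddCommGroup B] [Module k B] {π : A →ₗ[k] B}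
    (hπ : IsReduction h π.toAddMonoidHom) (W : Type*) [AddCommGroup W] [Module k W] :
    IsReduction h (π.rTensor W).toAddMonoidHom := by
  have hsmul : ∀ z : A ⊗[k] W,
      (((LinearMap.lsmul S A h).restrictScalars k).rTensor W) z = h • z := by
    intro z
    induction z using TensorProduct.induction_on with
    | zero => simp
    | tmul a w => rfl
    | add z z' hz hz' => rw [map_add, hz, hz', smul_add]
  have hex : Function.Exact ((LinearMap.lsmul S A h).restrictScalars k) π := by
    intro a
    constructor
    · intro ha
      obtain ⟨a', rfl⟩ := hπ.exists_of_eq_zero a ha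
      exact ⟨a', rfl⟩
    · rintro ⟨a', rfl⟩
      exact hπ.map_smul a'
  have hex' := rTensor_exact W hex hπ.surjective
  refine ⟨LinearMap.rTensor_surjective W hπ.surjective, fun m hm => ?_, fun m => ?_⟩
  · obtain ⟨m', rfl⟩ := (hex' m).1 hm
    exact ⟨m', hsmul m'⟩
  · exact (hex' _).2 ⟨m, hsmul m⟩

end GrEquiv

/-! ### The algebra `U_h(𝔞)` -/

section Uh

variable {k : Type*} [Field k] {n : ℕ}

variable (k n) in
/-- The underlying power series. -/
def CTensor.toSeries : CTensor k n ≃+* (FreeAlgebra k (Fin n))⟦X⟧ := RingEquiv.refl _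

theorem CTensor.toSeries_X_smul (x : CTensor k n) :
    CTensor.toSeries k n ((PowerSeries.X : k⟦X⟧) • x) =
      PowerSeries.X * CTensor.toSeries k n x := by
  rw [Algebra.smul_def, map_mul]
  congr 1
  exact PowerSeries.map_X (algebraMap k (FreeAlgebra k (Fin n)))

theorem CTensor.toSeries_algebraMap (c : k) :
    CTensor.toSeries k n (algebraMap k _ c) = PowerSeries.C (algebraMap k _ c) :=
  PowerSeries.algebraMap_apply (R := k) (A := FreeAlgebra k (Fin n)) (r := c)

theorem CTensor.toSeries_algebraMap' (c : k⟦X⟧) :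
    CTensor.toSeries k n (algebraMap k⟦X⟧ _ c) =
      PowerSeries.map (algebraMap k (FreeAlgebra k (Fin n))) c := rfl

variable (k n) in
/-- The constant power series. -/
def CTensor.const : FreeAlgebra k (Fin n) →ₐ[k] CTensor k n :=
  { (CTensor.toSeries k n).symm.toRingHom.comp PowerSeries.C with
    commutes' := fun c => (CTensor.toSeries k n).injective (CTensor.toSeries_algebraMap c).symm }

theorem CTensor.const_ι (i : Fin n) :
    CTensor.const k n (FreeAlgebra.ι k i) = CTensor.gen k i :=
  (CTensor.toSeries k n).injective rfl

variable (k n) in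
/-- The constant coefficient of a power series. -/
def CTensor.coeffZero : CTensor k n →ₐ[k] FreeAlgebra k (Fin n) :=
  { (PowerSeries.constantCoeff : (FreeAlgebra k (Fin n))⟦X⟧ →+* FreeAlgebra k (Fin n)).comp
      (CTensor.toSeries k n).toRingHom with
    commutes' := fun c => by
      show PowerSeries.constantCoeff (CTensor.toSeries k n (algebraMap k _ c)) = _
      rw [CTensor.toSeries_algebraMap, PowerSeries.constantCoeff_C] }

theorem CTensor.coeffZero_apply (x : CTensor k n) :
    CTensor.coeffZero k n x = PowerSeries.constantCoeff (CTensor.toSeries k n x) := rfl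

theorem CTensor.coeffZero_X_smul (x : CTensor k n) :
    CTensor.coeffZero k n ((PowerSeries.X : k⟦X⟧) • x) = 0 := by
  rw [CTensor.coeffZero_apply, CTensor.toSeries_X_smul, map_mul, PowerSeries.constantCoeff_X,
    zero_mul]

theorem CTensor.coeffZero_gen (i : Fin n) :
    CTensor.coeffZero k n (CTensor.gen k i) = FreeAlgebra.ι k i :=
  PowerSeries.constantCoeff_C _

theorem CTensor.eq_const_add (x : CTensor k n) :
    ∃ y, x = CTensor.const k n (CTensor.coeffZero k n x) + (PowerSeries.X : k⟦X⟧) • y := by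
  refine ⟨(CTensor.toSeries k n).symm
    (PowerSeries.mk fun r => PowerSeries.coeff (r + 1) (CTensor.toSeries k n x)),
    (CTensor.toSeries k n).injective ?_⟩
  rw [map_add, CTensor.toSeries_X_smul, RingEquiv.apply_symm_apply, add_comm]
  exact PowerSeries.eq_X_mul_shift_add_const _

/-- The augmentation of the free algebra. -/
def freeCounit (k : Type*) [Field k] (n : ℕ) : FreeAlgebra k (Fin n) →ₐ[k] k :=
  FreeAlgebra.lift k (fun _ => 0)

theorem freeCounit_polyTensor (P : MvPolynomial (Fin n) k) :
    freeCounit k n (polyTensor P) = MvPolynomial.constantCoeff P := by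
  suffices h : (freeCounit k n).toLinearMap ∘ₗ polyTensor =
      (MvPolynomial.aeval (fun _ => (0 : k))).toLinearMap by
    have := LinearMap.congr_fun h P
    rwa [AlgHom.toLinearMap_apply, MvPolynomial.aeval_zero', Algebra.algebraMap_self,
      RingHom.id_apply] at this
  refine linearMap_ext_monomial fun m => ?_
  simp only [LinearMap.comp_apply, polyTensor, constr_monomial, AlgHom.toLinearMap_apply,
    map_list_prod, List.map_ofFn, Function.comp_def, map_pow, freeCounit,
    FreeAlgebra.lift_ι_apply, MvPolynomial.aeval_monomial, List.prod_ofFn, map_one, one_mul]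
  rw [Finsupp.prod_fintype]
  simp

variable (k n) in
/-- The augmentation of the complete tensor algebra. -/
def CTensor.counit : CTensor k n →ₐ[k⟦X⟧] k⟦X⟧ :=
  { (PowerSeries.map (freeCounit k n : FreeAlgebra k (Fin n) →+* k)).comp
      (CTensor.toSeries k n).toRingHom with
    commutes' := fun c => by
      show PowerSeries.map _ (CTensor.toSeries k n (algebraMap k⟦X⟧ _ c)) = c
      rw [CTensor.toSeries_algebraMap']
      ext r
      simp }

theorem CTensor.counit_gen (i : Fin n) : CTensor.counit k n (CTensor.gen k i) = 0 := by
  show PowerSeries.map _ (PowerSeries.C _) = 0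
  simp [freeCounit]

variable (g : Fin n → Fin n → (MvPolynomial (Fin n) k)⟦X⟧)

theorem CTensor.counit_seriesTensor (p : (MvPolynomial (Fin n) k)⟦X⟧)
    (hp : ∀ r, MvPolynomial.constantCoeff (PowerSeries.coeff r p) = 0) :
    CTensor.counit k n (seriesTensor p) = 0 := by
  show PowerSeries.map _ (PowerSeries.mk _) = 0
  ext r
  simp [freeCounit_polyTensor, hp]

/-- A morphism from the complete tensor algebra to a separated ring that is compatible with the
filtrations and kills the relations factors through `U_h(𝔞)`. -/
theorem relIdeal_le_ker {B : Type*} [Ring B] (f : CTensor k n →+* B)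
    (hf : ∀ p : Fin n × Fin n, f (CTensor.gen k p.1 * CTensor.gen k p.2 -
      CTensor.gen k p.2 * CTensor.gen k p.1 - seriesTensor (g p.1 p.2)) = 0)
    (hsep : ∀ x, (∀ N, ∃ y ∈ hFilt (PowerSeries.X : k⟦X⟧) (CTensor k n) N, f x = f y) → f x = 0) :
    (relIdeal g).ringCon ≤ RingCon.ker f := by
  intro x y hxy
  rw [TwoSidedIdeal.rel_iff, relIdeal, mem_hClosure] at hxy
  have hspan : ∀ z ∈ TwoSidedIdeal.span (Set.range fun p : Fin n × Fin n =>
      CTensor.gen k p.1 * CTensor.gen k p.2 - CTensor.gen k p.2 * CTensor.gen k p.1 -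
        seriesTensor (g p.1 p.2)), f z = 0 := by
    intro z hz
    have hle : TwoSidedIdeal.span (Set.range fun p : Fin n × Fin n =>
      CTensor.gen k p.1 * CTensor.gen k p.2 - CTensor.gen k p.2 * CTensor.gen k p.1 -
        seriesTensor (g p.1 p.2)) ≤ TwoSidedIdeal.ker f := by
      rw [TwoSidedIdeal.span_le]
      rintro _ ⟨p, rfl⟩
      exact (TwoSidedIdeal.mem_ker f).2 (hf p)
    exact (TwoSidedIdeal.mem_ker f).1 (hle hz)
  rw [RingCon.ker_apply, ← sub_eq_zero, ← map_sub]
  refine hsep _ fun N => ?_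
  obtain ⟨z, hz, hxz⟩ := hxy N
  exact ⟨_, hxz, by rw [map_sub f (x - y) z, hspan z hz, sub_zero]⟩

variable {g}

theorem hFilt_powerSeries_separated {c : k⟦X⟧}
    (hc : ∀ N, c ∈ hFilt (PowerSeries.X : k⟦X⟧) k⟦X⟧ N) : c = 0 := by
  ext r
  obtain ⟨c', rfl⟩ := mem_hFilt.1 (hc (r + 1))
  rw [smul_eq_mul, PowerSeries.coeff_X_pow_mul', if_neg (by omega), map_zero]

/-- Commutators of generators die, and so does `g^⊗` for want of constant terms; separatedness of
`k⟦h⟧` extends this to the closure. -/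
theorem counit_le_ker
    (hg : ∀ i j r, MvPolynomial.constantCoeff (PowerSeries.coeff r (g i j)) = 0) :
    (relIdeal g).ringCon ≤ RingCon.ker (CTensor.counit k n).toRingHom := by
  refine relIdeal_le_ker g _ (fun p => ?_) fun x hx => ?_
  · simp [CTensor.counit_gen, CTensor.counit_seriesTensor _ (hg p.1 p.2)]
  · refine hFilt_powerSeries_separated fun N => ?_
    obtain ⟨y, hy, hxy⟩ := hx N
    rw [hxy]
    exact map_mem_hFilt _ (CTensor.counit k n).toLinearMap N y hy

/-- The augmentation of `U_h(𝔞)`. -/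
def Uh.counit (hg : ∀ i j r, MvPolynomial.constantCoeff (PowerSeries.coeff r (g i j)) = 0) :
    Uh g →ₐ[k⟦X⟧] k⟦X⟧ :=
  (relIdeal g).ringCon.liftₐ (CTensor.counit k n) (counit_le_ker hg)

theorem Uh.counit_gen (hg : ∀ i j r, MvPolynomial.constantCoeff (PowerSeries.coeff r (g i j)) = 0)
    (i : Fin n) : Uh.counit hg (Uh.gen g i) = 0 := CTensor.counit_gen i

variable (g) in
/-- The quotient map. -/
abbrev Uh.mk : CTensor k n →ₐ[k⟦X⟧] Uh g := (relIdeal g).ringCon.mkₐ k⟦X⟧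

theorem Uh.mk_surjective : Function.Surjective (Uh.mk g) := RingCon.mkₐ_surjective _

/-- The morphisms agree on constant series. Every element is a constant plus `h y`, so their
difference is divisible by every power of `h`; no continuity need be assumed. -/
theorem Uh.algHom_ext {ε ε' : Uh g →ₐ[k⟦X⟧] k⟦X⟧} (h : ∀ i, ε (Uh.gen g i) = ε' (Uh.gen g i)) :
    ε = ε' := by
  have hconst : ∀ x : FreeAlgebra k (Fin n),
      ε (Uh.mk g (CTensor.const k n x)) = ε' (Uh.mk g (CTensor.const k n x)) := by
    intro x
    have : ((ε.comp (Uh.mk g)).restrictScalars k).comp (CTensor.const k n) =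
        ((ε'.comp (Uh.mk g)).restrictScalars k).comp (CTensor.const k n) :=
      FreeAlgebra.hom_ext (funext fun i => h i)
    exact DFunLike.congr_fun this x
  have key : ∀ N (x : CTensor k n),
      ε (Uh.mk g x) - ε' (Uh.mk g x) ∈ hFilt (PowerSeries.X : k⟦X⟧) k⟦X⟧ N := by
    intro N
    induction N with
    | zero => intro x; exact mem_hFilt.2 ⟨_, by rw [pow_zero, one_smul]⟩
    | succ N ih =>
      intro x
      obtain ⟨y, hy⟩ := CTensor.eq_const_add x
      obtain ⟨c, hc⟩ := mem_hFilt.1 (ih y)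
      refine mem_hFilt.2 ⟨c, ?_⟩
      rw [hy, map_add, map_add, map_add, hconst, map_smul, map_smul, map_smul,
        add_sub_add_left_eq_sub, ← smul_sub, hc, smul_smul, pow_succ']
  refine AlgHom.ext fun u => ?_
  obtain ⟨x, rfl⟩ := Uh.mk_surjective u
  exact sub_eq_zero.1 (hFilt_powerSeries_separated fun N => key N x)

end Uh

/-! ### The reduction of `U_h(𝔞)` modulo `h` -/

section Reduction

variable {k : Type*} [Field k] {𝔞 : Type*} [LieRing 𝔞] [LieAlgebra k 𝔞] {n : ℕ}

attribute [local instance 100] LieRing.ofAssociativeRing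

/-- The map of free algebras over the enveloping algebra given by a basis. -/
def freeToEnv (e : Module.Basis (Fin n) k 𝔞) :
    FreeAlgebra k (Fin n) →ₐ[k] UniversalEnvelopingAlgebra k 𝔞 :=
  FreeAlgebra.lift k fun i => UniversalEnvelopingAlgebra.ι k (e i)

theorem freeToEnv_ι (e : Module.Basis (Fin n) k 𝔞) (i : Fin n) :
    freeToEnv e (FreeAlgebra.ι k i) = UniversalEnvelopingAlgebra.ι k (e i) :=
  FreeAlgebra.lift_ι_apply _ _

variable {g : Fin n → Fin n → (MvPolynomial (Fin n) k)⟦X⟧}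

/-- Modulo `h`, the element `(g i j)^⊗` is the bracket `[e i, e j]`. -/
abbrev LiftsBracket (e : Module.Basis (Fin n) k 𝔞)
    (g : Fin n → Fin n → (MvPolynomial (Fin n) k)⟦X⟧) : Prop :=
  ∀ i j, ∃ y : CTensor k n, seriesTensor (g i j) =
    ∑ a, e.repr ⁅e i, e j⁆ a • CTensor.gen k a + (PowerSeries.X : k⟦X⟧) • y

variable {e : Module.Basis (Fin n) k 𝔞}

/-- At `h = 0` the relations become those of `U(𝔞)`. The closure adds nothing, since multiples of
`h` already map to `0`. -/
theorem toEnv_le_ker (hg : LiftsBracket e g) :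
    (relIdeal g).ringCon ≤ RingCon.ker ((freeToEnv e).comp (CTensor.coeffZero k n)).toRingHom := by
  refine relIdeal_le_ker g _ (fun p => ?_) fun x hx => ?_
  · obtain ⟨y, hy⟩ := hg p.1 p.2
    have h1 : freeToEnv e (CTensor.coeffZero k n (seriesTensor (g p.1 p.2))) =
        UniversalEnvelopingAlgebra.ι k ⁅e p.1, e p.2⁆ := by
      rw [hy, map_add, CTensor.coeffZero_X_smul, add_zero, map_sum, map_sum]
      conv_rhs => rw [← e.sum_repr ⁅e p.1, e p.2⁆, map_sum]
      refine Finset.sum_congr rfl fun a _ => ?_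
      rw [map_smul, map_smul, CTensor.coeffZero_gen, freeToEnv_ι, map_smul]
    show freeToEnv e (CTensor.coeffZero k n _) = 0
    rw [map_sub, map_sub, map_sub, map_sub, h1, map_mul, map_mul, map_mul, map_mul,
      CTensor.coeffZero_gen, CTensor.coeffZero_gen, freeToEnv_ι, freeToEnv_ι, ι_lie, sub_self]
  · obtain ⟨y, hy, hxy⟩ := hx 1
    obtain ⟨z, rfl⟩ := mem_hFilt.1 hy
    rw [hxy, pow_one]
    show freeToEnv e (CTensor.coeffZero k n _) = 0
    rw [CTensor.coeffZero_X_smul, map_zero]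

/-- The reduction of `U_h(𝔞)` modulo `h`. -/
def Uh.toEnv (hg : LiftsBracket e g) : Uh g →ₐ[k] UniversalEnvelopingAlgebra k 𝔞 :=
  (relIdeal g).ringCon.liftₐ ((freeToEnv e).comp (CTensor.coeffZero k n)) (toEnv_le_ker hg)

theorem Uh.toEnv_mk (hg : LiftsBracket e g) (x : CTensor k n) :
    Uh.toEnv hg (Uh.mk g x) = freeToEnv e (CTensor.coeffZero k n x) := rfl

theorem Uh.toEnv_gen (hg : LiftsBracket e g) (i : Fin n) :
    Uh.toEnv hg (Uh.gen g i) = UniversalEnvelopingAlgebra.ι k (e i) := by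
  refine (Uh.toEnv_mk hg (CTensor.gen k i)).trans ?_
  rw [CTensor.coeffZero_gen, freeToEnv_ι]

theorem Uh.toEnv_X_smul (hg : LiftsBracket e g) (u : Uh g) :
    Uh.toEnv hg ((PowerSeries.X : k⟦X⟧) • u) = 0 := by
  obtain ⟨x, rfl⟩ := Uh.mk_surjective u
  rw [← map_smul, Uh.toEnv_mk, CTensor.coeffZero_X_smul, map_zero]

theorem Uh.toEnv_surjective (hg : LiftsBracket e g) : Function.Surjective (Uh.toEnv hg) := by
  intro u
  refine enveloping_mem (LinearMap.range (Uh.toEnv hg).toLinearMap) ⟨1, map_one (Uh.toEnv hg)⟩ ?_ u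
  rintro x _ ⟨v, rfl⟩
  refine ⟨(∑ i, e.repr x i • Uh.gen g i) * v, ?_⟩
  rw [AlgHom.toLinearMap_apply, AlgHom.toLinearMap_apply, map_mul]
  conv_rhs => rw [← e.sum_repr x]
  simp only [map_sum, map_smul, Uh.toEnv_gen]

variable (g) in
/-- The two-sided ideal of multiples of `h`. -/
def Uh.hIdeal : TwoSidedIdeal (Uh g) :=
  TwoSidedIdeal.mk' {u | ∃ u', u = (PowerSeries.X : k⟦X⟧) • u'} ⟨0, (smul_zero _).symm⟩
    (by rintro _ _ ⟨u, rfl⟩ ⟨v, rfl⟩; exact ⟨u + v, (smul_add _ _ _).symm⟩)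
    (by rintro _ ⟨u, rfl⟩; exact ⟨-u, (smul_neg _ _).symm⟩)
    (by rintro x _ ⟨u, rfl⟩; exact ⟨x * u, mul_smul_comm _ _ _⟩)
    (by rintro _ x ⟨u, rfl⟩; exact ⟨u * x, smul_mul_assoc _ _ _⟩)

theorem Uh.mem_hIdeal {u : Uh g} :
    u ∈ Uh.hIdeal g ↔ ∃ u', u = (PowerSeries.X : k⟦X⟧) • u' := TwoSidedIdeal.mem_mk' ..

variable (g) in
/-- The quotient map `U_h(𝔞) → U_h(𝔞) / h U_h(𝔞)`. -/
abbrev Uh.quot : Uh g →ₐ[k] (Uh.hIdeal g).ringCon.Quotient := (Uh.hIdeal g).ringCon.mkₐ k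

theorem Uh.quot_eq_zero {u : Uh g} :
    Uh.quot g u = 0 ↔ ∃ u', u = (PowerSeries.X : k⟦X⟧) • u' := by
  rw [← Uh.mem_hIdeal, TwoSidedIdeal.mem_iff]
  exact (Uh.hIdeal g).ringCon.eq

theorem Uh.gen_mul_gen_sub (i j : Fin n) :
    Uh.gen g i * Uh.gen g j - Uh.gen g j * Uh.gen g i = Uh.mk g (seriesTensor (g i j)) := by
  have hmem : CTensor.gen k i * CTensor.gen k j - CTensor.gen k j * CTensor.gen k i -
      seriesTensor (g i j) ∈ relIdeal g := by
    rw [relIdeal, mem_hClosure]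
    exact fun N => ⟨_, TwoSidedIdeal.subset_span ⟨(i, j), rfl⟩, by
      rw [sub_self]; exact zero_mem _⟩
  rw [TwoSidedIdeal.mem_iff] at hmem
  have := (relIdeal g).ringCon.eq.2 hmem
  exact sub_eq_zero.1 this

theorem Uh.quot_lie (hg : LiftsBracket e g) (x y : 𝔞) :
    e.constr k (fun i => Uh.quot g (Uh.gen g i)) ⁅x, y⁆ =
      ⁅e.constr k (fun i => Uh.quot g (Uh.gen g i)) x,
        e.constr k (fun i => Uh.quot g (Uh.gen g i)) y⁆ := by
  set f := e.constr k (fun i => Uh.quot g (Uh.gen g i)) with hf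
  suffices h : (LieModule.toEnd k 𝔞 𝔞).toLinearMap.compr₂ f =
      (LieModule.toEnd k (Uh.hIdeal g).ringCon.Quotient
        (Uh.hIdeal g).ringCon.Quotient).toLinearMap.compl₁₂ f f from
    LinearMap.congr_fun (LinearMap.congr_fun h x) y
  refine e.ext fun i => e.ext fun j => ?_
  show f ⁅e i, e j⁆ = ⁅f (e i), f (e j)⁆
  obtain ⟨y, hy⟩ := hg i j
  have h1 : Uh.quot g (Uh.mk g (seriesTensor (g i j))) = f ⁅e i, e j⁆ := by
    rw [hy, map_add, map_add, map_smul, Uh.quot_eq_zero.2 ⟨_, rfl⟩, add_zero]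
    conv_rhs => rw [← e.sum_repr ⁅e i, e j⁆, map_sum]
    rw [map_sum, map_sum]
    refine Finset.sum_congr rfl fun a _ => ?_
    rw [map_smul f, hf, Module.Basis.constr_basis]
    exact map_smul (Uh.quot g) _ (Uh.gen g a)
  rw [hf, Module.Basis.constr_basis, Module.Basis.constr_basis, ← hf, Ring.lie_def, ← map_mul,
    ← map_mul, ← map_sub, Uh.gen_mul_gen_sub, h1]

/-- The inverse of the map `U_h(𝔞) / h U_h(𝔞) → U(𝔞)` induced by the reduction. -/
def envToQuot (hg : LiftsBracket e g) :
    UniversalEnvelopingAlgebra k 𝔞 →ₐ[k] (Uh.hIdeal g).ringCon.Quotient :=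
  UniversalEnvelopingAlgebra.lift k
    { e.constr k (fun i => Uh.quot g (Uh.gen g i)) with
      map_lie' := fun {x y} => Uh.quot_lie hg x y }

/-- Modulo `h` every element is a noncommutative polynomial in the generators, on which both maps
agree. -/
theorem envToQuot_toEnv (hg : LiftsBracket e g) (u : Uh g) :
    envToQuot hg (Uh.toEnv hg u) = Uh.quot g u := by
  obtain ⟨x, rfl⟩ := Uh.mk_surjective u
  obtain ⟨y, hy⟩ := CTensor.eq_const_add x
  have h1 : Uh.quot g (Uh.mk g x) =
      Uh.quot g (Uh.mk g (CTensor.const k n (CTensor.coeffZero k n x))) := by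
    conv_lhs => rw [hy, map_add, map_add, map_smul, Uh.quot_eq_zero.2 ⟨_, rfl⟩, add_zero]
  rw [h1, Uh.toEnv_mk]
  have h2 : (envToQuot hg).comp (freeToEnv e) =
      ((Uh.quot g).comp ((Uh.mk g).restrictScalars k)).comp (CTensor.const k n) := by
    refine FreeAlgebra.hom_ext (funext fun i => ?_)
    show envToQuot hg (freeToEnv e (FreeAlgebra.ι k i)) =
      Uh.quot g (Uh.mk g (CTensor.const k n (FreeAlgebra.ι k i)))
    rw [freeToEnv_ι, CTensor.const_ι, envToQuot, UniversalEnvelopingAlgebra.lift_ι_apply]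
    exact e.constr_basis k _ i
  exact DFunLike.congr_fun h2 _

/-- The universal property of `U(𝔞)` gives a map back to the quotient by `h`, so whatever `Uh.toEnv`
kills is a multiple of `h`. -/
theorem Uh.isReduction_toEnv (hg : LiftsBracket e g) :
    IsReduction (PowerSeries.X : k⟦X⟧) (Uh.toEnv hg).toLinearMap.toAddMonoidHom where
  surjective := Uh.toEnv_surjective hg
  exists_of_eq_zero u hu := by
    refine Uh.quot_eq_zero.1 ?_
    have hu : Uh.toEnv hg u = 0 := hu
    rw [← envToQuot_toEnv hg, hu, map_zero]
  map_smul := Uh.toEnv_X_smul hg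

end Reduction

/-! ### Lifting the Koszul resolution -/

section LiftKoszul

variable {k : Type*} [Field k] [CharZero k] {𝔞 : Type*} [LieRing 𝔞] [LieAlgebra k 𝔞]

attribute [local instance 100] LieRing.ofAssociativeRing

variable {S : Type*} [CommRing S] [Algebra k S] {h : S} {A : Type*} [Ring A] [Algebra S A]
  [Algebra k A] [IsScalarTower k S A]

/-- The map `A ⊗ ⋀^q 𝔞 → U(𝔞) ⊗ ⋀^q 𝔞` induced by `p : A → U(𝔞)`. -/
def koszulRed (p : A →ₐ[k] UniversalEnvelopingAlgebra k 𝔞) (q : ℕ) :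
    KoszulMod k 𝔞 A q →ₗ[k] KoszulMod k 𝔞 (UniversalEnvelopingAlgebra k 𝔞) q :=
  p.toLinearMap.rTensor _

omit [CharZero k] in
@[simp] theorem koszulRed_tmul (p : A →ₐ[k] UniversalEnvelopingAlgebra k 𝔞) (q : ℕ) (a : A)
    (w : ⋀[k]^q 𝔞) : koszulRed p q (a ⊗ₜ w) = p a ⊗ₜ w := rfl

omit [CharZero k] in
theorem koszulRed_smul (p : A →ₐ[k] UniversalEnvelopingAlgebra k 𝔞) (q : ℕ) (a : A)
    (m : KoszulMod k 𝔞 A q) : koszulRed p q (a • m) = p a • koszulRed p q m := by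
  induction m using TensorProduct.induction_on with
  | zero => simp
  | tmul b w =>
    rw [TensorProduct.smul_tmul', koszulRed_tmul, koszulRed_tmul, TensorProduct.smul_tmul',
      smul_eq_mul, smul_eq_mul, map_mul]
  | add m m' hm hm' => rw [smul_add, map_add, map_add, hm, hm', smul_add]

omit [CharZero k] in
theorem koszulZeroEquiv_koszulRed (p : A →ₐ[k] UniversalEnvelopingAlgebra k 𝔞) (m : KoszulMod k 𝔞 A 0) :
    koszulZeroEquiv k 𝔞 (UniversalEnvelopingAlgebra k 𝔞) (koszulRed p 0 m) =
      p (koszulZeroEquiv k 𝔞 A m) := by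
  suffices H : (koszulZeroEquiv k 𝔞 (UniversalEnvelopingAlgebra k 𝔞)).toLinearMap.restrictScalars
      k ∘ₗ koszulRed p 0 =
      p.toLinearMap ∘ₗ (koszulZeroEquiv k 𝔞 A).toLinearMap.restrictScalars k from
    LinearMap.congr_fun H m
  refine koszulMod_hom_ext fun u X => ?_
  simp only [LinearMap.comp_apply, LinearMap.restrictScalars_apply, LinearEquiv.coe_coe,
    koszulZeroEquiv_tmul, koszulRed_tmul, AlgHom.toLinearMap_apply]

omit [CharZero k] in
theorem IsReduction.koszulRed {p : A →ₐ[k] UniversalEnvelopingAlgebra k 𝔞}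
    (hp : IsReduction h p.toLinearMap.toAddMonoidHom) (q : ℕ) :
    IsReduction h (koszulRed p q).toAddMonoidHom := hp.rTensor _

/-- One step of the construction: the values of the differential on `1 ⊗ w` are lifted to cycles by
`exists_lift_to_ker` and extended `A`-linearly; exactness follows from `exact_of_exact_mod`. -/
theorem exists_lift_koszulD [Module.Finite k 𝔞] (hA : IsHFree h A)
    {p : A →ₐ[k] UniversalEnvelopingAlgebra k 𝔞}
    (hp : IsReduction h p.toLinearMap.toAddMonoidHom) {M₀ N₀ : Type*} [AddCommGroup M₀]
    [Module S M₀] [Module A M₀] [IsScalarTower S A M₀] [AddCommGroup N₀]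
    (hM₀ : ∀ m : M₀, h • m = 0 → m = 0) (π₀ : M₀ →+ N₀) (hπ₀ : ∀ m, π₀ m = 0 → ∃ m', m = h • m')
    (q : ℕ) (d : KoszulMod k 𝔞 A q →ₗ[A] M₀) (hd : HasSaturatedRange h (d.restrictScalars S))
    (D : KoszulMod k 𝔞 (UniversalEnvelopingAlgebra k 𝔞) q →+ N₀)
    (hdD : ∀ m, π₀ (d m) = D (koszulRed p q m)) (hD : Function.Exact (envD k 𝔞 q) D) :
    ∃ d' : KoszulMod k 𝔞 A (q + 1) →ₗ[A] KoszulMod k 𝔞 A q,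
      (∀ m, koszulRed p q (d' m) = envD k 𝔞 q (koszulRed p (q + 1) m)) ∧ Function.Exact d' d := by
  let f : ⋀[k]^(q + 1) 𝔞 →ₗ[k] KoszulMod k 𝔞 (UniversalEnvelopingAlgebra k 𝔞) q :=
    (envD k 𝔞 q).restrictScalars k ∘ₗ TensorProduct.mk k _ _ 1
  obtain ⟨f', hf', hf⟩ := exists_lift_to_ker d hd π₀ (koszulRed p q) (hp.koszulRed q).surjective hπ₀
    (hp.koszulRed q).map_smul D hdD f fun w => (hD _).2 ⟨1 ⊗ₜ w, rfl⟩
  have hcompat : ∀ m, koszulRed p q (extendScalars f' m) =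
      envD k 𝔞 q (koszulRed p (q + 1) m) := by
    intro m
    induction m using TensorProduct.induction_on with
    | zero => simp
    | tmul a w =>
      rw [extendScalars_tmul, koszulRed_smul, hf, koszulRed_tmul]
      show p a • envD k 𝔞 q (1 ⊗ₜ w) = _
      rw [← map_smul, TensorProduct.smul_tmul', smul_eq_mul, mul_one]
    | add m m' hm hm' => simp only [map_add, hm, hm']
  have hzero : ∀ m : KoszulMod k 𝔞 A (q + 1), d (extendScalars f' m) = 0 := by
    intro m
    induction m using TensorProduct.induction_on with
    | zero => simp
    | tmul a w => rw [extendScalars_tmul, map_smul, hf', smul_zero]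
    | add m m' hm hm' => rw [map_add, map_add, hm, hm', add_zero]
  refine ⟨extendScalars f', hcompat, ?_⟩
  exact exact_of_exact_mod hM₀ (hA.tensor (⋀[k]^q 𝔞)).separated (hA.tensor (⋀[k]^(q + 1) 𝔞))
    (d.restrictScalars S) ((extendScalars f').restrictScalars S) hzero π₀
    (koszulRed p q).toAddMonoidHom (koszulRed p (q + 1)).toAddMonoidHom
    (hp.koszulRed (q + 1)).surjective (hp.koszulRed q).exists_of_eq_zero D
    (envD k 𝔞 q).toAddMonoidHom hD hdD hcompat

/-- The recursion starts at the augmentation, whose range is saturated by surjectivity; later ranges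
are saturated by the exactness just obtained. -/
theorem exists_lift_koszulResolution {n : ℕ} (e : Module.Basis (Fin n) k 𝔞) (hA : IsHFree h A)
    {p : A →ₐ[k] UniversalEnvelopingAlgebra k 𝔞}
    (hp : IsReduction h p.toLinearMap.toAddMonoidHom) (hS : ∀ s : S, h • s = 0 → s = 0)
    {π₀ : S →+* k} (hπ₀ : IsReduction h π₀.toAddMonoidHom) (ε : A →ₐ[S] S)
    (hε : ∀ a, π₀ (ε a) = envCounit k 𝔞 (p a)) :
    ∃ d : ∀ q, KoszulMod k 𝔞 A (q + 1) →ₗ[A] KoszulMod k 𝔞 A q,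
      (∀ q m, koszulRed p q (d q m) = envD k 𝔞 q (koszulRed p (q + 1) m)) ∧
      IsResolution (KoszulMod k 𝔞 A) d (koszulAug k 𝔞 (ε : A →+* S)) := by
  have : Module.Finite k 𝔞 := Module.Finite.of_basis e
  have hsurj : Function.Surjective (koszulAug k 𝔞 (ε : A →+* S)) := fun s =>
    ⟨(koszulZeroEquiv k 𝔞 A).symm (algebraMap S A ((AugModule.of _).symm s)), by
      rw [koszulAug_apply, LinearEquiv.apply_symm_apply]
      exact (AddEquiv.eq_symm_apply _).1 (ε.commutes _)⟩
  obtain ⟨d₀, hd₀, hexact₀⟩ := exists_lift_koszulD hA hp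
    (M₀ := AugModule (ε : A →+* S)) hS π₀.toAddMonoidHom hπ₀.exists_of_eq_zero 0
    (koszulAug k 𝔞 (ε : A →+* S)) (fun y _ => hsurj y)
    ((envCounit k 𝔞).toLinearMap.toAddMonoidHom.comp
      (koszulZeroEquiv k 𝔞 (UniversalEnvelopingAlgebra k 𝔞)).toLinearMap.toAddMonoidHom)
    (fun m => by
      rw [koszulAug_apply]
      refine (hε _).trans ?_
      rw [← koszulZeroEquiv_koszulRed]
      rfl)
    (fun z => ⟨fun hz => by
      obtain ⟨x, hx⟩ := exists_envD_of_envCounit_eq_zero hz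
      exact ⟨x, (koszulZeroEquiv k 𝔞 _).injective hx⟩, by
      rintro ⟨x, rfl⟩
      exact envCounit_envD x⟩)
  -- Each differential is carried with its reduction and saturation, exactly what the next step
  -- needs.
  let T (q : ℕ) : Type _ := {d : KoszulMod k 𝔞 A (q + 1) →ₗ[A] KoszulMod k 𝔞 A q //
    (∀ m, koszulRed p q (d m) = envD k 𝔞 q (koszulRed p (q + 1) m)) ∧
      HasSaturatedRange h (d.restrictScalars S)}
  have htors : ∀ q, ∀ m : KoszulMod k 𝔞 A q, h • m = 0 → m = 0 := fun q =>
    (hA.tensor (⋀[k]^q 𝔞)).torsion_free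
  have step : ∀ q (d : T q), ∃ d' : T (q + 1), Function.Exact d'.1 d.1 := by
    rintro q ⟨d, hd, hsat⟩
    obtain ⟨d', hd', hexact⟩ := exists_lift_koszulD hA hp (htors q)
      (koszulRed p q).toAddMonoidHom (hp.koszulRed q).exists_of_eq_zero (q + 1) d hsat
      (envD k 𝔞 q).toAddMonoidHom hd (envD_exact e q)
    exact ⟨⟨d', hd', hasSaturatedRange_of_exact (d := d.restrictScalars S) (htors q) hexact⟩,
      hexact⟩
  choose next hnext using step
  let t₀ : T 0 := ⟨d₀, hd₀, hasSaturatedRange_of_exact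
    (d := (koszulAug k 𝔞 (ε : A →+* S)).restrictScalars S) hS hexact₀⟩
  let t : ∀ q, T q := Nat.rec t₀ next
  exact ⟨fun q => (t q).1, fun q => (t q).2.1, hsurj, hexact₀, fun q => hnext q (t q)⟩

end LiftKoszul

/-! ### The associated graded of the lifted resolution -/

section GrRing

variable {S : Type*} [CommRing S] {h : S} {A : Type*} [Ring A] [Algebra S A]

theorem exists_grRingEquiv (hA : ∀ a : A, h • a = 0 → a = 0) {B : Type*} [Ring B] {p : A →+* B}
    (hp : IsReduction h p.toAddMonoidHom) :
    ∃ Θ : Gr h A ≃+* B[X], ∀ t a, Θ (grSymb h t a) = Polynomial.monomial t (p a) := by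
  obtain ⟨Φ, hΦ⟩ := exists_grEquiv hA hp (isPolynomialGroup_polynomial B)
  have hΦ : ∀ t a, Φ (grSymb h t a) = Polynomial.monomial t (p a) := hΦ
  refine ⟨{ Φ with map_mul' := fun x y => ?_ }, hΦ⟩
  show Φ (x * y) = Φ x * Φ y
  induction x using gr_induction with
  | zero => simp
  | add x x' hx hx' => rw [add_mul, map_add, map_add, hx, hx', add_mul]
  | symb s a =>
    induction y using gr_induction with
    | zero => simp
    | add y y' hy hy' => rw [mul_add, map_add, map_add, hy, hy', mul_add]
    | symb t b =>
      rw [grSymb_mul_grSymb, hΦ, hΦ, hΦ, Polynomial.monomial_mul_monomial, map_mul]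

variable {M : Type*} [AddCommGroup M] [Module S M] [Module A M] [IsScalarTower S A M]

theorem gr_map_smul {C P : Type*} [Ring C] [AddCommGroup P] [Module C P] (Θ : Gr h A ≃+* C)
    (Ψ : Gr h M ≃+ P)
    (H : ∀ s t (a : A) (m : M), Ψ (grSymb h (s + t) (a • m)) =
      Θ (grSymb h s a) • Ψ (grSymb h t m)) (x : Gr h A) (y : Gr h M) :
    Ψ (x • y) = Θ x • Ψ y := by
  induction x using gr_induction with
  | zero => rw [zero_smul, map_zero, map_zero, zero_smul]
  | add x x' hx hx' => rw [add_smul, map_add, map_add, hx, hx', add_smul]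
  | symb s a =>
    induction y using gr_induction with
    | zero => rw [smul_zero, map_zero, smul_zero]
    | add y y' hy hy' => rw [smul_add, map_add, map_add, hy, hy', smul_add]
    | symb t m => rw [grSymb_smul_grSymb, H]

end GrRing

/-! ### Comparison of the graded complex with the Koszul complex -/

section Main

variable {k : Type*} [Field k] {𝔞 : Type*} [LieRing 𝔞] [LieAlgebra k 𝔞] {n : ℕ}

attribute [local instance 100] LieRing.ofAssociativeRing

theorem isReduction_constantCoeff : IsReduction (PowerSeries.X : k⟦X⟧)
    (PowerSeries.constantCoeff : k⟦X⟧ →+* k).toAddMonoidHom where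
  surjective c := ⟨PowerSeries.C c, PowerSeries.constantCoeff_C c⟩
  exists_of_eq_zero m hm := PowerSeries.X_dvd_iff.2 hm
  map_smul m := by
    show PowerSeries.constantCoeff (PowerSeries.X * m) = 0
    rw [map_mul, PowerSeries.constantCoeff_X, zero_mul]

theorem tensorMonomial_smul (s t : ℕ) {B : Type*} [Ring B] [Algebra k B] {W : Type*}
    [AddCommGroup W] [Module k W] (b : B) (z : B ⊗[k] W) :
    tensorMonomial W (s + t) (b • z) = Polynomial.monomial s b • tensorMonomial W t z := by
  induction z using TensorProduct.induction_on with
  | zero => simp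
  | tmul b' w =>
    rw [TensorProduct.smul_tmul', tensorMonomial_tmul, tensorMonomial_tmul,
      TensorProduct.smul_tmul', smul_eq_mul, smul_eq_mul, Polynomial.monomial_mul_monomial]
  | add z z' hz hz' => rw [smul_add, map_add, map_add, hz, hz', smul_add]

theorem koszulZeroEquiv_tensorMonomial (t : ℕ)
    (z : KoszulMod k 𝔞 (UniversalEnvelopingAlgebra k 𝔞) 0) :
    koszulZeroEquiv k 𝔞 (UPoly k 𝔞) (tensorMonomial _ t z) =
      Polynomial.monomial t (koszulZeroEquiv k 𝔞 (UniversalEnvelopingAlgebra k 𝔞) z) := by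
  refine Polynomial.ext fun s => ?_
  rw [coeff_koszulZeroEquiv, tensorCoeff_tensorMonomial, Polynomial.coeff_monomial]
  split_ifs
  · rfl
  · exact (koszulZeroEquiv k 𝔞 (UniversalEnvelopingAlgebra k 𝔞)).map_zero

theorem counit_monomial (t : ℕ) (u : UniversalEnvelopingAlgebra k 𝔞) :
    UPoly.counit k 𝔞 (Polynomial.monomial t u) = Polynomial.monomial t (envCounit k 𝔞 u) :=
  Polynomial.map_monomial _

-- Every identity is checked on symbols of `h ^ t m`, which go to `h ^ t` times the reduction of
-- `m`; the compatibilities modulo `h` then give those over `k[h]`.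
set_option maxHeartbeats 1600000 in
theorem exists_grKoszulEquiv [CharZero k] [Module.Finite k 𝔞] {S : Type*} [CommRing S]
    [Algebra k S] {h : S} {A : Type*} [Ring A] [Algebra S A] [Algebra k A] [IsScalarTower k S A]
    (hA : IsHFree h A) {p : A →ₐ[k] UniversalEnvelopingAlgebra k 𝔞}
    (hp : IsReduction h p.toLinearMap.toAddMonoidHom) (hS : ∀ s : S, h • s = 0 → s = 0)
    {π₀ : S →+* k} (hπ₀ : IsReduction h π₀.toAddMonoidHom) (ε : A →ₐ[S] S)
    (hε : ∀ a, π₀ (ε a) = envCounit k 𝔞 (p a))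
    (d : ∀ q, KoszulMod k 𝔞 A (q + 1) →ₗ[A] KoszulMod k 𝔞 A q)
    (hd : ∀ q m, koszulRed p q (d q m) = envD k 𝔞 q (koszulRed p (q + 1) m)) :
    ∃ (Θ : Gr h A ≃+* UPoly k 𝔞) (Ψ : ∀ q, Gr h (KoszulMod k 𝔞 A q) ≃+ KoszulMod k 𝔞 (UPoly k 𝔞) q)
      (Ψ' : Gr h (AugModule (ε : A →+* S)) ≃+ AugModule (UPoly.counit k 𝔞)),
      (∀ t a, Θ (grSymb h t a) = Polynomial.monomial t (p a)) ∧
      (∀ q a m, Ψ q (a • m) = Θ a • Ψ q m) ∧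
      (∀ q (w : ⋀[k]^q 𝔞), Ψ q (grSymb h 0 ((1 : A) ⊗ₜ[k] w)) = (1 : UPoly k 𝔞) ⊗ₜ[k] w) ∧
      (∀ (a : Gr h A) m, Ψ' (a • m) = Θ a • Ψ' m) ∧
      Ψ' (grSymb h 0 (AugModule.of _ 1)) = AugModule.of _ 1 ∧
      (∀ q x, Ψ q (grMap h ((d q).restrictScalars S) x) = koszulD (upolyι k 𝔞) q (Ψ (q + 1) x)) ∧
      (∀ x, Ψ' (grMap h ((koszulAug k 𝔞 (ε : A →+* S)).restrictScalars S) x) =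
        koszulAug k 𝔞 (UPoly.counit k 𝔞) (Ψ 0 x)) := by
  obtain ⟨Θ, hΘ⟩ := exists_grRingEquiv hA.torsion_free (p := p.toRingHom) ⟨hp.1, hp.2, hp.3⟩
  choose Ψ hΨ using fun q => exists_grEquiv (hA.tensor (⋀[k]^q 𝔞)).torsion_free (hp.koszulRed q)
    (isPolynomialGroup_tensor (k := k) (UniversalEnvelopingAlgebra k 𝔞) (⋀[k]^q 𝔞))
  obtain ⟨Φ, hΦ⟩ := exists_grEquiv (M := AugModule (ε : A →+* S)) hS
    (π := π₀.toAddMonoidHom.comp (AugModule.of (ε : A →+* S)).symm.toAddMonoidHom) ⟨hπ₀.1, hπ₀.2, hπ₀.3⟩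
    (isPolynomialGroup_polynomial k)
  let Ψ' : Gr h (AugModule (ε : A →+* S)) ≃+ AugModule (UPoly.counit k 𝔞) :=
    Φ.trans (AugModule.of (UPoly.counit k 𝔞))
  have hΘ : ∀ t a, Θ (grSymb h t a) = Polynomial.monomial t (p a) := hΘ
  have hΨ : ∀ q t m, Ψ q (grSymb h t m) = tensorMonomial _ t (koszulRed p q m) := hΨ
  have hΨ' : ∀ t m, Ψ' (grSymb h t (AugModule.of _ m)) =
      AugModule.of _ (Polynomial.monomial t (π₀ m)) := fun t m => 
    congrArg (AugModule.of (UPoly.counit k 𝔞)) (hΦ t m)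
  refine ⟨Θ, Ψ, Ψ', hΘ, fun q => ?_, fun q w => ?_, ?_, ?_, fun q x => ?_, fun x => ?_⟩
  · refine gr_map_smul Θ (Ψ q) fun s t a m => ?_
    rw [hΨ, hΨ, hΘ, koszulRed_smul, tensorMonomial_smul]
  · rw [hΨ, koszulRed_tmul, map_one, tensorMonomial_tmul, Polynomial.monomial_zero_one]
  · refine gr_map_smul Θ Ψ' fun s t a m => ?_
    obtain ⟨c, rfl⟩ := (AugModule.of _).surjective m
    have h1 : a • AugModule.of (ε : A →+* S) c = AugModule.of _ (ε a * c) := rfl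
    have h2 : ∀ (P : UPoly k 𝔞) Q, P • AugModule.of (UPoly.counit k 𝔞) Q =
      AugModule.of _ (UPoly.counit k 𝔞 P * Q) := fun _ _ => rfl
    rw [h1, hΨ', hΨ', hΘ, h2, counit_monomial, Polynomial.monomial_mul_monomial, map_mul, hε]
  · rw [hΨ', map_one, Polynomial.monomial_zero_one]
  · induction x using gr_induction with
    | zero => simp only [map_zero]
    | add x y hx hy => simp only [map_add, hx, hy]
    | symb t m =>
      rw [grMap_grSymb, hΨ, hΨ, LinearMap.restrictScalars_apply, hd, tensorMonomial_koszulD]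
  · induction x using gr_induction with
    | zero => rw [AddMonoidHom.map_zero, AddEquiv.map_zero, AddEquiv.map_zero, LinearMap.map_zero]
    | add x y hx hy =>
      rw [AddMonoidHom.map_add, AddEquiv.map_add, AddEquiv.map_add, hx, hy, LinearMap.map_add]
    | symb t m =>
      rw [grMap_grSymb, hΨ, LinearMap.restrictScalars_apply, koszulAug_apply, koszulAug_apply, hΨ',
        koszulZeroEquiv_tensorMonomial, counit_monomial, koszulZeroEquiv_koszulRed, ← hε]
      rfl

variable {e : Module.Basis (Fin n) k 𝔞} {g : Fin n → Fin n → (MvPolynomial (Fin n) k)⟦X⟧}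

/-- Both sides are the augmentation of the free algebra at the constant coefficient. This
compatibility lets the lifting start at `ε`. -/
theorem constantCoeff_counit
    (hg : ∀ i j r, MvPolynomial.constantCoeff (PowerSeries.coeff r (g i j)) = 0)
    (hl : LiftsBracket e g) (u : Uh g) :
    PowerSeries.constantCoeff (Uh.counit hg u) = envCounit k 𝔞 (Uh.toEnv hl u) := by
  obtain ⟨x, rfl⟩ := Uh.mk_surjective u
  have h1 : (envCounit k 𝔞).comp (freeToEnv e) = freeCounit k n :=
    FreeAlgebra.hom_ext (funext fun i => by
      show envCounit k 𝔞 (freeToEnv e (FreeAlgebra.ι k i)) = freeCounit k n (FreeAlgebra.ι k i)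
      rw [freeToEnv_ι, envCounit_ι, freeCounit, FreeAlgebra.lift_ι_apply])
  rw [Uh.toEnv_mk]
  refine Eq.trans ?_ (DFunLike.congr_fun h1 (CTensor.coeffZero k n x)).symm
  exact MvPowerSeries.constantCoeff_map (freeCounit k n : FreeAlgebra k (Fin n) →+* k)
    (CTensor.toSeries k n x)

end Main

end QKoszul

end

open QKoszul
theorem mainTheorem8 {k : Type*} [Field k] [CharZero k] {𝔞 : Type*} [LieRing 𝔞] [LieAlgebra k 𝔞]
    {n : ℕ} (e : Module.Basis (Fin n) k 𝔞)
    (g : Fin n → Fin n → PowerSeries (MvPolynomial (Fin n) k))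
    -- the polynomials occurring in `g i j` have no constant term
    (hg_order : ∀ i j r, MvPolynomial.constantCoeff (PowerSeries.coeff r (g i j)) = 0)
    -- modulo `h`, the element `(g i j)^⊗` is the bracket `[e i, e j]`
    (hg_lift : ∀ i j, ∃ y : CTensor k n, seriesTensor (g i j) =
      ∑ a, e.repr ⁅e i, e j⁆ a • CTensor.gen k a + (PowerSeries.X : PowerSeries k) • y)
    (hdef : IsDeformation k (UniversalEnvelopingAlgebra k 𝔞) (Uh g)) :
    -- the trivial module `k⟦h⟧`
    ∃ ε : Uh g →ₐ[PowerSeries k] PowerSeries k,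
      (∀ i, ε (Uh.gen g i) = 0) ∧
      (∀ ε' : Uh g →ₐ[PowerSeries k] PowerSeries k, (∀ i, ε' (Uh.gen g i) = 0) → ε' = ε) ∧
      -- a resolution `K_h` of the trivial module by the modules `U_h(𝔞) ⊗ ⋀^q 𝔞`
      ∃ (d : ∀ q : ℕ, KoszulMod k 𝔞 (Uh g) (q + 1) →ₗ[Uh g] KoszulMod k 𝔞 (Uh g) q)
        (η : KoszulMod k 𝔞 (Uh g) 0 →ₗ[Uh g] AugModule (ε : Uh g →+* PowerSeries k)),
        IsKoszulAugmentation k (ε : Uh g →+* PowerSeries k) η ∧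
        IsResolution (KoszulMod k 𝔞 (Uh g)) d η ∧
        -- the Koszul resolution of the trivial `U(𝔞)[h]`-module `k[h]`
        ∃ (D : ∀ q : ℕ, KoszulMod k 𝔞 (UPoly k 𝔞) (q + 1) →ₗ[UPoly k 𝔞]
              KoszulMod k 𝔞 (UPoly k 𝔞) q)
          (H : KoszulMod k 𝔞 (UPoly k 𝔞) 0 →ₗ[UPoly k 𝔞] AugModule (UPoly.counit k 𝔞)),
          IsKoszulDifferential k (UPoly.ι k 𝔞) D ∧
          IsKoszulAugmentation k (UPoly.counit k 𝔞) H ∧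
          IsResolution (KoszulMod k 𝔞 (UPoly k 𝔞)) D H ∧
          -- the graded ring isomorphism `Gr U_h(𝔞) ≃ U(𝔞)[h]`
          ∃ Θ : Gr (PowerSeries.X : PowerSeries k) (Uh g) ≃+* UPoly k 𝔞,
            (∀ t x, ∃ u, Θ (DirectSum.of _ t x) = Polynomial.monomial t u) ∧
            (∀ c : k, Θ (grSymb _ 0 (algebraMap k (Uh g) c)) = algebraMap k (UPoly k 𝔞) c) ∧
            (∀ i, Θ (grSymb _ 0 (Uh.gen g i)) = UPoly.ι k 𝔞 (e i)) ∧
            Θ (grSymb _ 1 1) = Polynomial.X ∧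
            -- the isomorphism over `Θ` of `Gr K_h` with the Koszul resolution
            ∃ (Ψ : ∀ q : ℕ, Gr (PowerSeries.X : PowerSeries k) (KoszulMod k 𝔞 (Uh g) q) ≃+
                KoszulMod k 𝔞 (UPoly k 𝔞) q)
              (Ψ' : Gr (PowerSeries.X : PowerSeries k)
                  (AugModule (ε : Uh g →+* PowerSeries k)) ≃+ AugModule (UPoly.counit k 𝔞)),
              (∀ q a m, Ψ q (a • m) = Θ a • Ψ q m) ∧
              (∀ (q : ℕ) (w : ⋀[k]^q 𝔞),
                Ψ q (grSymb _ 0 ((1 : Uh g) ⊗ₜ[k] w)) = (1 : UPoly k 𝔞) ⊗ₜ[k] w) ∧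
              (∀ (a : Gr (PowerSeries.X : PowerSeries k) (Uh g)) m, Ψ' (a • m) = Θ a • Ψ' m) ∧
              Ψ' (grSymb _ 0 (AugModule.of _ 1)) = AugModule.of _ 1 ∧
              (∀ q x, Ψ q (grMap _ ((d q).restrictScalars (PowerSeries k)) x) =
                D q (Ψ (q + 1) x)) ∧
              (∀ x, Ψ' (grMap _ (η.restrictScalars (PowerSeries k)) x) = H (Ψ 0 x)) := by
  have : Module.Finite k 𝔞 := Module.Finite.of_basis e
  have hA := hdef.1.isHFree
  have hp := Uh.isReduction_toEnv (e := e) hg_lift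
  have hε := constantCoeff_counit (e := e) hg_order hg_lift
  have hS : ∀ s : PowerSeries k, (PowerSeries.X : PowerSeries k) • s = 0 → s = 0 := fun s hs =>
    (mul_eq_zero.1 hs).resolve_left PowerSeries.X_ne_zero
  obtain ⟨d, hd, hres⟩ := exists_lift_koszulResolution e hA hp hS isReduction_constantCoeff
    (Uh.counit hg_order) hε
  obtain ⟨Θ, Ψ, Ψ', hΘ, hΨ⟩ := exists_grKoszulEquiv hA hp hS isReduction_constantCoeff
    (Uh.counit hg_order) hε d hd
  refine ⟨Uh.counit hg_order, Uh.counit_gen hg_order, fun ε' hε' => Uh.algHom_ext fun i =>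
    (hε' i).trans (Uh.counit_gen hg_order i).symm, d, koszulAug k 𝔞 _,
    isKoszulAugmentation_koszulAug _, hres, koszulD (upolyι k 𝔞), koszulAug k 𝔞 _,
    isKoszulDifferential_koszulD (upolyι k 𝔞), isKoszulAugmentation_koszulAug _,
    isResolution_upoly e, Θ, fun t x => ?_, fun c => ?_, fun i => ?_, ?_, Ψ, Ψ', hΨ⟩
  · obtain ⟨a, rfl⟩ := grPieceSymb_surjective _ t x
    exact ⟨_, hΘ t a⟩
  · rw [hΘ, AlgHom.commutes, Polynomial.monomial_zero_left, Polynomial.algebraMap_apply]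
  · rw [hΘ, Uh.toEnv_gen, Polynomial.monomial_zero_left]
    rfl
  · rw [hΘ, map_one, Polynomial.monomial_one_one_eq_X]
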